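/- **Setting.** Identify $\mathbb R^2$ with its standard inner product and orientation; $J$ is the rotation by $+\frac{\pi}{2}$. For a regular plane curve $f:[a,b]\to\mathbb R^2$ let $\tau=\partial_pf/|\partial_pf|$ be its tangent, $\nu=J\tau$ its normal, $\kappa=\langle\partial_p^2f,\nu\rangle/|\partial_pf|^2$ its curvature, $ds=|\partial_pf|\,dp$, $L(f)=\int_a^b ds$ its length, and $\bar\kappa=\int_a^b\kappa\,ds\big/\int_a^b ds$ the average of its curvature. Let ${}^\Sigma f:[\alpha,\beta]\to\mathbb R^2$ be a smooth, convex, simple, smoothly closed curve, parametrized by arclength and positively oriented (so that it lies to the left of each of its tangent lines), let ${}^\Sigma\tilde f:\mathbb R\to\mathbb R^2$ be its periodic extension, $\Sigma={}^\Sigma f([\alpha,\beta])$, and let ${}^\Sigma\vec\tau:\Sigma\to\mathbb S^1$ be its unit tangent field. The outer domain of $\Sigma$ is the unbounded component of $\mathbb R^2\setminus\Sigma$. Put $$d_\Sigma=\min\{|x-y| : x,y\in\Sigma,\ {}^\Sigma\vec\tau(x)=-{}^\Sigma\vec\tau(y)\}.$$ Let $a<b$ and let $c_0:[a,b]\to\mathbb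 R^2$ be a smooth regular curve with $c_0(a),c_0(b)\in\Sigma$ whose oriented angles with $\Sigma$ are $\angle(\tau_0(a),{}^\Sigma\vec\tau(c_0(a)))=\frac{\pi}{2}$ and $\angle(\tau_0(b),{}^\Sigma\vec\tau(c_0(b)))=-\frac{\pi}{2}$. Let $0<T\le\infty$ and let $c:[a,b]\times[0,T)\to\mathbb R^2$ be a solution of the area preserving curve shortening problem with Neumann free boundary conditions and initial curve $c_0$: $c$ is smooth on $[a,b]\times(0,T)$, the maps $c,\partial_pc,\partial_p^2c$ are continuous on $[a,b]\times[0,T)$, each $c(\cdot,t)$ is regular, and $$\partial_tc(p,t)=(\kappa(p,t)-\bar\kappa(t))\,\nu(p,t)\quad\text{on }[a,b]\times[0,T),\qquad c(\cdot,0)=c_0,$$ and for all $t\in[0,T)$ $$c(a,t),c(b,t)\in\Sigma,\qquad \angle(\tau(a,t),{}^\Sigma\vec\tau(c(a,t)))=\tfrac{\pi}{2},\qquad \angle(\tau(b,t),{}^\Sigma\vec\tau(c(b,t)))=-\tfrac{\pi}{2}.$$ Let $L_0=L(c_0)$. Let $a_0\in[\alpha,\beta)$ and $b_0\in(a_0,a_0+\beta-\alpha]$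 be the parameters with ${}^\Sigma\tilde f(a_0)=c_0(a)$ and ${}^\Sigma\tilde f(b_0)=c_0(b)$, let $\tilde\gamma_0(p)={}^\Sigma\tilde f((b_0-a_0)p+a_0)$, $p\in[0,1]$, be the arc of $\Sigma$ from $c_0(a)$ to $c_0(b)$ in the positive direction, and let $$A_0=\frac12\int_{c_0}x^1\,dx^2-x^2\,dx^1-\frac12\int_{\tilde\gamma_0}x^1\,dx^2-x^2\,dx^1$$ be the oriented area enclosed by $c_0$ and $\Sigma$. **Theorem.** Assume that the curvature of $c_0$ is positive on $[a,b]$, that $c_0$ has no self-intersection (it is injective on $[a,b]$), that $c_0$ is contained in the outer domain of $\Sigma$ except for its two end points, which lie on $\Sigma$, and that $L_0<d_\Sigma$. Then $$\frac{\pi}{L_0}\le\bar\kappa(t)\le\frac{(L_0+2\,\mathrm{diam}\,\Sigma)\,\pi}{2A_0}\qquad\text{for all }t\in[0,T).$$ -/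

import Mathlib

/-!
The Euclidean plane `ℝ²` is `ℂ`, with its norm and its real inner product; the first and second
coordinate of a point are its real and imaginary part, and the rotation `J` by `+π/2` is
multiplication by `I`.
-/

open Set

attribute [local instance] Complex.finrank_real_complex_fact

noncomputable section

namespace PlaneCurve

/-- `∂_p f` for a curve `f` defined on the parameter interval `[a, b]`
(one-sided at the two end points). -/
def velocity (a b : ℝ) (f : ℝ → ℂ) (p : ℝ) : ℂ :=
  derivWithin f (Icc a b) p

/-- `∂_p² f` for a curve `f` defined on `[a, b]`. -/
def acceleration (a b : ℝ) (f : ℝ → ℂ) (p : ℝ) : ℂ :=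
  derivWithin (velocity a b f) (Icc a b) p

/-- The unit tangent `τ = ∂_p f / |∂_p f|`. -/
def tangent (a b : ℝ) (f : ℝ → ℂ) (p : ℝ) : ℂ :=
  ‖velocity a b f p‖⁻¹ • velocity a b f p

/-- The unit normal `ν = J τ`. -/
def normal (a b : ℝ) (f : ℝ → ℂ) (p : ℝ) : ℂ :=
  Complex.I * tangent a b f p

/-- The signed curvature `κ = ⟨∂_p² f, ν⟩ / |∂_p f|²`. -/
def curvature (a b : ℝ) (f : ℝ → ℂ) (p : ℝ) : ℝ :=
  inner ℝ (acceleration a b f p) (normal a b f p) / ‖velocity a b f p‖ ^ 2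

/-- The length `L = ∫_a^b ds`, where `ds = |∂_p f| dp`. -/
def arcLength (a b : ℝ) (f : ℝ → ℂ) : ℝ :=
  ∫ p in a..b, ‖velocity a b f p‖

/-- The average of the curvature, `∫ κ ds / ∫ ds`. -/
def meanCurvature (a b : ℝ) (f : ℝ → ℂ) : ℝ :=
  (∫ p in a..b, curvature a b f p * ‖velocity a b f p‖) / arcLength a b f

/-- The line integral `½ ∫_f p¹ dp² - p² dp¹`. -/
def sweptArea (a b : ℝ) (f : ℝ → ℂ) : ℝ :=
  (1 / 2) * ∫ p in a..b,
    ((f p).re * (velocity a b f p).im - (f p).im * (velocity a b f p).re)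

end PlaneCurve

/-- A support curve: a smooth, convex, simple, smoothly closed plane curve on `[α, β]`,
parametrized by arclength and positively oriented. It is given by its `(β - α)`-periodic
extension `f` to `ℝ`; closing up smoothly means that this extension is smooth. -/
structure SupportCurve where
  /-- the periodic extension of the parametrization -/
  f : ℝ → ℂ
  /-- left end of the parameter interval -/
  α : ℝ
  /-- right end of the parameter interval -/
  β : ℝ
  lt : α < β
  smooth : ContDiff ℝ (⊤ : ℕ∞) f
  periodic : Function.Periodic f (β - α)
  simple : InjOn f (Ico α β)
  arclength : ∀ p, ‖deriv f p‖ = 1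
  /-- Convexity and positive orientation: the curve lies on one side of each of its tangent lines,
  namely in the closed half-plane to the left (into which the normal `J f'` points). -/
  convex : ∀ p q, 0 ≤ inner ℝ (f q - f p) (Complex.I * deriv f p)

namespace SupportCurve

variable (S : SupportCurve)

/-- The set `Σ ⊆ ℝ²` traced out by the support curve. -/
def trace : Set ℂ := S.f '' Icc S.α S.β

/-- The inverse of the parametrization, with values in `[α, β)` (meaningful on `Σ`). -/
def param (x : ℂ) : ℝ := Function.invFunOn S.f (Ico S.α S.β) x

/-- The unit tangent field on `Σ` (meaningful on `Σ`). -/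
def tangentAt (x : ℂ) : ℂ := deriv S.f (S.param x)

/-- The outer domain created by `Σ`: the unbounded component of the complement of `Σ`. -/
def outerDomain : Set ℂ :=
  {x | x ∈ S.traceᶜ ∧ ¬ Bornology.IsBounded (connectedComponentIn S.traceᶜ x)}

/-- The minimal distance of two points of `Σ` with opposite tangents. -/
def oppositeDist : ℝ :=
  sInf {r | ∃ x ∈ S.trace, ∃ y ∈ S.trace, S.tangentAt x = -S.tangentAt y ∧ r = ‖x - y‖}

/-- The parameter `a₀ ∈ [α, β)` of the initial point of a curve on `[a, b]`. -/
def startParam (a : ℝ) (c₀ : ℝ → ℂ) : ℝ := S.param (c₀ a)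

/-- The parameter `b₀` of the end point of a curve on `[a, b]`, chosen in
`(a₀, a₀ + (β - α)]`. -/
def endParam (a b : ℝ) (c₀ : ℝ → ℂ) : ℝ :=
  if S.startParam a c₀ < S.param (c₀ b) then S.param (c₀ b)
  else S.param (c₀ b) + (S.β - S.α)

/-- The boundary curve on `Σ`, parametrized on `[0, 1]`, that runs from `c₀ a` to `c₀ b` in the
positive direction. -/
def boundaryCurve (a b : ℝ) (c₀ : ℝ → ℂ) (p : ℝ) : ℂ :=
  S.f ((S.endParam a b c₀ - S.startParam a c₀) * p + S.startParam a c₀)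

/-- The oriented area enclosed by `c₀` and `Σ`, formed with the boundary curve above. -/
def enclosedArea (a b : ℝ) (c₀ : ℝ → ℂ) : ℝ :=
  PlaneCurve.sweptArea a b c₀ - PlaneCurve.sweptArea 0 1 (S.boundaryCurve a b c₀)

/-- The oriented-angle boundary conditions: both end points of `f` lie on `Σ`, the oriented angle
from the tangent of `f` to the tangent of `Σ` is `π/2` at the initial point and `-π/2` at the
end point. -/
structure MeetsOrthogonally (a b : ℝ) (f : ℝ → ℂ) : Prop where
  left_mem : f a ∈ S.trace
  right_mem : f b ∈ S.trace
  left_angle : Complex.orientation.oangle (PlaneCurve.tangent a b f a) (S.tangentAt (f a)) =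
    ((Real.pi / 2 : ℝ) : Real.Angle)
  right_angle : Complex.orientation.oangle (PlaneCurve.tangent a b f b) (S.tangentAt (f b)) =
    ((-(Real.pi / 2) : ℝ) : Real.Angle)

/-- An initial curve: a smooth regular curve on `[a, b]` satisfying the boundary conditions. -/
structure IsInitialCurve (a b : ℝ) (c₀ : ℝ → ℂ) : Prop where
  lt : a < b
  smooth : ContDiffOn ℝ (⊤ : ℕ∞) c₀ (Icc a b)
  regular : ∀ p ∈ Icc a b, PlaneCurve.velocity a b c₀ p ≠ 0
  boundary : S.MeetsOrthogonally a b c₀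

end SupportCurve

/-- The time interval `[0, T)`, where `0 < T ≤ ∞`. -/
def timeInterval (T : EReal) : Set ℝ := {t | 0 ≤ t ∧ (t : EReal) < T}

/-- A solution `c : [a, b] × [0, T) → ℝ²` (written `c p t`) of the area preserving curve shortening
problem with Neumann free boundary conditions outside of the support curve `S`, with initial
curve `c₀`. It is smooth on `[a, b] × (0, T)`; up to time `0` it is continuous together with
`∂_p c` and `∂_p² c` (hence also, by the flow equation, with `∂_t c`). -/
structure IsAreaPreservingFlow (S : SupportCurve) (a b : ℝ) (T : EReal)
    (c₀ : ℝ → ℂ) (c : ℝ → ℝ → ℂ) : Prop where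
  time_pos : 0 < T
  smooth : ContDiffOn ℝ (⊤ : ℕ∞) (fun x : ℝ × ℝ => c x.1 x.2)
    (Icc a b ×ˢ (timeInterval T \ {0}))
  continuous : ContinuousOn (fun x : ℝ × ℝ => c x.1 x.2) (Icc a b ×ˢ timeInterval T)
  continuous_velocity :
    ContinuousOn (fun x : ℝ × ℝ => PlaneCurve.velocity a b (fun p => c p x.2) x.1)
      (Icc a b ×ˢ timeInterval T)
  continuous_acceleration :
    ContinuousOn (fun x : ℝ × ℝ => PlaneCurve.acceleration a b (fun p => c p x.2) x.1)
      (Icc a b ×ˢ timeInterval T)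
  regular : ∀ t ∈ timeInterval T, ∀ p ∈ Icc a b,
    PlaneCurve.velocity a b (fun q => c q t) p ≠ 0
  /-- `∂_t c = (κ - κ̄) ν` -/
  flow : ∀ p ∈ Icc a b, ∀ t ∈ timeInterval T,
    HasDerivWithinAt (fun s => c p s)
      ((PlaneCurve.curvature a b (fun q => c q t) p
          - PlaneCurve.meanCurvature a b (fun q => c q t)) •
        PlaneCurve.normal a b (fun q => c q t) p)
      (timeInterval T) t
  initial : ∀ p ∈ Icc a b, c p 0 = c₀ p
  boundary : ∀ t ∈ timeInterval T, S.MeetsOrthogonally a b (fun q => c q t)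

end

/-! Write `K = ∫ κ ds` for the total curvature and `L` for the length at time `t`, so that `κ̄ = K /
L`. The two bounds follow from three facts valid for as long as the flow exists: `L ≤ L₀`, `π ≤ K <
2π`, and `4 A₀ ≤ L (L + 2 diam Σ)`. The first two give `κ̄ ≥ π / L₀`; the last two, with `L ≤ L₀`,
give `κ̄ < 2π / L ≤ (L₀ + 2 diam Σ) π / (2 A₀)`.

Length. Since `V = κ - κ̄` has mean zero and the end points move orthogonally to the curve, `L' = -∫
V κ ds = -∫ V² ds ≤ 0` (`arcLength_le`).

Total curvature. If `K` were a multiple of `2π`, the tangents of the curve at its end points would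
agree, so by orthogonality the tangents of `Σ` there would be opposite, and the end points would be
at distance at least `d_Σ > L₀ ≥ L`, which is absurd (`exp_turning_ne_one`). By continuity `K` stays
in `(0, 2π)` if it starts there. Hence `κ̄ > 0`. Differentiating the boundary condition in time
gives `κ_s = ± κ_Σ (κ - κ̄)` at the ends; with `κ_Σ ≥ 0` and `κ̄ > 0` this rules out a negative
minimum of `κ` at the boundary, and the maximum principle for `κ_t = κ_ss + (κ - κ̄) κ²` keeps `κ ≥
0` (`curv_nonneg`). For a locally convex curve, `0 < K < π` contradicts the position of its chord
relative to the two tangent lines of `Σ`, so `K ≥ π` (`MeetsOrthogonally.pi_le_turning`).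

Initial values. In normal coordinates `f(q) - r i f'(q)` along `Σ` the initial curve becomes a
simple arc in a half plane. Hopf's rotation theorem there shows that `K` equals `π` plus the turning
of the arc of `Σ` between the end points. That arc is no longer than `L₀ < d_Σ`, so it turns by less
than `π`. The same coordinates show `A₀ > 0` (`initial_curve`).

Area. The enclosed area is constant because `∫ V ds = 0` and the boundary terms match the motion
along `Σ` (`area_eq`). Measured from one end point, the arc of `Σ` contributes with a favourable
sign by convexity, and the curve stays within `L / 2 + diam Σ` of that point (`sweptArea_sub_le`).
-/

open Filter Topology ComplexConjugate

/-! ### Hopf's rotation theorem in a half plane -/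

/-- A continuous angle that starts in `[0, π]` and has nonnegative sine stays in `[0, π]`. -/
theorem mem_Icc_zero_pi_of_sin_nonneg {a b : ℝ} {θ : ℝ → ℝ} (hθ : ContinuousOn θ (Icc a b))
    (ha : θ a ∈ Icc 0 Real.pi) (hs : ∀ p ∈ Icc a b, 0 ≤ Real.sin (θ p)) :
    ∀ p ∈ Icc a b, θ p ∈ Icc 0 Real.pi := by
  intro p hp
  have hpi := Real.pi_pos
  have hsub : Icc a p ⊆ Icc a b := Icc_subset_Icc_right hp.2
  constructor
  · by_contra! h
    -- Truncating at `-π/2` yields an attained value in `(-π, 0)`, where the sine is negative,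
    -- however far below `0` the angle has gone.
    obtain ⟨x, hx, hxθ⟩ : max (θ p) (-(Real.pi / 2)) ∈ θ '' Icc a p :=
      intermediate_value_Icc' hp.1 (hθ.mono hsub)
        ⟨le_max_left _ _, max_le (by linarith [ha.1]) (by linarith [ha.1])⟩
    have h1 := hs x (hsub hx)
    rw [hxθ] at h1
    have h2 : max (θ p) (-(Real.pi / 2)) < 0 := max_lt h (by linarith)
    have h3 : -(Real.pi / 2) ≤ max (θ p) (-(Real.pi / 2)) := le_max_right _ _
    linarith [Real.sin_neg_of_neg_of_neg_pi_lt h2 (by linarith)]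
  · by_contra! h
    obtain ⟨x, hx, hxθ⟩ : min (θ p) (3 * Real.pi / 2) ∈ θ '' Icc a p :=
      intermediate_value_Icc hp.1 (hθ.mono hsub)
        ⟨le_min (by linarith [ha.2]) (by linarith [ha.2]), min_le_left _ _⟩
    have h1 := hs x (hsub hx)
    rw [hxθ] at h1
    have h2 : Real.pi < min (θ p) (3 * Real.pi / 2) := lt_min h (by linarith)
    have h3 : min (θ p) (3 * Real.pi / 2) ≤ 3 * Real.pi / 2 := min_le_right _ _
    have h4 : Real.sin (min (θ p) (3 * Real.pi / 2) - Real.pi) ≤ 0 := by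
      rw [Real.sin_sub_pi]; linarith
    linarith [Real.sin_pos_of_pos_of_lt_pi (x := min (θ p) (3 * Real.pi / 2) - Real.pi)
      (by linarith) (by linarith)]

/-- The secant map of a `C¹` curve: the average of the velocity `W` between two parameters. -/
noncomputable def secantMap (W : ℝ → ℂ) (x : ℝ × ℝ) : ℂ :=
  ∫ u in (0 : ℝ)..1, W (x.1 + u * (x.2 - x.1))

theorem continuous_secantMap {W : ℝ → ℂ} (hW : Continuous W) : Continuous (secantMap W) := by
  unfold secantMap
  apply intervalIntegral.continuous_parametric_intervalIntegral_of_continuous'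
  fun_prop

theorem secantMap_self (W : ℝ → ℂ) (s : ℝ) : secantMap W (s, s) = W s := by
  simp [secantMap]

/-- Substituting `x = s + u (t - s)` shows that the secant map is the difference quotient of `z`,
continued by `W` to the diagonal. For an injective regular curve it therefore has no zero, which is
where simplicity enters Hopf's argument. -/
theorem mul_secantMap {a b : ℝ} {z W : ℝ → ℂ} (hW : Continuous W)
    (hz : ∀ p ∈ Icc a b, HasDerivWithinAt z (W p) (Icc a b) p) {s t : ℝ} (hs : s ∈ Icc a b)
    (ht : t ∈ Icc a b) : ((t - s : ℝ) : ℂ) * secantMap W (s, t) = z t - z s := by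
  have h1 : ∫ x in s..t, W x = z t - z s := by
    have hsub : uIcc s t ⊆ Icc a b := ordConnected_Icc.uIcc_subset hs ht
    apply intervalIntegral.integral_eq_sub_of_hasDeriv_right
    · exact fun x hx => ((hz x (hsub hx)).continuousWithinAt).mono hsub
    · intro x hx
      have hx' : x ∈ Ioo a b := by
        have h1 := hx.1
        have h2 := hx.2
        exact ⟨lt_of_le_of_lt (le_min hs.1 ht.1) h1, lt_of_lt_of_le h2 (max_le hs.2 ht.2)⟩
      exact ((hz x (Ioo_subset_Icc_self hx')).hasDerivAt (Icc_mem_nhds hx'.1 hx'.2)).hasDerivWithinAt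
    · exact hW.intervalIntegrable _ _
  have h2 := intervalIntegral.smul_integral_comp_mul_add (a := 0) (b := 1) W (t - s) s
  simp only [mul_zero, zero_add, mul_one, sub_add_cancel] at h2
  rw [← h1, ← h2, secantMap, Complex.real_smul]
  congr 2
  ext u
  ring_nf

/-- Hopf's rotation theorem for a simple curve in the closed upper half plane that leaves the real
axis upwards and returns to it downwards: its tangent turns by `π` or by `-π`. -/
theorem exists_tangent_angle_of_halfPlane {a b : ℝ} (hab : a < b) {z w : ℝ → ℂ}
    (hz : ∀ p ∈ Icc a b, HasDerivWithinAt z (w p) (Icc a b) p) (hw : ContinuousOn w (Icc a b))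
    (hw0 : ∀ p ∈ Icc a b, w p ≠ 0) (hinj : InjOn z (Icc a b))
    (him : ∀ p ∈ Icc a b, 0 ≤ (z p).im) (hza : (z a).im = 0) (hzb : (z b).im = 0)
    (hwa : (w a).re = 0) (hwa' : 0 < (w a).im) (hwb : (w b).re = 0) (hwb' : (w b).im < 0) :
    ∃ θ : ℝ → ℝ, ContinuousOn θ (Icc a b) ∧
      (∀ p ∈ Icc a b, w p = ‖w p‖ * Complex.exp (θ p * Complex.I)) ∧
      θ a = Real.pi / 2 ∧ (θ b = -(Real.pi / 2) ∨ θ b = 3 * Real.pi / 2) := by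
  have hpi := Real.pi_pos
  have hale := hab.le
  -- Constant extension of the velocity beyond `[a, b]`, so that the secant map is continuous on the
  -- whole plane.
  set W : ℝ → ℂ := IccExtend hale (domRestrict (Icc a b) w) with hWdef
  have hWc : Continuous W := (continuousOn_iff_continuous_domRestrict.1 hw).Icc_extend'
  have hWw : ∀ p ∈ Icc a b, W p = w p := fun p hp => by
    rw [hWdef, IccExtend_of_mem _ _ hp]; rfl
  have hz' : ∀ p ∈ Icc a b, HasDerivWithinAt z (W p) (Icc a b) p := fun p hp => by
    rw [hWw p hp]; exact hz p hp
  have hS0 : ∀ s ∈ Icc a b, ∀ t ∈ Icc a b, secantMap W (s, t) ≠ 0 := by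
    intro s hs t ht h
    rcases eq_or_ne s t with rfl | hst
    · rw [secantMap_self, hWw s hs] at h
      exact hw0 s hs h
    · have := mul_secantMap hWc hz' hs ht
      rw [h, mul_zero] at this
      exact hst (hinj hs ht (sub_eq_zero.1 this.symm).symm)
  -- Retracting both parameters to `[a, b]` makes the secant map a nowhere vanishing function on the
  -- simply connected space `ℝ × ℝ`; it thus lifts through the complex exponential, and `Im F` is a
  -- continuous argument.
  let pr : ℝ → ℝ := fun x => (projIcc a b hale x : ℝ)
  have hpr : Continuous pr := continuous_subtype_val.comp continuous_projIcc
  have hprm : ∀ x, pr x ∈ Icc a b := fun x => (projIcc a b hale x).2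
  have hpre : ∀ x ∈ Icc a b, pr x = x := fun x hx => by simp [pr, projIcc_of_mem hale hx]
  let f : C(ℝ × ℝ, {z : ℂ // z ≠ 0}) :=
    ⟨fun x => ⟨secantMap W (pr x.1, pr x.2), hS0 _ (hprm _) _ (hprm _)⟩, by
      apply Continuous.subtype_mk
      apply (continuous_secantMap hWc).comp
      fun_prop⟩
  have ham : a ∈ Icc a b := left_mem_Icc.2 hale
  have hbm : b ∈ Icc a b := right_mem_Icc.2 hale
  have hwaI : w a = (‖w a‖ : ℂ) * Complex.I := by
    have h1 : w a = ((w a).im : ℂ) * Complex.I := by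
      apply Complex.ext <;> simp [hwa]
    have h2 : ‖w a‖ = (w a).im := by
      rw [h1]; simp [abs_of_pos hwa']
    rw [h2]; exact h1
  have hna : 0 < ‖w a‖ := norm_pos_iff.2 (hw0 a ham)
  obtain ⟨F, ⟨hF0, hFf⟩, -⟩ := Complex.isCoveringMap_exp.existsUnique_continuousMap_lifts f (a, a)
    (Complex.log ‖w a‖ + (Real.pi / 2 : ℝ) * Complex.I) (by
      apply Subtype.ext
      simp only [f, ContinuousMap.coe_mk, hpre a ham, secantMap_self, hWw a ham]
      rw [Complex.exp_add, Complex.exp_log (by exact_mod_cast hna.ne')]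
      rw [Complex.ofReal_div, Complex.ofReal_ofNat, Complex.exp_pi_div_two_mul_I]
      exact hwaI.symm)
  have hexp : ∀ s ∈ Icc a b, ∀ t ∈ Icc a b, Complex.exp (F (s, t)) = secantMap W (s, t) := by
    intro s hs t ht
    have := congrArg Subtype.val (congrFun hFf (s, t))
    simpa [f, hpre s hs, hpre t ht] using this
  have hIm : ∀ s ∈ Icc a b, ∀ t ∈ Icc a b,
      (secantMap W (s, t)).im = Real.exp (F (s, t)).re * Real.sin (F (s, t)).im := by
    intro s hs t ht
    rw [← hexp s hs t ht, Complex.exp_im]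
  have hsec : ∀ s ∈ Icc a b, ∀ t ∈ Icc a b,
      (t - s) * (secantMap W (s, t)).im = (z t).im - (z s).im := by
    intro s hs t ht
    have := congrArg Complex.im (mul_secantMap hWc hz' hs ht)
    simpa only [Complex.im_ofReal_mul, Complex.sub_im] using this
  have hFaa : (F (a, a)).im = Real.pi / 2 := by
    have : Complex.log (‖w a‖ : ℂ) = ((Real.log ‖w a‖ : ℝ) : ℂ) := (Complex.ofReal_log hna.le).symm
    rw [hF0, this, Complex.add_im, Complex.ofReal_im, Complex.im_ofReal_mul, Complex.I_im]
    ring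
  -- the first side of the triangle
  have h1 : ∀ t ∈ Icc a b, (F (a, t)).im ∈ Icc 0 Real.pi := by
    apply mem_Icc_zero_pi_of_sin_nonneg (θ := fun t => (F (a, t)).im)
    · fun_prop
    · rw [hFaa]; constructor <;> linarith
    · intro t ht
      have h2 : 0 ≤ (secantMap W (a, t)).im := by
        rcases eq_or_lt_of_le ht.1 with rfl | hlt
        · rw [secantMap_self, hWw a ham]; exact hwa'.le
        · have := hsec a ham t ht
          rw [hza, sub_zero] at this
          exact nonneg_of_mul_nonneg_right (by rw [this]; exact him t ht) (by linarith)
      rw [hIm a ham t ht] at h2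
      exact nonneg_of_mul_nonneg_right h2 (Real.exp_pos _)
  -- the corner
  have hcorner : Real.sin (F (a, b)).im = 0 := by
    have h2 := hsec a ham b hbm
    rw [hza, hzb, sub_zero, hIm a ham b hbm] at h2
    rcases mul_eq_zero.1 h2 with h | h
    · linarith
    · exact (mul_eq_zero.1 h).resolve_left (Real.exp_pos _).ne'
  -- the second side of the triangle
  have hneg : ∀ s ∈ Icc a b, Real.sin (F (s, b)).im ≤ 0 := by
    intro s hs
    have h2 : (secantMap W (s, b)).im ≤ 0 := by
      rcases eq_or_lt_of_le hs.2 with rfl | hlt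
      · rw [secantMap_self, hWw s hs]; exact hwb'.le
      · have := hsec s hs b hbm
        rw [hzb, zero_sub] at this
        by_contra! hcon
        have := mul_pos (sub_pos.2 hlt) hcon
        linarith [him s hs]
    rw [hIm s hs b hbm] at h2
    by_contra! hcon
    linarith [mul_pos (Real.exp_pos (F (s, b)).re) hcon]
  have hcosb : Real.cos (F (b, b)).im = 0 := by
    have h2 := congrArg Complex.re (hexp b hbm b hbm)
    rw [secantMap_self, hWw b hbm, hwb, Complex.exp_re] at h2
    exact (mul_eq_zero.1 h2).resolve_left (Real.exp_pos _).ne'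
  have hsinb := hneg b hbm
  refine ⟨fun p => (F (p, p)).im, by fun_prop, ?_, hFaa, ?_⟩
  · intro p hp
    have h2 := hexp p hp p hp
    rw [secantMap_self, hWw p hp] at h2
    rw [← h2, Complex.norm_exp]
    conv_lhs => rw [← Complex.re_add_im (F (p, p)), Complex.exp_add]
    rw [Complex.ofReal_exp]
  -- The diagonal has the same end points as the path through the corner `(a, b)`. On the first side
  -- the argument stays in `[0, π]`, so it is `0` or `π` at the corner. On the second side it stays
  -- in `[-π, 0]` or `[π, 2π]` accordingly, and the vanishing cosine at `(b, b)` selects the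
  -- midpoint.
  · have hcorner' : (F (a, b)).im = 0 ∨ (F (a, b)).im = Real.pi := by
      have hm := h1 b hbm
      rcases eq_or_lt_of_le hm.1 with h | h
      · exact Or.inl h.symm
      · rcases eq_or_lt_of_le hm.2 with h' | h'
        · exact Or.inr h'
        · exact absurd hcorner (Real.sin_pos_of_pos_of_lt_pi h h').ne'
    rcases hcorner' with h | h
    · left
      have := mem_Icc_zero_pi_of_sin_nonneg (θ := fun s => (F (s, b)).im + Real.pi)
        (a := a) (b := b) (by fun_prop) (by rw [h]; constructor <;> linarith)
        (fun s hs => by rw [Real.sin_add_pi]; linarith [hneg s hs]) b hbm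
      obtain ⟨m1, m2⟩ : 0 ≤ (F (b, b)).im + Real.pi ∧ (F (b, b)).im + Real.pi ≤ Real.pi := this
      rcases lt_trichotomy (F (b, b)).im (-(Real.pi / 2)) with hl | hl | hl
      · have := Real.cos_neg_of_pi_div_two_lt_of_lt (x := -(F (b, b)).im) (by linarith) (by linarith)
        rw [Real.cos_neg] at this; linarith
      · exact hl
      · have := Real.cos_pos_of_mem_Ioo (x := (F (b, b)).im) ⟨hl, by linarith⟩
        linarith
    · right
      have := mem_Icc_zero_pi_of_sin_nonneg (θ := fun s => (F (s, b)).im - Real.pi)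
        (a := a) (b := b) (by fun_prop) (by rw [h]; constructor <;> linarith)
        (fun s hs => by rw [Real.sin_sub_pi]; linarith [hneg s hs]) b hbm
      obtain ⟨m1, m2⟩ : 0 ≤ (F (b, b)).im - Real.pi ∧ (F (b, b)).im - Real.pi ≤ Real.pi := this
      have hc : Real.cos ((F (b, b)).im - Real.pi) = 0 := by rw [Real.cos_sub_pi, hcosb, neg_zero]
      change (F (b, b)).im = _
      rcases lt_trichotomy ((F (b, b)).im - Real.pi) (Real.pi / 2) with hl | hl | hl
      · have := Real.cos_pos_of_mem_Ioo (x := (F (b, b)).im - Real.pi) ⟨by linarith, hl⟩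
        linarith
      · linarith
      · have := Real.cos_neg_of_pi_div_two_lt_of_lt hl (by linarith)
        linarith

/-! ### Minima in one variable and the parabolic maximum principle -/

theorem hasDerivWithinAt_nonpos_of_min_right {f : ℝ → ℝ} {f' a b : ℝ} (hab : a < b)
    (hf : HasDerivWithinAt f f' (Icc a b) b) (hmin : ∀ x ∈ Icc a b, f b ≤ f x) : f' ≤ 0 := by
  have h := (hf.mono Ico_subset_Icc_self)
  rw [hasDerivWithinAt_iff_tendsto_slope' right_notMem_Ico] at h
  have : (𝓝[Ico a b] b).NeBot := by
    rw [nhdsWithin_Ico_eq_nhdsLT hab]; infer_instance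
  refine le_of_tendsto h ?_
  filter_upwards [self_mem_nhdsWithin] with x hx
  rw [slope_def_field]
  exact div_nonpos_of_nonneg_of_nonpos (by linarith [hmin x ⟨hx.1, hx.2.le⟩]) (by linarith [hx.2])

theorem hasDerivWithinAt_nonneg_of_min_left {f : ℝ → ℝ} {f' a b : ℝ} (hab : a < b)
    (hf : HasDerivWithinAt f f' (Icc a b) a) (hmin : ∀ x ∈ Icc a b, f a ≤ f x) : 0 ≤ f' := by
  have h := (hf.mono Ioc_subset_Icc_self)
  rw [hasDerivWithinAt_iff_tendsto_slope' left_notMem_Ioc] at h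
  have : (𝓝[Ioc a b] a).NeBot := by
    rw [nhdsWithin_Ioc_eq_nhdsGT hab]; infer_instance
  refine ge_of_tendsto h ?_
  filter_upwards [self_mem_nhdsWithin] with x hx
  rw [slope_def_field]
  exact div_nonneg (by linarith [hmin x ⟨hx.1.le, hx.2⟩]) (by linarith [hx.1])

/-- A function that starts nonnegative and crosses zero only upwards becomes positive. -/
theorem pos_of_deriv_pos_at_zeros {f f' : ℝ → ℝ} {a b : ℝ}
    (hf : ∀ p ∈ Icc a b, HasDerivWithinAt f (f' p) (Icc a b) p) (ha : 0 ≤ f a)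
    (h : ∀ p ∈ Icc a b, f p = 0 → 0 < f' p) : ∀ p ∈ Ioc a b, 0 < f p := by
  have hnn : ∀ p ∈ Icc a b, 0 ≤ f p := by
    have hcont : ContinuousOn (fun p => -f p) (Icc a b) :=
      fun p hp => (hf p hp).continuousWithinAt.neg
    have := image_le_of_deriv_right_lt_deriv_boundary (f := fun p => -f p) (f' := fun p => -f' p)
      (B := fun _ => 0) (B' := fun _ => 0) hcont (fun p hp => by
        have h1 := (hf p (Ico_subset_Icc_self hp)).neg
        exact h1.mono_of_mem_nhdsWithin (Icc_mem_nhdsGE_of_mem hp)) (by simpa using ha)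
      (fun p => hasDerivAt_const p 0) (fun p hp h0 => by
        have := h p (Ico_subset_Icc_self hp) (by linarith)
        linarith)
    intro p hp
    have := this hp
    linarith
  intro p hp
  have hpm : p ∈ Icc a b := Ioc_subset_Icc_self hp
  -- A zero at `p > a` would be a minimum of `f` on `[a, p]`, forcing `f' p ≤ 0`.
  refine lt_of_le_of_ne (hnn p hpm) fun h0 => ?_
  have h1 := hasDerivWithinAt_nonpos_of_min_right hp.1
    ((hf p hpm).mono (Icc_subset_Icc_right hp.2)) (fun x hx => by
      rw [← h0]; exact hnn x ⟨hx.1, hx.2.trans hp.2⟩)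
  linarith [h p hpm h0.symm]

/-- At an interior minimum the second derivative is nonnegative. -/
theorem second_deriv_nonneg_of_min {f f₁ : ℝ → ℝ} {f₂ a b p : ℝ} (hp : p ∈ Ioo a b)
    (hf : ∀ x ∈ Icc a b, HasDerivWithinAt f (f₁ x) (Icc a b) x)
    (hf₁ : HasDerivWithinAt f₁ f₂ (Icc a b) p) (hp₁ : f₁ p = 0)
    (hmin : ∀ x ∈ Icc a b, f p ≤ f x) : 0 ≤ f₂ := by
  by_contra! hneg
  have h := (hf₁.hasDerivAt (Icc_mem_nhds hp.1 hp.2)).hasDerivWithinAt (s := Ioi p)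
  rw [hasDerivWithinAt_iff_tendsto_slope' self_notMem_Ioi] at h
  have h2 : ∀ᶠ x in 𝓝[>] p, f₁ x < 0 := by
    filter_upwards [h.eventually (gt_mem_nhds hneg), self_mem_nhdsWithin] with x hx hx'
    rw [slope_def_field, hp₁, sub_zero] at hx
    by_contra! hcon
    exact absurd (div_nonneg hcon (sub_nonneg.2 (le_of_lt hx'))) (not_le.2 hx)
  obtain ⟨u, hu, hu'⟩ := mem_nhdsGT_iff_exists_Ioo_subset.1 h2
  obtain ⟨v, hv1, hv2⟩ := exists_between (lt_min hu hp.2)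
  have hvu : v < u := hv2.trans_le (min_le_left _ _)
  have hvb : v < b := hv2.trans_le (min_le_right _ _)
  have hsub : Icc p v ⊆ Icc a b := Icc_subset_Icc hp.1.le hvb.le
  obtain ⟨x, hx, hx'⟩ := exists_hasDerivAt_eq_slope f f₁ hv1
    (fun y hy => ((hf y (hsub hy)).continuousWithinAt).mono hsub)
    (fun y hy => (hf y (hsub (Ioo_subset_Icc_self hy))).hasDerivAt
      (Icc_mem_nhds (hp.1.trans hy.1) (hy.2.trans hvb)))
  have h3 : f₁ x < 0 := hu' ⟨hx.1, hx.2.trans hvu⟩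
  have h4 := hmin v ⟨(hp.1.trans hv1).le, hvb.le⟩
  rw [hx'] at h3
  exact absurd (div_nonneg (sub_nonneg.2 h4) (sub_nonneg.2 hv1.le)) (not_le.2 h3)

/-- The weak maximum principle for a linear parabolic equation on `[a, b]` with boundary
conditions that exclude negative minima at the two end points. -/
theorem nonneg_of_parabolic {a b t₁ M : ℝ} (hab : a < b) {k k₁ k₂ kt A B C : ℝ → ℝ → ℝ}
    (hk : ContinuousOn (fun x : ℝ × ℝ => k x.1 x.2) (Icc a b ×ˢ Icc 0 t₁))
    (h0 : ∀ p ∈ Icc a b, 0 ≤ k p 0)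
    (h1 : ∀ t ∈ Ioc 0 t₁, ∀ p ∈ Icc a b,
      HasDerivWithinAt (fun q => k q t) (k₁ p t) (Icc a b) p)
    (h2 : ∀ t ∈ Ioc 0 t₁, ∀ p ∈ Icc a b,
      HasDerivWithinAt (fun q => k₁ q t) (k₂ p t) (Icc a b) p)
    (ht : ∀ t ∈ Ioc 0 t₁, ∀ p ∈ Icc a b, HasDerivAt (fun s => k p s) (kt p t) t)
    (hpde : ∀ t ∈ Ioc 0 t₁, ∀ p ∈ Icc a b,
      kt p t = A p t * k₂ p t + B p t * k₁ p t + C p t * k p t)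
    (hA : ∀ t ∈ Ioc 0 t₁, ∀ p ∈ Icc a b, 0 ≤ A p t ∧ A p t ≤ M)
    (hB : ∀ t ∈ Ioc 0 t₁, ∀ p ∈ Icc a b, |B p t| ≤ M)
    (hC : ∀ t ∈ Ioc 0 t₁, ∀ p ∈ Icc a b, |C p t| ≤ M)
    (ha : ∀ t ∈ Ioc 0 t₁, k a t < 0 → k₁ a t ≤ 0)
    (hb : ∀ t ∈ Ioc 0 t₁, k b t < 0 → 0 ≤ k₁ b t) :
    ∀ t ∈ Icc 0 t₁, ∀ p ∈ Icc a b, 0 ≤ k p t := by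
  intro t htm p hpm
  by_contra! hneg
  set m := (a + b) / 2 with hm
  -- With `ζ = 1 + (p - m)²` one has `ζ ≥ 1`, `ζ'' = 2` and `|ζ'| ≤ b - a`, so `A ζ'' + B ζ' + C ζ ≤
  -- (N - 1) ζ`. Hence `μ e^{Nt} ζ` with `μ < 0` is a strict barrier that `k` cannot touch from
  -- above.
  set N := M * (3 + (b - a)) + 1 with hN
  let ζ : ℝ → ℝ := fun p => 1 + (p - m) ^ 2
  have hζ1 : ∀ p, 1 ≤ ζ p := fun p => by simp only [ζ]; nlinarith [sq_nonneg (p - m)]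
  have hζ0 : ∀ p, 0 < ζ p := fun p => lt_of_lt_of_le one_pos (hζ1 p)
  have hζd : ∀ p, HasDerivAt ζ (2 * (p - m)) p := fun p => by
    have h := (((hasDerivAt_id p).sub_const m).pow 2).const_add 1
    have h' : ((2 : ℕ) : ℝ) * (id p - m) ^ (2 - 1) * 1 = 2 * (p - m) := by simp
    rw [h'] at h
    exact h
  let w : ℝ × ℝ → ℝ := fun x => k x.1 x.2 * Real.exp (-(N * x.2)) / ζ x.1
  have hw : ContinuousOn w (Icc a b ×ˢ Icc 0 t₁) := by
    apply ContinuousOn.div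
    · apply hk.mul; fun_prop
    · simp only [ζ]; fun_prop
    · exact fun x _ => (hζ0 _).ne'
  have hcomp : IsCompact (Icc a b ×ˢ Icc 0 t₁) := isCompact_Icc.prod isCompact_Icc
  obtain ⟨⟨p₀, t₀⟩, hx₀, hmin⟩ := hcomp.exists_isMinOn ⟨(p, t), hpm, htm⟩ hw
  have hp₀ : p₀ ∈ Icc a b := hx₀.1
  have ht₀ : t₀ ∈ Icc 0 t₁ := hx₀.2
  set μ := w (p₀, t₀) with hμ
  have hkw : ∀ p t, k p t = w (p, t) * Real.exp (N * t) * ζ p := fun p t => by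
    have := (hζ0 p).ne'
    simp only [w]
    rw [div_mul_eq_mul_div, div_mul_cancel₀ _ this, mul_assoc, ← Real.exp_add]
    simp
  have hμ0 : μ < 0 := by
    have h3 : w (p₀, t₀) ≤ w (p, t) := hmin ⟨hpm, htm⟩
    have h4 : w (p, t) < 0 :=
      div_neg_of_neg_of_pos (mul_neg_of_neg_of_pos hneg (Real.exp_pos _)) (hζ0 _)
    linarith
  have hge : ∀ p ∈ Icc a b, ∀ t ∈ Icc 0 t₁, 0 ≤ k p t - μ * Real.exp (N * t) * ζ p := by
    intro p hp t ht
    have h3 : μ ≤ w (p, t) := hmin ⟨hp, ht⟩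
    rw [hkw p t, ← sub_mul, ← sub_mul]
    exact mul_nonneg (mul_nonneg (sub_nonneg.2 h3) (Real.exp_pos _).le) (hζ0 p).le
  have heq : k p₀ t₀ - μ * Real.exp (N * t₀) * ζ p₀ = 0 := by rw [hkw p₀ t₀]; ring
  have hk₀ : k p₀ t₀ < 0 := by
    have : μ * Real.exp (N * t₀) * ζ p₀ < 0 :=
      mul_neg_of_neg_of_pos (mul_neg_of_neg_of_pos hμ0 (Real.exp_pos _)) (hζ0 _)
    linarith
  have ht₀' : 0 < t₀ := by
    refine lt_of_le_of_ne ht₀.1 fun h => ?_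
    rw [← h] at hk₀
    linarith [h0 p₀ hp₀]
  have htm₀ : t₀ ∈ Ioc 0 t₁ := ⟨ht₀', ht₀.2⟩
  set e := Real.exp (N * t₀) with he
  have he0 : 0 < e := Real.exp_pos _
  have hder_p : ∀ p ∈ Icc a b, HasDerivWithinAt (fun q => k q t₀ - μ * e * ζ q)
      (k₁ p t₀ - μ * e * (2 * (p - m))) (Icc a b) p := fun p hp =>
    (h1 t₀ htm₀ p hp).sub ((hζd p).hasDerivWithinAt.const_mul _)
  have hminp : ∀ p ∈ Icc a b, k p₀ t₀ - μ * e * ζ p₀ ≤ k p t₀ - μ * e * ζ p := fun p hp => by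
    rw [heq]; exact hge p hp t₀ ht₀
  have hμe : μ * e < 0 := mul_neg_of_neg_of_pos hμ0 he0
  -- The barrier has slope `μ e ζ'`, positive at `a` and negative at `b` since `μ < 0` and `m` is
  -- the midpoint. This makes the weak boundary conditions `k₁ ≤ 0` and `k₁ ≥ 0` sufficient to
  -- exclude contact at the ends.
  have hpa : a < p₀ := by
    refine lt_of_le_of_ne hp₀.1 fun h => ?_
    subst h
    have := hasDerivWithinAt_nonneg_of_min_left hab (hder_p a hp₀) hminp
    have h3 := ha t₀ htm₀ hk₀
    have h4 : 0 < μ * e * (2 * (a - m)) := mul_pos_of_neg_of_neg hμe (by rw [hm]; linarith)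
    linarith
  have hpb : p₀ < b := by
    refine lt_of_le_of_ne hp₀.2 fun h => ?_
    subst h
    have := hasDerivWithinAt_nonpos_of_min_right hab (hder_p p₀ hp₀) hminp
    have h3 := hb t₀ htm₀ hk₀
    have h4 : μ * e * (2 * (p₀ - m)) < 0 := mul_neg_of_neg_of_pos hμe (by rw [hm]; linarith)
    linarith
  have hd1 : k₁ p₀ t₀ - μ * e * (2 * (p₀ - m)) = 0 := by
    have hl : IsLocalMin (fun q => k q t₀ - μ * e * ζ q) p₀ := by
      filter_upwards [Icc_mem_nhds hpa hpb] with p hp using hminp p hp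
    exact hl.hasDerivAt_eq_zero ((hder_p p₀ hp₀).hasDerivAt (Icc_mem_nhds hpa hpb))
  have hd2 : 0 ≤ k₂ p₀ t₀ - μ * e * 2 := by
    refine second_deriv_nonneg_of_min ⟨hpa, hpb⟩ hder_p ?_ hd1 hminp
    have h3 : HasDerivAt (fun q : ℝ => μ * e * (2 * (q - m))) (μ * e * 2) p₀ := by
      simpa using (((hasDerivAt_id p₀).sub_const m).const_mul 2).const_mul (μ * e)
    exact (h2 t₀ htm₀ p₀ hp₀).sub h3.hasDerivWithinAt
  -- Only times up to `t₀` are compared, so the contact may occur at the final time and gives an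
  -- inequality for the time derivative.
  have hdt : kt p₀ t₀ - μ * (e * N) * ζ p₀ ≤ 0 := by
    have h3 : HasDerivAt (fun s => Real.exp (N * s)) (e * N) t₀ := by
      simpa using ((hasDerivAt_id t₀).const_mul N).exp
    have h4 : HasDerivAt (fun s => k p₀ s - μ * Real.exp (N * s) * ζ p₀)
        (kt p₀ t₀ - μ * (e * N) * ζ p₀) t₀ :=
      (ht t₀ htm₀ p₀ hp₀).sub ((h3.const_mul μ).mul_const (ζ p₀))
    refine hasDerivWithinAt_nonpos_of_min_right ht₀' h4.hasDerivWithinAt fun s hs => ?_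
    have := hge p₀ hp₀ s ⟨hs.1, hs.2.trans ht₀.2⟩
    linarith
  obtain ⟨hA0, hA1⟩ := hA t₀ htm₀ p₀ hp₀
  have hB1 := hB t₀ htm₀ p₀ hp₀
  have hC1 := hC t₀ htm₀ p₀ hp₀
  have hM : 0 ≤ M := hA0.trans hA1
  have hp1 : |2 * (p₀ - m)| ≤ b - a := by
    rw [abs_le, hm]; constructor <;> linarith
  have hBz : B p₀ t₀ * (2 * (p₀ - m)) ≤ M * (b - a) := by
    refine (le_abs_self _).trans ?_
    rw [abs_mul]
    exact mul_le_mul hB1 hp1 (abs_nonneg _) hM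
  have hCz : C p₀ t₀ * ζ p₀ ≤ M * ζ p₀ :=
    mul_le_mul_of_nonneg_right ((le_abs_self _).trans hC1) (hζ0 _).le
  have hpd := hpde t₀ htm₀ p₀ hp₀
  have hk0' : k p₀ t₀ = μ * e * ζ p₀ := by linarith
  have hk1' : k₁ p₀ t₀ = μ * e * (2 * (p₀ - m)) := by linarith
  have hAk : A p₀ t₀ * (μ * e * 2) ≤ A p₀ t₀ * k₂ p₀ t₀ :=
    mul_le_mul_of_nonneg_left (by linarith) hA0
  have hfin : (μ * e) * (A p₀ t₀ * 2 + B p₀ t₀ * (2 * (p₀ - m)) + C p₀ t₀ * ζ p₀)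
      ≤ (μ * e) * (N * ζ p₀) := by
    rw [hk0', hk1'] at hpd
    linarith
  have hfin' := (mul_le_mul_left_of_neg hμe).1 hfin
  have hMζ : M * (b - a) ≤ M * (b - a) * ζ p₀ :=
    le_mul_of_one_le_right (mul_nonneg hM (by linarith)) (hζ1 _)
  have hMζ' : 2 * M ≤ 2 * M * ζ p₀ := le_mul_of_one_le_right (by linarith) (hζ1 _)
  rw [hN] at hfin'
  linarith [hζ0 p₀]

/-! ### Parameter integrals and linear equations on an interval -/

theorem continuousOn_intervalIntegral {E : Type*} [NormedAddCommGroup E] [NormedSpace ℝ E]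
    {a b c d : ℝ} (hab : a ≤ b) {F : ℝ → ℝ → E}
    (hF : ContinuousOn (fun x : ℝ × ℝ => F x.1 x.2) (Icc a b ×ˢ Icc c d)) :
    ContinuousOn (fun t => ∫ p in a..b, F p t) (Icc c d) := by
  rcases lt_or_ge d c with hcd | hcd
  · simp [Icc_eq_empty (not_le.2 hcd)]
  let G : ℝ → ℝ → E := fun t p => F (projIcc a b hab p) (projIcc c d hcd t)
  have hG : Continuous (Function.uncurry G) := by
    have h1 : Continuous fun x : ℝ × ℝ =>
        ((projIcc a b hab x.2 : ℝ), (projIcc c d hcd x.1 : ℝ)) := by fun_prop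
    exact hF.comp_continuous h1 fun x => ⟨(projIcc a b hab x.2).2, (projIcc c d hcd x.1).2⟩
  have hc := intervalIntegral.continuous_parametric_intervalIntegral_of_continuous'
    (μ := MeasureTheory.volume) hG a b
  refine hc.continuousOn.congr ?_
  intro t ht
  apply intervalIntegral.integral_congr
  intro p hp
  rw [uIcc_of_le hab] at hp
  simp [G, projIcc_of_mem _ hp, projIcc_of_mem _ ht]

theorem hasDerivAt_intervalIntegral_of_continuousOn {E : Type*} [NormedAddCommGroup E]
    [NormedSpace ℝ E] {a b t : ℝ} (hab : a ≤ b) {U : Set ℝ} (hU : IsOpen U) (ht : t ∈ U)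
    {F F' : ℝ → ℝ → E} (hF : ContinuousOn (fun x : ℝ × ℝ => F x.1 x.2) (Icc a b ×ˢ U))
    (hF' : ContinuousOn (fun x : ℝ × ℝ => F' x.1 x.2) (Icc a b ×ˢ U))
    (hd : ∀ p ∈ Icc a b, ∀ s ∈ U, HasDerivAt (fun r => F p r) (F' p s) s) :
    HasDerivAt (fun s => ∫ p in a..b, F p s) (∫ p in a..b, F' p t) t := by
  obtain ⟨ε, hε, hball⟩ := Metric.nhds_basis_closedBall.mem_iff.1 (hU.mem_nhds ht)
  obtain ⟨C, hC⟩ := (isCompact_Icc.prod (isCompact_closedBall t ε)).exists_bound_of_continuousOn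
    (hF'.mono (prod_mono_right hball))
  have hsl : ∀ {G : ℝ → ℝ → E}, ContinuousOn (fun x : ℝ × ℝ => G x.1 x.2) (Icc a b ×ˢ U) →
      ∀ s ∈ U, ContinuousOn (fun p => G p s) (uIcc a b) := by
    intro G hG s hs
    rw [uIcc_of_le hab]
    exact hG.comp (f := fun p => (p, s)) (by fun_prop) fun p hp => ⟨hp, hs⟩
  have hsub : ∀ p ∈ uIoc a b, p ∈ Icc a b := fun p hp => by
    rw [uIoc_of_le hab] at hp; exact Ioc_subset_Icc_self hp
  refine (intervalIntegral.hasDerivAt_integral_of_dominated_loc_of_deriv_le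
    (F := fun s p => F p s) (F' := fun s p => F' p s) (bound := fun _ => C)
    (Metric.closedBall_mem_nhds t hε) ?_ ?_ ?_ ?_ ?_ ?_).2
  · filter_upwards [hU.mem_nhds ht] with s hs
    exact ((hsl hF s hs).intervalIntegrable.def').aestronglyMeasurable
  · exact (hsl hF t ht).intervalIntegrable
  · exact ((hsl hF' t ht).intervalIntegrable.def').aestronglyMeasurable
  · exact .of_forall fun p hp s hs => hC (p, s) ⟨hsub p hp, hs⟩
  · exact intervalIntegrable_const
  · exact .of_forall fun p hp s hs => hd p (hsub p hp) s (hball hs)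

theorem hasDerivWithinAt_integral_Icc {E : Type*} [NormedAddCommGroup E] [NormedSpace ℝ E]
    [CompleteSpace E] {a b : ℝ} {h : ℝ → E} (hh : ContinuousOn h (Icc a b)) :
    ∀ p ∈ Icc a b, HasDerivWithinAt (fun q => ∫ x in a..q, h x) (h p) (Icc a b) p := by
  intro p hp
  have hab : a ≤ b := hp.1.trans hp.2
  set H : ℝ → E := IccExtend hab (domRestrict (Icc a b) h)
  have hHc : Continuous H := (continuousOn_iff_continuous_domRestrict.1 hh).Icc_extend'
  have hHh : ∀ q ∈ Icc a b, H q = h q := fun q hq => IccExtend_of_mem _ _ hq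
  have h1 : HasDerivAt (fun q => ∫ x in a..q, H x) (H p) p :=
    intervalIntegral.integral_hasDerivAt_right (hHc.intervalIntegrable _ _)
      (hHc.stronglyMeasurableAtFilter _ _) hHc.continuousAt
  rw [← hHh p hp]
  have h2 : ∀ q ∈ Icc a b, ∫ x in a..q, h x = ∫ x in a..q, H x := fun q hq => by
    apply intervalIntegral.integral_congr
    intro x hx
    rw [uIcc_of_le hq.1] at hx
    exact (hHh x ⟨hx.1, hx.2.trans hq.2⟩).symm
  exact h1.hasDerivWithinAt.congr h2 (h2 p hp)

theorem eq_left_of_hasDerivWithinAt_zero {E : Type*} [NormedAddCommGroup E] [NormedSpace ℝ E]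
    {a b : ℝ} {f : ℝ → E} (hf : ∀ p ∈ Icc a b, HasDerivWithinAt f 0 (Icc a b) p) :
    ∀ p ∈ Icc a b, f p = f a :=
  constant_of_has_deriv_right_zero (fun p hp => (hf p hp).continuousWithinAt) fun p hp =>
    (hf p (Ico_subset_Icc_self hp)).mono_of_mem_nhdsWithin (Icc_mem_nhdsGE_of_mem hp)

theorem integral_eq_sub_of_hasDerivWithinAt {E : Type*} [NormedAddCommGroup E] [NormedSpace ℝ E]
    [CompleteSpace E] {a b : ℝ} (hab : a ≤ b) {f f' : ℝ → E}
    (hf : ∀ p ∈ Icc a b, HasDerivWithinAt f (f' p) (Icc a b) p) (hf' : ContinuousOn f' (Icc a b)) :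
    ∫ p in a..b, f' p = f b - f a :=
  intervalIntegral.integral_eq_sub_of_hasDerivAt_of_le hab
    (fun p hp => (hf p hp).continuousWithinAt)
    (fun p hp => (hf p (Ioo_subset_Icc_self hp)).hasDerivAt (Icc_mem_nhds hp.1 hp.2))
    (hf'.intervalIntegrable_of_Icc hab)

/-- The solution of `u' = i θ' u` is `u = u(a) exp(i ∫ θ')`. -/
theorem eq_mul_exp_of_hasDerivWithinAt {a b : ℝ} {u : ℝ → ℂ} {θ' : ℝ → ℝ}
    (hθ : ContinuousOn θ' (Icc a b))
    (hu : ∀ p ∈ Icc a b, HasDerivWithinAt u (θ' p * Complex.I * u p) (Icc a b) p) :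
    ∀ p ∈ Icc a b, u p = u a * Complex.exp ((∫ x in a..p, θ' x : ℝ) * Complex.I) := by
  intro p hp
  let θ : ℝ → ℝ := fun q => ∫ x in a..q, θ' x
  have hd : ∀ q ∈ Icc a b,
      HasDerivWithinAt (fun q => u q * Complex.exp (-(θ q * Complex.I))) 0 (Icc a b) q := by
    intro q hq
    have h1 := ((hasDerivWithinAt_integral_Icc hθ q hq).ofReal_comp.mul_const Complex.I).neg.cexp
    refine ((hu q hq).fun_mul h1).congr_deriv ?_
    ring
  have h := eq_left_of_hasDerivWithinAt_zero hd p hp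
  have h0 : θ a = 0 := by simp [θ]
  simp only [h0, Complex.ofReal_zero, zero_mul, neg_zero, Complex.exp_zero, mul_one] at h
  rw [← h, mul_assoc, ← Complex.exp_add]
  simp [θ]

/-! ### Plane vectors as complex numbers -/

theorem Complex.inner_eq_re_mul_add_im_mul (w z : ℂ) : inner ℝ w z = w.re * z.re + w.im * z.im := by
  rw [Complex.inner]
  simp
  ring

theorem norm_mul_norm_eq (z : ℂ) : ‖z‖ * ‖z‖ = z.re * z.re + z.im * z.im := by
  rw [← Complex.normSq_apply, Complex.normSq_eq_norm_sq, sq]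

theorem HasDerivWithinAt.norm_complex {v : ℝ → ℂ} {v' : ℂ} {s : Set ℝ} {x : ℝ}
    (hv : HasDerivWithinAt v v' s x) (h0 : v x ≠ 0) :
    HasDerivWithinAt (fun y => ‖v y‖) ((v' * conj (v x)).re / ‖v x‖) s x := by
  have h := hv.norm_sq.sqrt (by simpa using h0)
  simp only [Real.sqrt_sq (norm_nonneg _)] at h
  refine h.congr_deriv ?_
  rw [Complex.inner_eq_re_mul_add_im_mul]
  simp only [Complex.mul_re, Complex.conj_re, Complex.conj_im]
  rw [mul_div_mul_left _ _ two_ne_zero]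
  ring_nf

/-- Only the part of `v'` orthogonal to `v` turns the direction, with angular speed `Im (v' v̄) /
|v|²`. This one computation serves the derivative of the tangent both along the curve and in time.
-/
theorem HasDerivWithinAt.unit_complex {v : ℝ → ℂ} {v' : ℂ} {s : Set ℝ} {x : ℝ}
    (hv : HasDerivWithinAt v v' s x) (h0 : v x ≠ 0) :
    HasDerivWithinAt (fun y => ‖v y‖⁻¹ • v y)
      ((((v' * conj (v x)).im / ‖v x‖ ^ 2 : ℝ) : ℂ) * Complex.I * (‖v x‖⁻¹ • v x)) s x := by
  have hn : ‖v x‖ ≠ 0 := norm_ne_zero_iff.2 h0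
  refine (((hv.norm_complex h0).fun_inv hn).fun_smul hv).congr_deriv ?_
  have hsq : v' * conj (v x) * v x = v' * (‖v x‖ : ℂ) ^ 2 := by
    rw [mul_assoc, mul_comm (conj _), Complex.mul_conj, Complex.normSq_eq_norm_sq,
      Complex.ofReal_pow]
  have hre := Complex.re_add_im (v' * conj (v x))
  have hnC : (‖v x‖ : ℂ) ≠ 0 := by exact_mod_cast hn
  generalize (v' * conj (v x)).re = R at *
  generalize (v' * conj (v x)).im = M at *
  simp only [Complex.real_smul, Complex.ofReal_div, Complex.ofReal_inv, Complex.ofReal_neg,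
    Complex.ofReal_pow]
  rw [← hre] at hsq
  field_simp
  linear_combination -hsq

/-- Turns an angle condition, known only modulo `2π`, into an exact complex identity. -/
theorem eq_exp_mul_of_oangle_eq {x y : ℂ} (hx : ‖x‖ = 1) (hy : ‖y‖ = 1) {θ : ℝ}
    (h : Complex.orientation.oangle x y = (θ : Real.Angle)) :
    y = Complex.exp (θ * Complex.I) * x := by
  rw [Complex.oangle] at h
  have hn : ‖conj x * y‖ = 1 := by rw [norm_mul, RCLike.norm_conj, hx, hy, one_mul]
  have h1 : conj x * y = Complex.exp ((conj x * y).arg * Complex.I) := by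
    conv_lhs => rw [← Complex.norm_mul_exp_arg_mul_I (conj x * y), hn]
    simp
  have h2 : Complex.exp ((conj x * y).arg * Complex.I) = Complex.exp (θ * Complex.I) := by
    obtain ⟨n, hn⟩ := Real.Angle.angle_eq_iff_two_pi_dvd_sub.1 h
    rw [Complex.exp_eq_exp_iff_exists_int]
    refine ⟨n, ?_⟩
    have : (conj x * y).arg = θ + 2 * Real.pi * n := by linarith
    rw [this]; push_cast; ring
  have h3 : x * conj x = 1 := by rw [Complex.mul_conj, Complex.normSq_eq_norm_sq, hx]; simp
  calc y = x * conj x * y := by rw [h3, one_mul]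
    _ = (conj x * y) * x := by ring
    _ = _ := by rw [h1, h2]

/-! ### Tangent, curvature and length of plane curves -/

namespace PlaneCurve

variable {a b : ℝ} {f : ℝ → ℂ}

theorem hasDerivWithinAt_velocity (hf : ContDiffOn ℝ (⊤ : ℕ∞) f (Icc a b)) :
    ∀ p ∈ Icc a b, HasDerivWithinAt f (velocity a b f p) (Icc a b) p := fun p hp =>
  ((hf.differentiableOn (by simp)) p hp).hasDerivWithinAt

theorem contDiffOn_velocity (hab : a < b) (hf : ContDiffOn ℝ (⊤ : ℕ∞) f (Icc a b)) :
    ContDiffOn ℝ (⊤ : ℕ∞) (velocity a b f) (Icc a b) :=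
  hf.derivWithin (uniqueDiffOn_Icc hab) (by simp)

theorem hasDerivWithinAt_acceleration (hab : a < b) (hf : ContDiffOn ℝ (⊤ : ℕ∞) f (Icc a b)) :
    ∀ p ∈ Icc a b, HasDerivWithinAt (velocity a b f) (acceleration a b f p) (Icc a b) p :=
  hasDerivWithinAt_velocity (contDiffOn_velocity hab hf)

theorem continuousOn_acceleration (hab : a < b) (hf : ContDiffOn ℝ (⊤ : ℕ∞) f (Icc a b)) :
    ContinuousOn (acceleration a b f) (Icc a b) :=
  (contDiffOn_velocity hab (contDiffOn_velocity hab hf)).continuousOn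

theorem norm_tangent {p : ℝ} (h0 : velocity a b f p ≠ 0) : ‖tangent a b f p‖ = 1 := by
  rw [tangent, norm_smul, norm_inv, norm_norm, inv_mul_cancel₀ (norm_ne_zero_iff.2 h0)]

theorem velocity_eq {p : ℝ} (h0 : velocity a b f p ≠ 0) :
    velocity a b f p = ‖velocity a b f p‖ * tangent a b f p := by
  rw [tangent, Complex.real_smul, ← mul_assoc, ← Complex.ofReal_mul,
    mul_inv_cancel₀ (norm_ne_zero_iff.2 h0), Complex.ofReal_one, one_mul]

/-- A formula in the first two derivatives alone, convenient for differentiation in time. At a point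
of zero velocity both sides are `0` by the convention for division. -/
theorem curvature_eq (p : ℝ) : curvature a b f p =
    (acceleration a b f p * conj (velocity a b f p)).im / ‖velocity a b f p‖ ^ 3 := by
  rw [curvature, normal, tangent, Complex.inner_eq_re_mul_add_im_mul]
  rcases eq_or_ne (velocity a b f p) 0 with h | h
  · simp [h]
  have := norm_ne_zero_iff.2 h
  simp
  field_simp

theorem curvature_mul_norm (p : ℝ) : curvature a b f p * ‖velocity a b f p‖ =
    (acceleration a b f p * conj (velocity a b f p)).im / ‖velocity a b f p‖ ^ 2 := by
  rw [curvature_eq]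
  rcases eq_or_ne (velocity a b f p) 0 with h | h
  · simp [h]
  have := norm_ne_zero_iff.2 h
  field_simp

/-- The total curvature `∫ κ ds`. -/
noncomputable def turning (a b : ℝ) (f : ℝ → ℂ) : ℝ :=
  ∫ p in a..b, curvature a b f p * ‖velocity a b f p‖

theorem continuousOn_curvature (hv : ContinuousOn (velocity a b f) (Icc a b))
    (hw : ContinuousOn (acceleration a b f) (Icc a b))
    (h0 : ∀ p ∈ Icc a b, velocity a b f p ≠ 0) : ContinuousOn (curvature a b f) (Icc a b) := by
  have : curvature a b f = fun p =>
    (acceleration a b f p * conj (velocity a b f p)).im / ‖velocity a b f p‖ ^ 3 :=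
    funext curvature_eq
  rw [this]
  apply ContinuousOn.div
  · exact Complex.continuous_im.comp_continuousOn
      (hw.mul (Complex.continuous_conj.comp_continuousOn hv))
  · exact hv.norm.pow 3
  · exact fun p hp => pow_ne_zero _ (norm_ne_zero_iff.2 (h0 p hp))

theorem hasDerivWithinAt_tangent (hab : a < b) (hf : ContDiffOn ℝ (⊤ : ℕ∞) f (Icc a b))
    (h0 : ∀ p ∈ Icc a b, velocity a b f p ≠ 0) :
    ∀ p ∈ Icc a b, HasDerivWithinAt (tangent a b f)
      (((curvature a b f p * ‖velocity a b f p‖ : ℝ) : ℂ) * Complex.I * tangent a b f p)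
      (Icc a b) p := by
  intro p hp
  rw [curvature_mul_norm]
  exact (hasDerivWithinAt_acceleration hab hf p hp).unit_complex (h0 p hp)

theorem continuousOn_curvature_mul_norm (hab : a < b) (hf : ContDiffOn ℝ (⊤ : ℕ∞) f (Icc a b))
    (h0 : ∀ p ∈ Icc a b, velocity a b f p ≠ 0) :
    ContinuousOn (fun p => curvature a b f p * ‖velocity a b f p‖) (Icc a b) :=
  (continuousOn_curvature (contDiffOn_velocity hab hf).continuousOn
    (continuousOn_acceleration hab hf) h0).mul (contDiffOn_velocity hab hf).continuousOn.norm

theorem tangent_eq_mul_exp (hab : a < b) (hf : ContDiffOn ℝ (⊤ : ℕ∞) f (Icc a b))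
    (h0 : ∀ p ∈ Icc a b, velocity a b f p ≠ 0) :
    ∀ p ∈ Icc a b, tangent a b f p = tangent a b f a *
      Complex.exp ((∫ x in a..p, curvature a b f x * ‖velocity a b f x‖ : ℝ) * Complex.I) :=
  eq_mul_exp_of_hasDerivWithinAt (continuousOn_curvature_mul_norm hab hf h0)
    (hasDerivWithinAt_tangent hab hf h0)

theorem arcLength_pos (hab : a < b) (hf : ContDiffOn ℝ (⊤ : ℕ∞) f (Icc a b))
    (h0 : ∀ p ∈ Icc a b, velocity a b f p ≠ 0) : 0 < arcLength a b f :=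
  intervalIntegral.intervalIntegral_pos_of_pos_on
    ((contDiffOn_velocity hab hf).continuousOn.norm.intervalIntegrable_of_Icc hab.le)
    (fun p hp => norm_pos_iff.2 (h0 p (Ioo_subset_Icc_self hp))) hab

theorem norm_sub_le_integral (hab : a < b) (hf : ContDiffOn ℝ (⊤ : ℕ∞) f (Icc a b)) {s t : ℝ}
    (hs : a ≤ s) (hst : s ≤ t) (ht : t ≤ b) :
    ‖f t - f s‖ ≤ ∫ p in s..t, ‖velocity a b f p‖ := by
  have hsub : Icc s t ⊆ Icc a b := Icc_subset_Icc hs ht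
  rw [← integral_eq_sub_of_hasDerivWithinAt hst
    (fun p hp => (hasDerivWithinAt_velocity hf p (hsub hp)).mono hsub)
    ((contDiffOn_velocity hab hf).continuousOn.mono hsub)]
  exact intervalIntegral.norm_integral_le_integral_norm hst

theorem norm_sub_le_arcLength (hab : a < b) (hf : ContDiffOn ℝ (⊤ : ℕ∞) f (Icc a b)) :
    ‖f b - f a‖ ≤ arcLength a b f :=
  norm_sub_le_integral hab hf le_rfl hab.le le_rfl

end PlaneCurve

/-! ### Geometry of the support curve -/

namespace SupportCurve

variable (S : SupportCurve)

theorem period_pos : 0 < S.β - S.α := sub_pos.2 S.lt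

theorem contDiff_deriv : ContDiff ℝ (⊤ : ℕ∞) (deriv S.f) :=
  ((contDiff_infty_iff_deriv (𝕜 := ℝ)).1 S.smooth).2

theorem contDiff_deriv_deriv : ContDiff ℝ (⊤ : ℕ∞) (deriv (deriv S.f)) :=
  ((contDiff_infty_iff_deriv (𝕜 := ℝ)).1 S.contDiff_deriv).2

theorem hasDerivAt (x : ℝ) : HasDerivAt S.f (deriv S.f x) x :=
  ((S.smooth.differentiable (by simp)) x).hasDerivAt

/-- The curvature of the support curve. -/
noncomputable def curv (x : ℝ) : ℝ := (deriv (deriv S.f) x * conj (deriv S.f x)).im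

theorem continuous_curv : Continuous S.curv :=
  Complex.continuous_im.comp (S.contDiff_deriv_deriv.continuous.mul
    (Complex.continuous_conj.comp S.contDiff_deriv.continuous))

theorem deriv_mul_conj (x : ℝ) : deriv S.f x * conj (deriv S.f x) = 1 := by
  rw [Complex.mul_conj, Complex.normSq_eq_norm_sq, S.arclength]; simp

theorem deriv_ne_zero (x : ℝ) : deriv S.f x ≠ 0 := fun h => by
  have := S.arclength x
  rw [h] at this
  simp at this

/-- Constant speed makes `f''` orthogonal to `f'`, so only the multiple `κ` of `i f'` remains. -/
theorem hasDerivAt_deriv (x : ℝ) :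
    HasDerivAt (deriv S.f) (S.curv x * Complex.I * deriv S.f x) x := by
  have h1 : HasDerivAt (deriv S.f) (deriv (deriv S.f) x) x :=
    ((S.contDiff_deriv.differentiable (by simp)) x).hasDerivAt
  have h2 := (hasDerivWithinAt_univ.2 h1).norm_complex (S.deriv_ne_zero x)
  simp only [S.arclength, div_one] at h2
  have h3 : (deriv (deriv S.f) x * conj (deriv S.f x)).re = 0 :=
    (hasDerivWithinAt_univ.1 h2).unique (hasDerivAt_const x 1)
  refine h1.congr_deriv ?_
  have h4 : deriv (deriv S.f) x * conj (deriv S.f x) = S.curv x * Complex.I := by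
    apply Complex.ext
    · rw [h3]; simp
    · simp [curv]
  rw [← h4, mul_assoc, mul_comm (conj _), S.deriv_mul_conj, mul_one]

theorem re_mul_re_add_im_mul_im (x : ℝ) :
    (deriv S.f x).re * (deriv S.f x).re + (deriv S.f x).im * (deriv S.f x).im = 1 := by
  rw [← norm_mul_norm_eq, S.arclength, one_mul]

/-- By convexity the signed distance of `f y` from the tangent line at `x` is minimal at `y = x`;
its second derivative there is the curvature. -/
theorem curv_nonneg (x : ℝ) : 0 ≤ S.curv x := by
  let L : ℂ →L[ℝ] ℝ := innerSL ℝ (Complex.I * deriv S.f x)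
  have hL : ∀ w, L w = inner ℝ w (Complex.I * deriv S.f x) := fun w => by
    simp only [L, innerSL_apply_apply]; exact real_inner_comm _ _
  have h1 : ∀ y ∈ Icc (x - 1) (x + 1), HasDerivWithinAt (fun y => L (S.f y - S.f x))
      (L (deriv S.f y)) (Icc (x - 1) (x + 1)) y := fun y _ =>
    (L.hasFDerivAt.comp_hasDerivAt y ((S.hasDerivAt y).sub_const (S.f x))).hasDerivWithinAt
  have h2 : HasDerivWithinAt (fun y => L (deriv S.f y)) (L (S.curv x * Complex.I * deriv S.f x))
      (Icc (x - 1) (x + 1)) x :=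
    (L.hasFDerivAt.comp_hasDerivAt x (S.hasDerivAt_deriv x)).hasDerivWithinAt
  have h3 := second_deriv_nonneg_of_min (p := x) ⟨by linarith, by linarith⟩ h1 h2
    (by rw [hL, Complex.inner_eq_re_mul_add_im_mul]; simp; ring)
    (fun y _ => by rw [hL, hL]; simpa using S.convex x y)
  rw [hL, Complex.inner_eq_re_mul_add_im_mul] at h3
  simp at h3
  have h4 := S.re_mul_re_add_im_mul_im x
  have h5 : S.curv x * ((deriv S.f x).re * (deriv S.f x).re + (deriv S.f x).im * (deriv S.f x).im)
      = S.curv x := by rw [h4, mul_one]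
  linarith

/-- The tangent angle of the support curve, relative to the parameter `0`. -/
noncomputable def angle (x : ℝ) : ℝ := ∫ y in (0 : ℝ)..x, S.curv y

theorem hasDerivAt_angle (x : ℝ) : HasDerivAt S.angle (S.curv x) x :=
  intervalIntegral.integral_hasDerivAt_right (S.continuous_curv.intervalIntegrable _ _)
    (S.continuous_curv.stronglyMeasurableAtFilter _ _) S.continuous_curv.continuousAt

theorem continuous_angle : Continuous S.angle :=
  continuous_iff_continuousAt.2 fun x => (S.hasDerivAt_angle x).continuousAt

theorem monotone_angle : Monotone S.angle :=
  monotone_of_hasDerivAt_nonneg S.hasDerivAt_angle S.curv_nonneg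

theorem deriv_eq_mul_exp (x y : ℝ) :
    deriv S.f y = deriv S.f x * Complex.exp ((S.angle y - S.angle x : ℝ) * Complex.I) := by
  have hd : ∀ z, HasDerivAt (fun z => deriv S.f z * Complex.exp (-(S.angle z * Complex.I))) 0 z := by
    intro z
    refine ((S.hasDerivAt_deriv z).fun_mul
      (((S.hasDerivAt_angle z).ofReal_comp.mul_const Complex.I).neg.cexp)).congr_deriv ?_
    ring
  have h := is_const_of_deriv_eq_zero (fun z => (hd z).differentiableAt) (fun z => (hd z).deriv) y x
  have h1 : deriv S.f y = deriv S.f y * Complex.exp (-(S.angle y * Complex.I)) *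
      Complex.exp (S.angle y * Complex.I) := by
    rw [mul_assoc, ← Complex.exp_add]; simp
  rw [h1, h, mul_assoc, ← Complex.exp_add]
  congr 2
  push_cast
  ring

theorem periodic_deriv : Function.Periodic (deriv S.f) (S.β - S.α) := by
  intro x
  rw [← deriv_comp_add_const]
  congr 1
  exact funext S.periodic

theorem exists_mem_Ico (x c : ℝ) : ∃ y ∈ Ico c (c + (S.β - S.α)),
    S.f y = S.f x ∧ deriv S.f y = deriv S.f x := by
  refine ⟨toIcoMod S.period_pos c x, toIcoMod_mem_Ico _ _ _, ?_, ?_⟩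
  · exact S.periodic.sub_zsmul_eq _
  · exact S.periodic_deriv.sub_zsmul_eq _

theorem f_mem_trace (x : ℝ) : S.f x ∈ S.trace := by
  obtain ⟨y, hy, h, -⟩ := S.exists_mem_Ico x S.α
  exact ⟨y, ⟨hy.1, by linarith [hy.2]⟩, h⟩

theorem exists_eq_of_mem_trace {x : ℂ} (hx : x ∈ S.trace) : ∃ y ∈ Ico S.α S.β, S.f y = x := by
  obtain ⟨z, -, rfl⟩ := hx
  obtain ⟨y, hy, h, -⟩ := S.exists_mem_Ico z S.α
  exact ⟨y, by simpa using hy, h⟩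

theorem param_mem {x : ℂ} (hx : x ∈ S.trace) : S.param x ∈ Ico S.α S.β :=
  Function.invFunOn_mem (S.exists_eq_of_mem_trace hx)

theorem f_param {x : ℂ} (hx : x ∈ S.trace) : S.f (S.param x) = x :=
  Function.invFunOn_eq (S.exists_eq_of_mem_trace hx)

/-- The tangent field on `Σ` does not depend on the parameter representing a point: `f` is injective
on one period and `f'` is periodic. -/
theorem tangentAt_f (x : ℝ) : S.tangentAt (S.f x) = deriv S.f x := by
  obtain ⟨y, hy, h, h'⟩ := S.exists_mem_Ico x S.α
  have h1 : S.param (S.f x) = y :=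
    S.simple (S.param_mem (S.f_mem_trace x)) (by simpa using hy)
      ((S.f_param (S.f_mem_trace x)).trans h.symm)
  rw [tangentAt, h1, h']

theorem norm_tangentAt (x : ℂ) : ‖S.tangentAt x‖ = 1 := S.arclength _

theorem oppositeDist_le {x y : ℂ} (hx : x ∈ S.trace) (hy : y ∈ S.trace)
    (h : S.tangentAt x = -S.tangentAt y) : S.oppositeDist ≤ ‖x - y‖ :=
  csInf_le ⟨0, by rintro r ⟨x, -, y, -, -, rfl⟩; exact norm_nonneg _⟩ ⟨x, hx, y, hy, h, rfl⟩

theorem norm_sub_le (x y : ℝ) : ‖S.f x - S.f y‖ ≤ |x - y| := by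
  have := Convex.norm_image_sub_le_of_norm_deriv_le (f := S.f) (s := univ) (C := 1) (x := y) (y := x)
    (fun x _ => (S.hasDerivAt x).differentiableAt) (fun x _ => (S.arclength x).le) convex_univ
    (mem_univ _) (mem_univ _)
  simpa using this

/-- Guarantees that an arc shorter than `d_Σ` does not wrap around `Σ`, so that the choice made in
`endParam` is the expected one. -/
theorem oppositeDist_le_period (h : 0 < S.oppositeDist) : S.oppositeDist ≤ S.β - S.α := by
  -- Positivity supplies a pair with opposite tangents, since the infimum of the empty set is `0`.
  have hne : {r | ∃ x ∈ S.trace, ∃ y ∈ S.trace, S.tangentAt x = -S.tangentAt y ∧ r = ‖x - y‖}.Nonempty := by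
    by_contra hcon
    rw [oppositeDist, not_nonempty_iff_eq_empty.1 hcon, Real.sInf_empty] at h
    exact lt_irrefl _ h
  obtain ⟨r, x, hx, y, hy, hxy, -⟩ := hne
  refine (S.oppositeDist_le hx hy hxy).trans ?_
  obtain ⟨u, hu, rfl⟩ := hx
  obtain ⟨v, hv, rfl⟩ := hy
  refine (S.norm_sub_le u v).trans ?_
  rw [abs_le]
  constructor <;> linarith [hu.1, hu.2, hv.1, hv.2]

theorem norm_sub_le_diam {x y : ℂ} (hx : x ∈ S.trace) (hy : y ∈ S.trace) :
    ‖x - y‖ ≤ Metric.diam S.trace := by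
  rw [← dist_eq_norm]
  exact Metric.dist_le_diam_of_mem
    (isCompact_Icc.image S.smooth.continuous).isBounded hx hy

/-- On the support curve the unit tangent is a Lipschitz function of the position. -/
theorem exists_norm_deriv_sub_le :
    ∃ C, ∀ x y, ‖deriv S.f x - deriv S.f y‖ ≤ C * ‖S.f x - S.f y‖ := by
  set P := S.β - S.α with hP
  have hP0 : 0 < P := S.period_pos
  let W := deriv S.f
  have hW : Continuous W := S.contDiff_deriv.continuous
  have hz : ∀ u v : ℝ, ((v - u : ℝ) : ℂ) * secantMap W (u, v) = S.f v - S.f u := fun u v =>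
    mul_secantMap (a := min u v) (b := max u v) hW
      (fun p _ => (S.hasDerivAt p).hasDerivWithinAt) ⟨min_le_left _ _, le_max_left _ _⟩
      ⟨min_le_right _ _, le_max_right _ _⟩
  -- On parameter pairs at distance at most half a period the secant map has no zero: on the
  -- diagonal it is `f'`, and off the diagonal a zero would contradict simplicity. By compactness
  -- its norm has a positive minimum, which bounds chords below by parameter distances.
  let K : Set (ℝ × ℝ) := (Icc S.α S.β ×ˢ Icc (S.α - P) (S.β + P)) ∩ {x | |x.1 - x.2| ≤ P / 2}
  have hK : IsCompact K := (isCompact_Icc.prod isCompact_Icc).inter_right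
    (isClosed_le (by fun_prop) (by fun_prop))
  have hKne : K.Nonempty := ⟨(S.α, S.α), ⟨⟨le_rfl, S.lt.le⟩, ⟨by simp [hP0.le], by linarith [S.lt]⟩⟩, by
    simpa using (half_pos hP0).le⟩
  obtain ⟨⟨u₀, v₀⟩, hm, hmin⟩ := hK.exists_isMinOn hKne
    (continuous_secantMap hW).norm.continuousOn
  have hm0 : 0 < ‖secantMap W (u₀, v₀)‖ := by
    rw [norm_pos_iff]
    intro h0
    rcases eq_or_ne u₀ v₀ with rfl | hne
    · rw [secantMap_self] at h0
      exact S.deriv_ne_zero _ h0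
    · have h1 := hz u₀ v₀
      rw [h0, mul_zero] at h1
      have h2 : S.f v₀ = S.f u₀ := sub_eq_zero.1 h1.symm
      obtain ⟨c, hc1, hc2⟩ : ∃ c, u₀ ∈ Ico c (c + P) ∧ v₀ ∈ Ico c (c + P) := by
        have h3 : |u₀ - v₀| ≤ P / 2 := hm.2
        rw [abs_le] at h3
        refine ⟨min u₀ v₀, ⟨min_le_left _ _, ?_⟩, ⟨min_le_right _ _, ?_⟩⟩ <;>
          rcases min_cases u₀ v₀ with h | h <;> linarith
      have e1 : toIcoMod S.period_pos S.α u₀ = toIcoMod S.period_pos S.α v₀ := by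
        have a1 := toIcoMod_mem_Ico S.period_pos S.α u₀
        have a2 := toIcoMod_mem_Ico S.period_pos S.α v₀
        rw [add_sub_cancel] at a1 a2
        refine S.simple a1 a2 ?_
        have b1 : S.f (toIcoMod S.period_pos S.α u₀) = S.f u₀ := S.periodic.sub_zsmul_eq _
        have b2 : S.f (toIcoMod S.period_pos S.α v₀) = S.f v₀ := S.periodic.sub_zsmul_eq _
        rw [b1, b2, h2]
      have e2 := (toIcoMod_eq_toIcoMod S.period_pos).1 e1
      obtain ⟨n, hn⟩ := e2
      rw [zsmul_eq_mul] at hn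
      have h4 : |v₀ - u₀| ≤ P / 2 := by rw [abs_sub_comm]; exact hm.2
      rw [hn, abs_mul, ← hP, abs_of_pos hP0] at h4
      have hn0 : n ≠ 0 := by
        rintro rfl
        simp at hn
        exact hne (by linarith)
      have h5 : (1 : ℝ) ≤ |(n : ℝ)| := by exact_mod_cast Int.one_le_abs hn0
      nlinarith
  obtain ⟨B, hB⟩ := (isCompact_Icc (a := S.α - P) (b := S.β + P)).exists_bound_of_continuousOn
    S.continuous_curv.continuousOn
  refine ⟨B / ‖secantMap W (u₀, v₀)‖, fun x y => ?_⟩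
  obtain ⟨u, hu, hu1, hu2⟩ := S.exists_mem_Ico x S.α
  -- A window of one period centred at `u` provides a representative with `|u - v| ≤ P / 2`.
  obtain ⟨v, hv, hv1, hv2⟩ := S.exists_mem_Ico y (u - P / 2)
  rw [← hP] at hu hv
  rw [← hu1, ← hu2, ← hv1, ← hv2]
  have huv : (u, v) ∈ K := by
    refine ⟨⟨⟨hu.1, by linarith [hu.2]⟩, ⟨by linarith [hu.1, hv.1], by linarith [hu.2, hv.2]⟩⟩, ?_⟩
    change |u - v| ≤ P / 2
    rw [abs_le]; constructor <;> linarith [hv.1, hv.2]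
  have h1 : ‖secantMap W (u₀, v₀)‖ ≤ ‖secantMap W (u, v)‖ := hmin huv
  have h2 : |u - v| * ‖secantMap W (u, v)‖ = ‖S.f u - S.f v‖ := by
    rw [norm_sub_rev, ← hz u v, norm_mul, Complex.norm_real, Real.norm_eq_abs, abs_sub_comm]
  have hum : u ∈ Icc (S.α - P) (S.β + P) := ⟨by linarith [hu.1], by linarith [hu.2]⟩
  have h3 : ‖deriv S.f u - deriv S.f v‖ ≤ B * ‖u - v‖ :=
    Convex.norm_image_sub_le_of_norm_hasDerivWithin_le
      (fun p _ => (S.hasDerivAt_deriv p).hasDerivWithinAt)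
      (fun p hp => by
        rw [norm_mul, norm_mul, S.arclength, Complex.norm_I, Complex.norm_real, mul_one, mul_one]
        exact hB p hp) (convex_Icc _ _) huv.1.2 hum
  have hB0 : 0 ≤ B := (norm_nonneg _).trans (hB u hum)
  rw [div_mul_eq_mul_div, le_div_iff₀ hm0]
  calc ‖deriv S.f u - deriv S.f v‖ * ‖secantMap W (u₀, v₀)‖
      ≤ B * ‖u - v‖ * ‖secantMap W (u, v)‖ :=
        mul_le_mul h3 h1 (norm_nonneg _) (mul_nonneg hB0 (norm_nonneg _))
    _ = B * ‖S.f u - S.f v‖ := by rw [← h2, Real.norm_eq_abs, mul_assoc]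

variable {S}

/-- Since `i f'` is the inner normal of `Σ`, the curve leaves `Σ` along the outer normal and, by the
condition at `b`, returns along the inner one. -/
theorem MeetsOrthogonally.tangentAt_left {a b : ℝ} {f : ℝ → ℂ} (h : S.MeetsOrthogonally a b f)
    (h0 : PlaneCurve.velocity a b f a ≠ 0) :
    S.tangentAt (f a) = Complex.I * PlaneCurve.tangent a b f a := by
  rw [eq_exp_mul_of_oangle_eq (PlaneCurve.norm_tangent h0) (S.norm_tangentAt _) h.left_angle]
  rw [Complex.ofReal_div, Complex.ofReal_ofNat, Complex.exp_pi_div_two_mul_I]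

theorem MeetsOrthogonally.tangentAt_right {a b : ℝ} {f : ℝ → ℂ} (h : S.MeetsOrthogonally a b f)
    (h0 : PlaneCurve.velocity a b f b ≠ 0) :
    S.tangentAt (f b) = -Complex.I * PlaneCurve.tangent a b f b := by
  rw [eq_exp_mul_of_oangle_eq (PlaneCurve.norm_tangent h0) (S.norm_tangentAt _) h.right_angle]
  rw [Complex.ofReal_neg, neg_mul, Complex.exp_neg, Complex.ofReal_div, Complex.ofReal_ofNat,
    Complex.exp_pi_div_two_mul_I, Complex.inv_I]

end SupportCurve

/-! ### Normal coordinates along the support curve -/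

/-- Global solvability of `q' = N(p, q) / (1 + max(0, H(p, q)))` on `[a, b]`, for bounded `N` and
continuously differentiable data. -/
theorem exists_solution_of_bounded {a b M x₀ : ℝ} (hab : a ≤ b) {N H Nx Hx : ℝ → ℝ → ℝ}
    (hNx : ContinuousOn (fun y : ℝ × ℝ => Nx y.1 y.2) (Icc a b ×ˢ univ))
    (hHx : ContinuousOn (fun y : ℝ × ℝ => Hx y.1 y.2) (Icc a b ×ˢ univ))
    (hNd : ∀ p ∈ Icc a b, ∀ x, HasDerivAt (N p) (Nx p x) x)
    (hHd : ∀ p ∈ Icc a b, ∀ x, HasDerivAt (H p) (Hx p x) x)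
    (hNc : ∀ x, ContinuousOn (fun p => N p x) (Icc a b))
    (hHc : ∀ x, ContinuousOn (fun p => H p x) (Icc a b))
    (hM : ∀ p ∈ Icc a b, ∀ x, |N p x| ≤ M) :
    ∃ q : ℝ → ℝ, q a = x₀ ∧ ∀ p ∈ Icc a b,
      HasDerivWithinAt q (N p (q p) / (1 + max 0 (H p (q p)))) (Icc a b) p := by
  have ham : a ∈ Icc a b := left_mem_Icc.2 hab
  have hM0 : 0 ≤ M := (abs_nonneg _).trans (hM a ham x₀)
  -- The denominator is at least `1`, so the speed is at most `M` and solutions stay within `M (b -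
  -- a)` of `x₀`; Picard–Lindelöf on this ball covers all of `[a, b]`.
  set R := M * (b - a)
  have hR : 0 ≤ R := mul_nonneg hM0 (sub_nonneg.2 hab)
  have hcomp := (isCompact_Icc (a := a) (b := b)).prod (isCompact_closedBall x₀ R)
  obtain ⟨C₁, hC₁⟩ := hcomp.exists_bound_of_continuousOn
    (hNx.mono (prod_mono_right (subset_univ _)))
  obtain ⟨C₂, hC₂⟩ := hcomp.exists_bound_of_continuousOn
    (hHx.mono (prod_mono_right (subset_univ _)))
  have hx₀ : x₀ ∈ Metric.closedBall x₀ R := Metric.mem_closedBall_self hR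
  have hC₁0 : 0 ≤ C₁ := (norm_nonneg _).trans (hC₁ (a, x₀) ⟨ham, hx₀⟩)
  have hC₂0 : 0 ≤ C₂ := (norm_nonneg _).trans (hC₂ (a, x₀) ⟨ham, hx₀⟩)
  have hden : ∀ p x, 1 ≤ 1 + max 0 (H p x) := fun p x => by simp
  have hPL : IsPicardLindelof (fun p x => N p x / (1 + max 0 (H p x))) (tmin := a) (tmax := b)
      ⟨a, ham⟩ x₀ ⟨R, hR⟩ 0 ⟨M, hM0⟩ ⟨C₁ + M * C₂, add_nonneg hC₁0 (mul_nonneg hM0 hC₂0)⟩ := by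
    refine ⟨fun p hp => ?_, fun x _ => ?_, fun p hp x _ => ?_, ?_⟩
    · refine LipschitzOnWith.of_dist_le_mul fun x hx y hy => ?_
      simp only [dist_eq_norm]
      change _ ≤ (C₁ + M * C₂) * _
      have h1 : ‖N p x - N p y‖ ≤ C₁ * ‖x - y‖ :=
        Convex.norm_image_sub_le_of_norm_hasDerivWithin_le
          (fun u _ => (hNd p hp u).hasDerivWithinAt) (fun u hu => hC₁ (p, u) ⟨hp, hu⟩)
          (convex_closedBall _ _) hy hx
      have h2 : ‖H p x - H p y‖ ≤ C₂ * ‖x - y‖ :=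
        Convex.norm_image_sub_le_of_norm_hasDerivWithin_le
          (fun u _ => (hHd p hp u).hasDerivWithinAt) (fun u hu => hC₂ (p, u) ⟨hp, hu⟩)
          (convex_closedBall _ _) hy hx
      have h3 : |max 0 (H p y) - max 0 (H p x)| ≤ ‖H p x - H p y‖ := by
        have := abs_max_sub_max_le_max 0 (H p y) 0 (H p x)
        rwa [sub_self, abs_zero, max_eq_right (abs_nonneg (H p y - H p x)),
          abs_sub_comm (H p y)] at this
      have d1 := hden p x
      have d2 := hden p y
      set A := 1 + max 0 (H p x) with hA
      set B := 1 + max 0 (H p y) with hB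
      have hAB : |B - A| ≤ C₂ * ‖x - y‖ := by
        rw [hA, hB, add_sub_add_left_eq_sub]; exact h3.trans h2
      -- This splitting of the difference of quotients gives the Lipschitz constant `C₁ + M C₂`,
      -- because `A, B ≥ 1`, `|N| ≤ M` and truncation at `0` is `1`-Lipschitz.
      have e1 : N p x / A - N p y / B = (N p x - N p y) / A + N p y * (B - A) / (A * B) := by
        have : A ≠ 0 := by linarith
        have : B ≠ 0 := by linarith
        field_simp
        ring
      clear_value A B
      rw [e1]
      refine (norm_add_le _ _).trans ?_
      rw [add_mul]
      refine add_le_add ?_ ?_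
      · rw [norm_div, Real.norm_of_nonneg (by linarith : 0 ≤ A)]
        exact (div_le_self (norm_nonneg _) d1).trans h1
      · rw [norm_div, norm_mul, Real.norm_of_nonneg (by positivity : 0 ≤ A * B), mul_assoc]
        refine (div_le_self (by positivity) (by nlinarith)).trans ?_
        exact mul_le_mul (hM p hp y) hAB (norm_nonneg _) hM0
    · refine (hNc x).div (continuousOn_const.add (ContinuousOn.sup continuousOn_const (hHc x))) fun p _ => ?_
      linarith [hden p x]
    · change ‖N p x / (1 + max 0 (H p x))‖ ≤ M
      rw [norm_div, Real.norm_of_nonneg (by linarith [hden p x] : 0 ≤ 1 + max 0 (H p x))]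
      exact (div_le_self (norm_nonneg _) (hden p x)).trans (hM p hp x)
    · change M * max (b - a) (a - a) ≤ R - 0
      rw [sub_self, max_eq_left (sub_nonneg.2 hab), sub_zero]
  exact hPL.exists_eq_forall_mem_Icc_hasDerivWithinAt₀

/-- A continuous angle with positive cosine that starts at `0` stays in `(-π/2, π/2)`. -/
theorem abs_lt_of_cos_pos {a b : ℝ} {θ : ℝ → ℝ} (hθ : ContinuousOn θ (Icc a b)) (ha : θ a = 0)
    (hc : ∀ p ∈ Icc a b, 0 < Real.cos (θ p)) : ∀ p ∈ Icc a b, |θ p| < Real.pi / 2 := by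
  intro p hp
  by_contra! h
  have hsub : Icc a p ⊆ Icc a b := Icc_subset_Icc_right hp.2
  obtain ⟨x, hx, hxθ⟩ : Real.pi / 2 ∈ (fun x => |θ x|) '' Icc a p :=
    intermediate_value_Icc hp.1 ((hθ.mono hsub).abs)
      ⟨by simp only [ha, abs_zero]; linarith [Real.pi_pos], h⟩
  have h1 := hc x (hsub hx)
  simp only at hxθ
  rw [← Real.cos_abs, hxθ, Real.cos_pi_div_two] at h1
  exact lt_irrefl _ h1

namespace SupportCurve

open PlaneCurve

variable (S : SupportCurve)

/-- Normal coordinates along the support curve: a curve that starts on the support curve in the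
direction of the outer normal and afterwards avoids it is of the form
`f(q) + r n(q)` with `r > 0`, where `n = -i f'`. -/
theorem exists_normal_coordinates {a b : ℝ} (hab : a < b) {c v : ℝ → ℂ} {x₀ : ℝ}
    (hc : ∀ p ∈ Icc a b, HasDerivWithinAt c (v p) (Icc a b) p) (hv : ContinuousOn v (Icc a b))
    (hca : c a = S.f x₀) (hva : (v a * conj (deriv S.f x₀)).im < 0)
    (hout : ∀ p ∈ Ioo a b, c p ∉ S.trace) :
    ∃ q r q' : ℝ → ℝ, q a = x₀ ∧ ContinuousOn q' (Icc a b) ∧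
      (∀ p ∈ Icc a b, HasDerivWithinAt q (q' p) (Icc a b) p) ∧
      (∀ p ∈ Icc a b, HasDerivWithinAt r (-(v p * conj (deriv S.f (q p))).im) (Icc a b) p) ∧
      (∀ p ∈ Icc a b, (v p * conj (deriv S.f (q p))).re = q' p * (1 + S.curv (q p) * r p)) ∧
      (∀ p ∈ Icc a b, c p = S.f (q p) - r p * Complex.I * deriv S.f (q p)) ∧
      (∀ p ∈ Icc a b, 0 ≤ r p) ∧ (∀ p ∈ Ioo a b, 0 < r p) ∧ r a = 0 := by
  have hcurv : ContDiff ℝ (⊤ : ℕ∞) S.curv :=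
    Complex.imCLM.contDiff.comp (S.contDiff_deriv_deriv.mul
      (Complex.conjCLE.contDiff.comp S.contDiff_deriv))
  have hcurvd : ∀ x, HasDerivAt S.curv (deriv S.curv x) x := fun x =>
    ((hcurv.differentiable (by simp)) x).hasDerivAt
  have hcurvc : Continuous (deriv S.curv) := (hcurv.continuous_deriv (by simp))
  have hfc := S.smooth.continuous
  have hf'c := S.contDiff_deriv.continuous
  have hκc := S.continuous_curv
  have hcc : ContinuousOn c (Icc a b) := fun p hp => (hc p hp).continuousWithinAt
  have hconjd : ∀ x, HasDerivAt (fun x => conj (deriv S.f x))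
      (conj (S.curv x * Complex.I * deriv S.f x)) x := fun x =>
    Complex.conjCLE.toContinuousLinearMap.hasFDerivAt.comp_hasDerivAt x (S.hasDerivAt_deriv x)
  have him : ∀ {u : ℝ → ℂ} {u' : ℂ} {s : Set ℝ} {x : ℝ}, HasDerivWithinAt u u' s x →
      HasDerivWithinAt (fun x => (u x).im) u'.im s x := fun h =>
    Complex.imCLM.hasFDerivAt.comp_hasDerivWithinAt _ h
  have hre : ∀ {u : ℝ → ℂ} {u' : ℂ} {s : Set ℝ} {x : ℝ}, HasDerivWithinAt u u' s x →
      HasDerivWithinAt (fun x => (u x).re) u'.re s x := fun h =>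
    Complex.reCLM.hasFDerivAt.comp_hasDerivWithinAt _ h
  obtain ⟨M, hM⟩ := isCompact_Icc.exists_bound_of_continuousOn hv
  -- Let `e` and `-r` be the components of `c - f(q)` along `f'(q)` and `i f'(q)`. Then `e' = Re (v
  -- · conj f'(q)) - q' (1 + κ r)`, so `e ≡ 0` calls for `q' = Re (v · conj f'(q)) / (1 + κ r)`. The
  -- sign of `r` is not yet known; truncating `κ r` at `0` makes the equation globally solvable and
  -- changes nothing where `r ≥ 0`.
  obtain ⟨q, hqa, hq⟩ := exists_solution_of_bounded (x₀ := x₀) (M := M) hab.le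
    (N := fun p x => (v p * conj (deriv S.f x)).re)
    (H := fun p x => S.curv x * -((c p - S.f x) * conj (deriv S.f x)).im)
    (Nx := fun p x => (v p * conj (S.curv x * Complex.I * deriv S.f x)).re)
    (Hx := fun p x => deriv S.curv x * -((c p - S.f x) * conj (deriv S.f x)).im +
      S.curv x * -(-deriv S.f x * conj (deriv S.f x) +
        (c p - S.f x) * conj (S.curv x * Complex.I * deriv S.f x)).im)
    (by
      have h1 : ContinuousOn (fun y : ℝ × ℝ => v y.1) (Icc a b ×ˢ univ) :=
        hv.comp continuousOn_fst fun y hy => hy.1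
      exact Complex.continuous_re.comp_continuousOn (h1.mul (by fun_prop)))
    (by
      have h1 : ContinuousOn (fun y : ℝ × ℝ => c y.1) (Icc a b ×ˢ univ) :=
        hcc.comp continuousOn_fst fun y hy => hy.1
      have h2 : ContinuousOn (fun y : ℝ × ℝ => c y.1 - S.f y.2) (Icc a b ×ˢ univ) :=
        h1.sub (by fun_prop)
      refine ContinuousOn.add (ContinuousOn.mul (by fun_prop) (ContinuousOn.neg ?_))
        (ContinuousOn.mul (by fun_prop) (ContinuousOn.neg ?_))
      · exact Complex.continuous_im.comp_continuousOn (h2.mul (by fun_prop))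
      · refine Complex.continuous_im.comp_continuousOn (ContinuousOn.add (by fun_prop) ?_)
        exact h2.mul (by fun_prop))
    (fun p _ x => by
      have := hre ((hconjd x).hasDerivWithinAt.const_mul (v p)) (s := univ)
      simpa using this)
    (fun p _ x => by
      have h1 := ((S.hasDerivAt x).const_sub (c p)).fun_mul (hconjd x)
      have h2 := him (hasDerivWithinAt_univ.2 h1)
      exact (hcurvd x).fun_mul (hasDerivWithinAt_univ.1 h2).fun_neg)
    (fun x => Complex.continuous_re.comp_continuousOn (hv.mul continuousOn_const))
    (fun x => continuousOn_const.mul (Complex.continuous_im.comp_continuousOn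
      ((hcc.sub continuousOn_const).mul continuousOn_const)).neg)
    (fun p hp x => by
      refine (Complex.abs_re_le_norm _).trans ?_
      rw [norm_mul, RCLike.norm_conj, S.arclength, mul_one]
      exact hM p hp)
  set r : ℝ → ℝ := fun p => -((c p - S.f (q p)) * conj (deriv S.f (q p))).im with hr
  set e : ℝ → ℝ := fun p => ((c p - S.f (q p)) * conj (deriv S.f (q p))).re with he
  set q' : ℝ → ℝ := fun p => (v p * conj (deriv S.f (q p))).re /
    (1 + max 0 (S.curv (q p) * r p)) with hq'
  have hqd : ∀ p ∈ Icc a b, HasDerivWithinAt q (q' p) (Icc a b) p := hq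
  have hqc : ContinuousOn q (Icc a b) := fun p hp => (hqd p hp).continuousWithinAt
  have hYd : ∀ p ∈ Icc a b,
      HasDerivWithinAt (fun p => (c p - S.f (q p)) * conj (deriv S.f (q p)))
      (v p * conj (deriv S.f (q p)) - q' p -
        S.curv (q p) * q' p * Complex.I * ((c p - S.f (q p)) * conj (deriv S.f (q p))))
      (Icc a b) p := by
    intro p hp
    have h1 := (S.hasDerivAt (q p)).scomp_hasDerivWithinAt p (hqd p hp)
    have h2 := (hconjd (q p)).scomp_hasDerivWithinAt p (hqd p hp)
    refine (((hc p hp).sub h1).fun_mul h2).congr_deriv ?_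
    have h3 := S.deriv_mul_conj (q p)
    simp only [Complex.real_smul, map_mul, Complex.conj_I, Complex.conj_ofReal, Function.comp,
      Pi.sub_apply]
    linear_combination (-(q' p : ℂ)) * h3
  have hrd : ∀ p ∈ Icc a b, HasDerivWithinAt r
      (-(v p * conj (deriv S.f (q p))).im + S.curv (q p) * q' p * e p) (Icc a b) p := by
    intro p hp
    refine (him (hYd p hp)).fun_neg.congr_deriv ?_
    have : (S.curv (q p) * q' p * Complex.I : ℂ) = ((S.curv (q p) * q' p : ℝ) : ℂ) * Complex.I := by
      push_cast; ring
    rw [this, mul_assoc]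
    simp only [Complex.sub_im, Complex.ofReal_im, Complex.im_ofReal_mul, Complex.I_mul_im, he]
    ring
  have hed : ∀ p ∈ Icc a b, HasDerivWithinAt e
      ((v p * conj (deriv S.f (q p))).re - q' p * (1 + S.curv (q p) * r p)) (Icc a b) p := by
    intro p hp
    refine (hre (hYd p hp)).congr_deriv ?_
    have : (S.curv (q p) * q' p * Complex.I : ℂ) = ((S.curv (q p) * q' p : ℝ) : ℂ) * Complex.I := by
      push_cast; ring
    rw [this, mul_assoc]
    simp only [Complex.sub_re, Complex.ofReal_re, Complex.re_ofReal_mul, Complex.I_mul_re, hr]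
    ring
  have hra : r a = 0 := by simp [hr, hqa, hca]
  have hea : e a = 0 := by simp [he, hqa, hca]
  have hX : ∀ p, 0 ≤ r p →
      (v p * conj (deriv S.f (q p))).re = q' p * (1 + S.curv (q p) * r p) := by
    intro p hp
    have h1 : 0 ≤ S.curv (q p) * r p := mul_nonneg (S.curv_nonneg _) hp
    simp only [hq']
    rw [max_eq_right h1, div_mul_cancel₀]
    linarith
  have he0 : ∀ s ∈ Icc a b, (∀ p ∈ Icc a s, 0 ≤ r p) → ∀ p ∈ Icc a s, e p = 0 := by
    intro s hs hrs p hp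
    have h1 : ∀ p ∈ Icc a s, HasDerivWithinAt e 0 (Icc a s) p := by
      intro p hp
      have hsub : Icc a s ⊆ Icc a b := Icc_subset_Icc_right hs.2
      refine ((hed p (hsub hp)).mono hsub).congr_deriv ?_
      rw [hX p (hrs p hp), sub_self]
    rw [eq_left_of_hasDerivWithinAt_zero h1 p hp, hea]
  have hrc : ContinuousOn r (Icc a b) := fun p hp => (hrd p hp).continuousWithinAt
  have hYeq : ∀ p, c p = S.f (q p) + (e p - r p * Complex.I) * deriv S.f (q p) := by
    intro p
    have h1 : ((e p - r p * Complex.I : ℂ)) = (c p - S.f (q p)) * conj (deriv S.f (q p)) := by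
      apply Complex.ext <;> simp [he, hr]
    rw [h1, mul_assoc, mul_comm (conj _), S.deriv_mul_conj]
    ring
  -- The initial direction makes `r` positive just after `a`. At the first later parameter with `r ≤
  -- 0` both `r` and `e` vanish, so the curve would lie on `Σ` there.
  have hrpos : ∀ p ∈ Ioo a b, 0 < r p := by
    have ham : a ∈ Icc a b := left_mem_Icc.2 hab.le
    have h1 : ∀ᶠ p in 𝓝[>] a, 0 < r p := by
      have h2 := (hrd a ham).mono Ioc_subset_Icc_self
      rw [hasDerivWithinAt_iff_tendsto_slope' left_notMem_Ioc, nhdsWithin_Ioc_eq_nhdsGT hab] at h2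
      have h3 : 0 < -(v a * conj (deriv S.f (q a))).im + S.curv (q a) * q' a * e a := by
        rw [hea, mul_zero, add_zero, hqa]; linarith
      filter_upwards [h2.eventually (lt_mem_nhds h3), self_mem_nhdsWithin] with p hp hp'
      rw [slope_def_field, hra, sub_zero] at hp
      exact (div_pos_iff_of_pos_right (sub_pos.2 hp')).1 hp
    obtain ⟨u, hu, hu'⟩ := mem_nhdsGT_iff_exists_Ioo_subset.1 h1
    intro p hp
    by_contra! hneg
    have hup : u ≤ p := by
      by_contra! hcon
      exact absurd (hu' ⟨hp.1, hcon⟩ : 0 < r p) (not_lt.2 hneg)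
    have hsub : Icc u p ⊆ Icc a b := Icc_subset_Icc (le_of_lt hu) hp.2.le
    obtain ⟨s, hs, hsmin⟩ : ∃ s, IsLeast (Icc u p ∩ r ⁻¹' Iic 0) s := by
      have hcl : IsClosed (Icc u p ∩ r ⁻¹' Iic 0) :=
        (hrc.mono hsub).preimage_isClosed_of_isClosed isClosed_Icc isClosed_Iic
      exact (isCompact_Icc.of_isClosed_subset hcl inter_subset_left).exists_isLeast
        ⟨p, ⟨hup, le_rfl⟩, hneg⟩
    have hsm : s ∈ Icc a b := hsub hs.1
    have has : a < s := lt_of_lt_of_le hu hs.1.1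
    have hlt : ∀ x ∈ Ioo a s, 0 < r x := by
      intro x hx
      rcases lt_or_ge x u with h | h
      · exact hu' ⟨hx.1, h⟩
      · by_contra! hcon
        exact absurd (hsmin ⟨⟨h, hx.2.le.trans hs.1.2⟩, hcon⟩) (not_le.2 hx.2)
    have hrs : 0 ≤ r s := by
      have hcw : ContinuousWithinAt r (Ioo a s) s :=
        (hrc s hsm).mono (Ioo_subset_Icc_self.trans (Icc_subset_Icc_right hsm.2))
      have : (𝓝[Ioo a s] s).NeBot := by
        rw [nhdsWithin_Ioo_eq_nhdsLT has]; infer_instance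
      exact ge_of_tendsto hcw (by filter_upwards [self_mem_nhdsWithin] with x hx using (hlt x hx).le)
    have hrs0 : r s = 0 := le_antisymm hs.2 hrs
    have hes : e s = 0 := by
      refine he0 s hsm (fun x hx => ?_) s ⟨has.le, le_rfl⟩
      rcases eq_or_lt_of_le hx.1 with rfl | h
      · exact hra.ge
      rcases eq_or_lt_of_le hx.2 with rfl | h'
      · exact hrs
      · exact (hlt x ⟨h, h'⟩).le
    refine hout s ⟨has, hs.1.2.trans_lt hp.2⟩ ?_
    rw [hYeq s, hes, hrs0]
    simpa using S.f_mem_trace (q s)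
  have hrnn : ∀ p ∈ Icc a b, 0 ≤ r p := by
    intro p hp
    rcases eq_or_lt_of_le hp.1 with rfl | h
    · exact hra.ge
    rcases eq_or_lt_of_le hp.2 with rfl | h'
    · have hcw : ContinuousWithinAt r (Ioo a p) p := (hrc p hp).mono Ioo_subset_Icc_self
      have : (𝓝[Ioo a p] p).NeBot := by
        rw [nhdsWithin_Ioo_eq_nhdsLT hab]; infer_instance
      exact ge_of_tendsto hcw
        (by filter_upwards [self_mem_nhdsWithin] with x hx using (hrpos x hx).le)
    · exact (hrpos p ⟨h, h'⟩).le
  have hez : ∀ p ∈ Icc a b, e p = 0 := he0 b (right_mem_Icc.2 hab.le) hrnn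
  refine ⟨q, r, q', hqa, ?_, hqd, ?_, fun p hp => hX p (hrnn p hp), ?_, hrnn, hrpos, hra⟩
  · have h1 : ContinuousOn (fun p => conj (deriv S.f (q p))) (Icc a b) :=
      (Complex.continuous_conj.comp hf'c).comp_continuousOn hqc
    refine (Complex.continuous_re.comp_continuousOn (hv.mul h1)).div
      (continuousOn_const.add (ContinuousOn.sup continuousOn_const
        ((hκc.comp_continuousOn hqc).mul hrc))) fun p _ => ?_
    have : 0 ≤ max 0 (S.curv (q p) * r p) := le_max_left _ _
    linarith
  · intro p hp
    simpa [hez p hp] using hrd p hp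
  · intro p hp
    conv_lhs => rw [hYeq p, hez p hp]
    push_cast
    ring
end SupportCurve

/-! ### Total curvature and enclosed area of the initial curve -/

namespace SupportCurve

open PlaneCurve

variable (S : SupportCurve)

/-- A parameter distance below the minimal distance of opposite points forces the support curve to
turn by less than `π`. -/
theorem angle_sub_lt_pi {x y : ℝ} (hxy : x ≤ y) (h : y - x < S.oppositeDist) :
    S.angle y - S.angle x < Real.pi := by
  by_contra! hcon
  -- Turning by at least `π` would produce a tangent exactly opposite to that at `x`, at a point
  -- closer than `d_Σ`.
  obtain ⟨u, hu, hu'⟩ : S.angle x + Real.pi ∈ S.angle '' Icc x y :=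
    intermediate_value_Icc hxy S.continuous_angle.continuousOn
      ⟨by linarith [Real.pi_pos], by linarith⟩
  have h1 : deriv S.f u = -deriv S.f x := by
    rw [S.deriv_eq_mul_exp x u, hu', add_sub_cancel_left, Complex.exp_pi_mul_I]
    ring
  have h2 := S.oppositeDist_le (S.f_mem_trace u) (S.f_mem_trace x)
    (by rw [S.tangentAt_f, S.tangentAt_f, h1])
  have h3 := S.norm_sub_le u x
  rw [abs_of_nonneg (sub_nonneg.2 hu.1)] at h3
  linarith [hu.2]

/-- The start lies in `[α, β)`, so a parameter less than one period later lies in `[α, β)` or in its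
translate by one period; these are the two branches of `endParam`. -/
theorem endParam_eq {a b x : ℝ} {c₀ : ℝ → ℂ} (ha : c₀ a ∈ S.trace) (hx : S.f x = c₀ b)
    (h1 : S.startParam a c₀ < x) (h2 : x < S.startParam a c₀ + (S.β - S.α)) :
    S.endParam a b c₀ = x := by
  have hs : S.startParam a c₀ ∈ Ico S.α S.β := S.param_mem ha
  have hb : c₀ b ∈ S.trace := hx ▸ S.f_mem_trace x
  have hp := S.param_mem hb
  have hfp := S.f_param hb
  rw [endParam]
  rcases lt_or_ge x S.β with h | h
  · have : S.param (c₀ b) = x :=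
      S.simple hp ⟨hs.1.trans h1.le, h⟩ (hfp.trans hx.symm)
    rw [this, if_pos h1]
  · have : S.param (c₀ b) = x - (S.β - S.α) :=
      S.simple hp ⟨by linarith [S.lt], by linarith [hs.2]⟩
        (by rw [hfp, S.periodic.sub_eq, hx])
    rw [this, if_neg (by linarith), sub_add_cancel]

theorem continuous_wedge : Continuous fun x =>
    (S.f x).re * (deriv S.f x).im - (S.f x).im * (deriv S.f x).re := by
  have := S.smooth.continuous
  have := S.contDiff_deriv.continuous
  fun_prop

/-- The line integral along the boundary curve, in terms of the parametrization of `Σ`. -/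
theorem sweptArea_boundaryCurve (a b : ℝ) (c₀ : ℝ → ℂ) :
    sweptArea 0 1 (S.boundaryCurve a b c₀) = (1 / 2) * ∫ x in S.startParam a c₀..S.endParam a b c₀,
      ((S.f x).re * (deriv S.f x).im - (S.f x).im * (deriv S.f x).re) := by
  rw [sweptArea]
  congr 1
  set d := S.endParam a b c₀ - S.startParam a c₀ with hd
  set x₀ := S.startParam a c₀
  have h1 : ∀ p ∈ Icc (0 : ℝ) 1, velocity 0 1 (S.boundaryCurve a b c₀) p =
      d • deriv S.f (d * p + x₀) := by
    intro p hp
    have h2 : HasDerivAt (fun p => d * p + x₀) d p := by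
      simpa using ((hasDerivAt_id p).const_mul d).add_const x₀
    exact ((S.hasDerivAt (d * p + x₀)).scomp p h2).hasDerivWithinAt.derivWithin
      ((uniqueDiffOn_Icc one_pos) p hp)
  have h2 := intervalIntegral.smul_integral_comp_mul_add (a := 0) (b := 1)
    (fun x => (S.f x).re * (deriv S.f x).im - (S.f x).im * (deriv S.f x).re) d x₀
  rw [mul_zero, zero_add, mul_one, hd, sub_add_cancel, ← hd] at h2
  rw [← h2, smul_eq_mul, ← intervalIntegral.integral_const_mul]
  apply intervalIntegral.integral_congr
  intro p hp
  rw [uIcc_of_le zero_le_one] at hp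
  simp only [h1 p hp, boundaryCurve]
  simp
  ring

theorem im_conj_mul (z w : ℂ) : (conj z * w).im = z.re * w.im - z.im * w.re := by
  simp
  ring

/-- For a positively curved initial curve with the stated properties, the total curvature lies
in `[π, 2π)` and the enclosed area is positive. -/
theorem initial_curve {S : SupportCurve} {a b : ℝ} {c₀ : ℝ → ℂ} (hc₀ : S.IsInitialCurve a b c₀)
    (hκ : ∀ p ∈ Icc a b, 0 < curvature a b c₀ p) (hinj : InjOn c₀ (Icc a b))
    (hout : ∀ p ∈ Ioo a b, c₀ p ∈ S.outerDomain) (hL : arcLength a b c₀ < S.oppositeDist) :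
    Real.pi ≤ turning a b c₀ ∧ turning a b c₀ < 2 * Real.pi ∧
      S.startParam a c₀ < S.endParam a b c₀ ∧ S.f (S.startParam a c₀) = c₀ a ∧
      S.f (S.endParam a b c₀) = c₀ b ∧ 0 < S.enclosedArea a b c₀ := by
  have hpi := Real.pi_pos
  have hab := hc₀.lt
  have ham : a ∈ Icc a b := left_mem_Icc.2 hab.le
  have hbm : b ∈ Icc a b := right_mem_Icc.2 hab.le
  have hsm := hc₀.smooth
  have hreg := hc₀.regular
  have hcd := hasDerivWithinAt_velocity hsm
  have hvc := (contDiffOn_velocity hab hsm).continuousOn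
  set v := velocity a b c₀ with hv
  set κ := curvature a b c₀ with hκdef
  set g : ℝ → ℝ := fun p => ‖v p‖ with hg
  have hg0 : ∀ p ∈ Icc a b, 0 < g p := fun p hp => norm_pos_iff.2 (hreg p hp)
  have hgc : ContinuousOn g (Icc a b) := hvc.norm
  set x₀ := S.startParam a c₀ with hx₀
  have hfx₀ : S.f x₀ = c₀ a := S.f_param hc₀.boundary.left_mem
  have hτa : tangent a b c₀ a = -Complex.I * deriv S.f x₀ := by
    have h := hc₀.boundary.tangentAt_left (hreg a ham)
    rw [← hfx₀, S.tangentAt_f] at h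
    rw [h, ← mul_assoc]; simp
  have hτ : ∀ p ∈ Icc a b, v p = g p * tangent a b c₀ p := fun p hp => velocity_eq (hreg p hp)
  have hva : (v a * conj (deriv S.f x₀)).im < 0 := by
    rw [hτ a ham, hτa, mul_assoc, mul_assoc, S.deriv_mul_conj]
    simpa using hg0 a ham
  obtain ⟨q, r, q', hqa, hq'c, hqd, hrd, hX, hceq, hr0, hrpos, hra⟩ :=
    S.exists_normal_coordinates hab hcd hvc hfx₀.symm hva fun p hp => (hout p hp).1
  have hqc : ContinuousOn q (Icc a b) := fun p hp => (hqd p hp).continuousWithinAt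
  have hrc : ContinuousOn r (Icc a b) := fun p hp => (hrd p hp).continuousWithinAt
  have hden : ∀ p ∈ Icc a b, 1 ≤ 1 + S.curv (q p) * r p := fun p hp => by
    linarith [mul_nonneg (S.curv_nonneg (q p)) (hr0 p hp)]
  -- the end point
  have hrb : r b = 0 := by
    refine le_antisymm ?_ (hr0 b hbm)
    obtain ⟨y, -, hy⟩ := S.exists_eq_of_mem_trace hc₀.boundary.right_mem
    -- The end point is on `Σ`, hence to the left of the tangent line at `q b`, while normal
    -- coordinates place it at distance `r b` to the right.
    have h1 := S.convex (q b) y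
    have h2 := S.re_mul_re_add_im_mul_im (q b)
    rw [hy, hceq b hbm, Complex.inner_eq_re_mul_add_im_mul] at h1
    simp at h1
    linear_combination h1 + (-r b) * h2
  have hfqb : S.f (q b) = c₀ b := by rw [hceq b hbm, hrb]; simp
  have hτb : tangent a b c₀ b = Complex.I * deriv S.f (q b) := by
    have h := hc₀.boundary.tangentAt_right (hreg b hbm)
    rw [← hfqb, S.tangentAt_f] at h
    rw [h, ← mul_assoc]; simp
  -- the angle relative to the normal direction
  have hκg := continuousOn_curvature_mul_norm hab hsm hreg
  set ψ : ℝ → ℝ := fun p => ∫ x in a..p, κ x * g x with hψ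
  have hψd : ∀ p ∈ Icc a b, HasDerivWithinAt ψ (κ p * g p) (Icc a b) p :=
    hasDerivWithinAt_integral_Icc hκg
  have hτψ : ∀ p ∈ Icc a b, tangent a b c₀ p =
      tangent a b c₀ a * Complex.exp (ψ p * Complex.I) := tangent_eq_mul_exp hab hsm hreg
  -- `χ` is a continuous angle from the outer normal `-i f'(q)` to the tangent of the curve: it
  -- starts at `0` and ends at `π` modulo `2π`.
  set χ : ℝ → ℝ := fun p => ψ p - (S.angle (q p) - S.angle x₀) with hχ
  have hχd : ∀ p ∈ Icc a b, HasDerivWithinAt χ (κ p * g p - S.curv (q p) * q' p) (Icc a b) p :=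
    fun p hp => (hψd p hp).sub
      (((S.hasDerivAt_angle (q p)).comp_hasDerivWithinAt p (hqd p hp)).sub_const _)
  have hχc : ContinuousOn χ (Icc a b) := fun p hp => (hχd p hp).continuousWithinAt
  have hχa : χ a = 0 := by simp [hχ, hψ, hqa]
  have hτχ : ∀ p ∈ Icc a b, tangent a b c₀ p =
      -Complex.I * Complex.exp (χ p * Complex.I) * deriv S.f (q p) := by
    intro p hp
    rw [hτψ p hp, hτa, S.deriv_eq_mul_exp x₀ (q p)]
    have : Complex.exp (ψ p * Complex.I) = Complex.exp (χ p * Complex.I) *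
        Complex.exp ((S.angle (q p) - S.angle x₀ : ℝ) * Complex.I) := by
      rw [← Complex.exp_add]; congr 1; simp only [hχ]; push_cast; ring
    rw [this]; ring
  have hvX : ∀ p ∈ Icc a b, v p * conj (deriv S.f (q p)) =
      g p * (Real.sin (χ p) - Real.cos (χ p) * Complex.I) := by
    intro p hp
    rw [hτ p hp, hτχ p hp, mul_assoc, mul_assoc, S.deriv_mul_conj, Complex.exp_mul_I]
    push_cast
    linear_combination (g p * Complex.sin (χ p) : ℂ) * -Complex.I_sq
  have hXre : ∀ p ∈ Icc a b, g p * Real.sin (χ p) = q' p * (1 + S.curv (q p) * r p) := by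
    intro p hp
    rw [← hX p hp, hvX p hp, Complex.re_ofReal_mul]
    simp [-Complex.ofReal_sin, -Complex.ofReal_cos]
  have hXim : ∀ p ∈ Icc a b, -(v p * conj (deriv S.f (q p))).im = g p * Real.cos (χ p) := by
    intro p hp
    rw [hvX p hp, Complex.im_ofReal_mul]
    simp [-Complex.ofReal_sin, -Complex.ofReal_cos]
  have hq'0 : ∀ p ∈ Icc a b, Real.sin (χ p) = 0 → q' p = 0 := by
    intro p hp h
    have h1 := hXre p hp
    rw [h, mul_zero] at h1
    exact (mul_eq_zero.1 h1.symm).resolve_right (by linarith [hden p hp])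
  -- Where the curve is normal to `Σ` the foot point `q` is stationary, so `χ` increases at the rate
  -- `κ |c'|`. Thus `χ` crosses multiples of `π` only upwards.
  have hχ' : ∀ p ∈ Icc a b, Real.sin (χ p) = 0 → 0 < κ p * g p - S.curv (q p) * q' p := by
    intro p hp h
    rw [hq'0 p hp h, mul_zero, sub_zero]
    exact mul_pos (hκ p hp) (hg0 p hp)
  have hχpos : ∀ p ∈ Ioc a b, 0 < χ p := pos_of_deriv_pos_at_zeros hχd hχa.ge
    fun p hp h => hχ' p hp (by rw [h, Real.sin_zero])
  -- the total rotation in normal coordinates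
  have hexpb : Complex.exp (χ b * Complex.I) = -1 := by
    have h1 := hτχ b hbm
    rw [hτb] at h1
    have h2 := mul_right_cancel₀ (S.deriv_ne_zero (q b)) h1
    have h3 : Complex.exp (χ b * Complex.I) = Complex.I * (-Complex.I * Complex.exp (χ b * Complex.I)) := by
      rw [← mul_assoc]; simp
    rw [h3, ← h2, Complex.I_mul_I]
  have hcosb : Real.cos (χ b) = -1 := by
    have := congrArg Complex.re hexpb
    rwa [Complex.exp_ofReal_mul_I_re] at this
  have hsinb : Real.sin (χ b) = 0 := by
    have := congrArg Complex.im hexpb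
    rw [Complex.exp_ofReal_mul_I_im] at this
    simpa using this
  -- So far `χ b` is only known to be a positive odd multiple of `π`. Hopf's theorem for `(q, r)` in
  -- the upper half plane gives the tangent angle `θ` the final value `-π/2` or `3π/2`, and `θ`
  -- differs from `π/2 - χ` by less than `π/2`. The second value would make `χ b` negative.
  have hχb : χ b = Real.pi := by
    let z : ℝ → ℂ := fun p => q p + r p * Complex.I
    let w : ℝ → ℂ := fun p => q' p + (g p * Real.cos (χ p) : ℝ) * Complex.I
    have hzd : ∀ p ∈ Icc a b, HasDerivWithinAt z (w p) (Icc a b) p := by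
      intro p hp
      have h1 := (hqd p hp).ofReal_comp
      have h2 := (hrd p hp).ofReal_comp.mul_const Complex.I
      rw [hXim p hp] at h2
      exact h1.add h2
    have hwre : ∀ p, (w p).re = q' p := fun p => by simp [w]
    have hwim : ∀ p, (w p).im = g p * Real.cos (χ p) := fun p => by
      simp [w, -Complex.ofReal_cos]
    have hzre : ∀ p, (z p).re = q p := fun p => by simp [z]
    have hzim : ∀ p, (z p).im = r p := fun p => by simp [z]
    have hwc : ContinuousOn w (Icc a b) := by
      refine (Complex.continuous_ofReal.comp_continuousOn hq'c).add
        ((Complex.continuous_ofReal.comp_continuousOn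
          (hgc.mul (Real.continuous_cos.comp_continuousOn hχc))).mul continuousOn_const)
    have hw0 : ∀ p ∈ Icc a b, w p ≠ 0 := by
      intro p hp h
      have h1 : q' p = 0 := by rw [← hwre, h]; rfl
      have h2 : g p * Real.cos (χ p) = 0 := by rw [← hwim, h]; rfl
      have h3 := hXre p hp
      rw [h1, zero_mul] at h3
      have h4 := (mul_eq_zero.1 h3).resolve_left (hg0 p hp).ne'
      have h5 := (mul_eq_zero.1 h2).resolve_left (hg0 p hp).ne'
      have h6 := Real.sin_sq_add_cos_sq (χ p)
      rw [h4, h5] at h6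
      norm_num at h6
    obtain ⟨θ, hθc, hθ, hθa, hθb⟩ := exists_tangent_angle_of_halfPlane hab hzd hwc hw0
      (fun p hp p' hp' h => by
        refine hinj hp hp' ?_
        have h1 := congrArg Complex.re h
        have h2 := congrArg Complex.im h
        rw [hzre, hzre] at h1
        rw [hzim, hzim] at h2
        rw [hceq p hp, hceq p' hp', h1, h2])
      (fun p hp => by rw [hzim]; exact hr0 p hp) (by rw [hzim, hra]) (by rw [hzim, hrb])
      (by rw [hwre]; exact hq'0 a ham (by rw [hχa, Real.sin_zero]))
      (by rw [hwim, hχa, Real.cos_zero, mul_one]; exact hg0 a ham)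
      (by rw [hwre]; exact hq'0 b hbm hsinb)
      (by rw [hwim, hcosb]; linarith [hg0 b hbm])
    -- The coordinate change only divides the tangential component `g sin χ` by `1 + κ r ≥ 1`. The
    -- resulting vector has a positive inner product with `g (sin χ, cos χ)`, whose angle is `π/2 -
    -- χ`.
    have hδ := abs_lt_of_cos_pos (θ := fun p => θ p + χ p - Real.pi / 2)
      ((hθc.add hχc).sub continuousOn_const) (by simp only [hθa, hχa]; ring) (by
        intro p hp
        have hn : 0 < ‖w p‖ := norm_pos_iff.2 (hw0 p hp)
        have h1 : ‖w p‖ * Real.cos (θ p) = q' p := by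
          rw [← hwre]
          conv_rhs => rw [hθ p hp, Complex.re_ofReal_mul, Complex.exp_ofReal_mul_I_re]
        have h2 : ‖w p‖ * Real.sin (θ p) = g p * Real.cos (χ p) := by
          rw [← hwim]
          conv_rhs => rw [hθ p hp, Complex.im_ofReal_mul, Complex.exp_ofReal_mul_I_im]
        have h3 : 0 < ‖w p‖ * Real.cos (θ p + χ p - Real.pi / 2) := by
          rw [Real.cos_sub_pi_div_two, Real.sin_add]
          have h4 : ‖w p‖ * (Real.sin (θ p) * Real.cos (χ p) + Real.cos (θ p) * Real.sin (χ p)) =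
              g p * Real.cos (χ p) ^ 2 + q' p * Real.sin (χ p) := by
            linear_combination Real.cos (χ p) * h2 + Real.sin (χ p) * h1
          rw [h4]
          set d := 1 + S.curv (q p) * r p with hd
          have hd1 : 1 ≤ d := hden p hp
          have h5 : q' p = g p * Real.sin (χ p) / d := by
            rw [hXre p hp, mul_div_cancel_right₀ _ (by linarith)]
          have h6 : g p * Real.cos (χ p) ^ 2 + q' p * Real.sin (χ p) =
              g p * (Real.cos (χ p) ^ 2 * d + Real.sin (χ p) ^ 2) / d := by
            rw [h5]
            have : d ≠ 0 := by linarith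
            field_simp
          rw [h6]
          have h7 : 1 ≤ Real.cos (χ p) ^ 2 * d + Real.sin (χ p) ^ 2 := by
            nlinarith [Real.sin_sq_add_cos_sq (χ p), sq_nonneg (Real.cos (χ p))]
          exact div_pos (mul_pos (hg0 p hp) (by linarith)) (by linarith)
        exact (mul_pos_iff_of_pos_left hn).1 h3) b hbm
    have hb0 := hχpos b ⟨hab, le_rfl⟩
    rw [abs_lt] at hδ
    rcases hθb with h | h
    · have h1 : Real.sin (χ b - Real.pi) = 0 := by rw [Real.sin_sub_pi, hsinb, neg_zero]
      have := (Real.sin_eq_zero_iff_of_lt_of_lt (by linarith [hδ.1]) (by linarith [hδ.2])).1 h1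
      linarith
    · exfalso
      linarith [hδ.2]
  -- Having reached `π` before `b`, the angle would exceed `π` at `b`, as it crosses this value only
  -- upwards.
  have hχlt : ∀ p ∈ Ioo a b, χ p < Real.pi := by
    intro p hp
    by_contra! hcon
    have hsub : Icc p b ⊆ Icc a b := Icc_subset_Icc_left hp.1.le
    have := pos_of_deriv_pos_at_zeros (f := fun x => χ x - Real.pi) (a := p) (b := b)
      (fun x hx => ((hχd x (hsub hx)).mono hsub).sub_const _) (by simpa using hcon)
      (fun x hx h => hχ' x (hsub hx) (by rw [sub_eq_zero.1 h, Real.sin_pi])) b ⟨hp.2, le_rfl⟩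
    simp only [hχb, sub_self, lt_irrefl] at this
  have hsinpos : ∀ p ∈ Ioo a b, 0 < Real.sin (χ p) := fun p hp =>
    Real.sin_pos_of_pos_of_lt_pi (hχpos p ⟨hp.1, hp.2.le⟩) (hχlt p hp)
  have hq'eq : ∀ p ∈ Icc a b, q' p = g p * Real.sin (χ p) / (1 + S.curv (q p) * r p) := by
    intro p hp
    rw [hXre p hp, mul_div_cancel_right₀ _ (by linarith [hden p hp])]
  have hq'pos : ∀ p ∈ Ioo a b, 0 < q' p := by
    intro p hp
    have hpm := Ioo_subset_Icc_self hp
    rw [hq'eq p hpm]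
    exact div_pos (mul_pos (hg0 p hpm) (hsinpos p hp)) (by linarith [hden p hpm])
  have hq'le : ∀ p ∈ Icc a b, q' p ≤ g p := by
    intro p hp
    rw [hq'eq p hp, div_le_iff₀ (by linarith [hden p hp])]
    exact mul_le_mul_of_nonneg_left ((Real.sin_le_one _).trans (hden p hp)) (hg0 p hp).le
  have hint : ∫ p in a..b, q' p = q b - x₀ := by
    rw [integral_eq_sub_of_hasDerivWithinAt hab.le hqd hq'c, hqa]
  have hlt : x₀ < q b := by
    have := intervalIntegral.intervalIntegral_pos_of_pos_on
      (hq'c.intervalIntegrable_of_Icc hab.le) hq'pos hab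
    linarith
  have hle : q b - x₀ ≤ arcLength a b c₀ := by
    rw [← hint]
    exact intervalIntegral.integral_mono_on hab.le (hq'c.intervalIntegrable_of_Icc hab.le)
      (hgc.intervalIntegrable_of_Icc hab.le) hq'le
  have hd0 : 0 < S.oppositeDist := (arcLength_pos hab hsm hreg).trans hL
  have hend : S.endParam a b c₀ = q b :=
    S.endParam_eq hc₀.boundary.left_mem hfqb hlt (by linarith [S.oppositeDist_le_period hd0])
  have hturn : turning a b c₀ = Real.pi + (S.angle (q b) - S.angle x₀) := by
    have : χ b = turning a b c₀ - (S.angle (q b) - S.angle x₀) := rfl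
    linarith
  -- The support arc from `x₀` to `q b` turns by a nonnegative angle, and by less than `π` because
  -- its length `q b - x₀ ≤ L₀` is below `d_Σ`.
  refine ⟨?_, ?_, by rw [hend]; exact hlt, hfx₀, by rw [hend, hfqb], ?_⟩
  · rw [hturn]; linarith [S.monotone_angle hlt.le]
  · rw [hturn]; linarith [S.angle_sub_lt_pi hlt.le (by linarith)]
  -- the enclosed area
  have hWc := S.continuous_wedge
  set W : ℝ → ℝ := fun x => (S.f x).re * (deriv S.f x).im - (S.f x).im * (deriv S.f x).re with hW
  have hcc : ContinuousOn c₀ (Icc a b) := hsm.continuousOn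
  have hsub : ∫ x in x₀..q b, W x = ∫ p in a..b, W (q p) * q' p := by
    have hΨ : ∀ p ∈ Icc a b, HasDerivWithinAt (fun p => ∫ x in x₀..q p, W x) (W (q p) * q' p)
        (Icc a b) p := fun p hp => by
      have h1 : HasDerivAt (fun y => ∫ x in x₀..y, W x) (W (q p)) (q p) :=
        intervalIntegral.integral_hasDerivAt_right (hWc.intervalIntegrable _ _)
          (hWc.stronglyMeasurableAtFilter _ _) hWc.continuousAt
      exact h1.comp_hasDerivWithinAt p (hqd p hp)
    rw [integral_eq_sub_of_hasDerivWithinAt hab.le hΨ ((hWc.comp_continuousOn hqc).mul hq'c), hqa]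
    simp
  let A : ℝ → ℂ := fun x => S.f x * conj (deriv S.f x)
  -- The difference of the two area integrands is `G'` plus `(2r + r² κ) q'`. `G` vanishes at both
  -- ends with `r`; the rest is twice the area element `(1 + κ r) dr dq` integrated from `Σ` out to
  -- the curve.
  let G : ℝ → ℝ := fun p => -(r p * (A (q p)).re)
  have hAd : ∀ x, HasDerivAt (fun x => (A x).re) (1 + S.curv x * (A x).im) x := by
    intro x
    have h1 : HasDerivAt (fun x => conj (deriv S.f x))
        (conj (S.curv x * Complex.I * deriv S.f x)) x :=
      Complex.conjCLE.toContinuousLinearMap.hasFDerivAt.comp_hasDerivAt x (S.hasDerivAt_deriv x)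
    have h2 := Complex.reCLM.hasFDerivAt.comp_hasDerivAt x ((S.hasDerivAt x).fun_mul h1)
    refine h2.congr_deriv ?_
    have h3 : deriv S.f x * conj (deriv S.f x) +
        S.f x * conj (S.curv x * Complex.I * deriv S.f x) =
        1 - S.curv x * (Complex.I * A x) := by
      rw [S.deriv_mul_conj]
      simp only [map_mul, Complex.conj_I, Complex.conj_ofReal, A]
      ring
    rw [h3]
    simp
  have hGd : ∀ p ∈ Icc a b, HasDerivWithinAt G
      (-(g p * Real.cos (χ p) * (A (q p)).re +
        r p * ((1 + S.curv (q p) * (A (q p)).im) * q' p))) (Icc a b) p := by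
    intro p hp
    have h1 := hrd p hp
    rw [hXim p hp] at h1
    exact (h1.fun_mul ((hAd (q p)).comp_hasDerivWithinAt p (hqd p hp))).fun_neg
  have hAc : Continuous A := S.smooth.continuous.mul
    (Complex.continuous_conj.comp S.contDiff_deriv.continuous)
  have hG'c : ContinuousOn (fun p => -(g p * Real.cos (χ p) * (A (q p)).re +
        r p * ((1 + S.curv (q p) * (A (q p)).im) * q' p))) (Icc a b) := by
    have h1 := (Complex.continuous_re.comp hAc).comp_continuousOn hqc
    have h2 := (Complex.continuous_im.comp hAc).comp_continuousOn hqc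
    have h3 := S.continuous_curv.comp_continuousOn hqc
    exact (((hgc.mul (Real.continuous_cos.comp_continuousOn hχc)).mul h1).add
      (hrc.mul ((continuousOn_const.add (h3.mul h2)).mul hq'c))).neg
  have hkey : ∀ p ∈ Icc a b,
      (c₀ p).re * (v p).im - (c₀ p).im * (v p).re - W (q p) * q' p =
      -(g p * Real.cos (χ p) * (A (q p)).re +
        r p * ((1 + S.curv (q p) * (A (q p)).im) * q' p)) +
      (2 * r p + r p ^ 2 * S.curv (q p)) * q' p := by
    intro p hp
    have e1 : S.f (q p) = A (q p) * deriv S.f (q p) := by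
      simp only [A]
      rw [mul_assoc, mul_comm (conj _), S.deriv_mul_conj, mul_one]
    have e2 : v p = (((1 + S.curv (q p) * r p) * q' p : ℝ) - (g p * Real.cos (χ p) : ℝ) * Complex.I) *
        deriv S.f (q p) := by
      have h1 := hvX p hp
      have h2 : v p = v p * conj (deriv S.f (q p)) * deriv S.f (q p) := by
        rw [mul_assoc, mul_comm (conj _), S.deriv_mul_conj, mul_one]
      rw [h2, h1, mul_comm (1 + _), ← hXre p hp]
      push_cast
      ring
    have e3 : c₀ p = (A (q p) - r p * Complex.I) * deriv S.f (q p) := by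
      rw [hceq p hp]
      conv_lhs => rw [e1]
      ring
    have e4 := S.re_mul_re_add_im_mul_im (q p)
    have e5 : W (q p) = -(A (q p)).im := by
      have h1 : W (q p) = (conj (S.f (q p)) * deriv S.f (q p)).im := (im_conj_mul _ _).symm
      rw [h1]
      have h2 : conj (S.f (q p)) * deriv S.f (q p) = conj (A (q p)) := by
        simp [A]
      rw [h2, Complex.conj_im]
    have e6 : (c₀ p).re * (v p).im - (c₀ p).im * (v p).re =
        (r p - (A (q p)).im) * ((1 + S.curv (q p) * r p) * q' p) -
          (A (q p)).re * (g p * Real.cos (χ p)) := by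
      rw [e2, e3]
      generalize (1 + S.curv (q p) * r p) * q' p = s1
      generalize g p * Real.cos (χ p) = s2
      simp
      linear_combination ((r p - (A (q p)).im) * s1 - (A (q p)).re * s2) * e4
    rw [e5, e6]
    ring
  have hpos : ∀ p ∈ Ioo a b, 0 < (2 * r p + r p ^ 2 * S.curv (q p)) * q' p := by
    intro p hp
    have h1 := hrpos p hp
    have h2 := mul_nonneg (sq_nonneg (r p)) (S.curv_nonneg (q p))
    exact mul_pos (by linarith) (hq'pos p hp)
  have hposc : ContinuousOn (fun p => (2 * r p + r p ^ 2 * S.curv (q p)) * q' p) (Icc a b) :=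
    ((continuousOn_const.mul hrc).add ((hrc.pow 2).mul
      (S.continuous_curv.comp_continuousOn hqc))).mul hq'c
  have hcvc : ContinuousOn (fun p => (c₀ p).re * (v p).im - (c₀ p).im * (v p).re) (Icc a b) :=
    ((Complex.continuous_re.comp_continuousOn hcc).mul
      (Complex.continuous_im.comp_continuousOn hvc)).sub
      ((Complex.continuous_im.comp_continuousOn hcc).mul
      (Complex.continuous_re.comp_continuousOn hvc))
  have hWqc : ContinuousOn (fun p => W (q p) * q' p) (Icc a b) :=
    (hWc.comp_continuousOn hqc).mul hq'c
  have hfinal : S.enclosedArea a b c₀ =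
      (1 / 2) * ∫ p in a..b, (2 * r p + r p ^ 2 * S.curv (q p)) * q' p := by
    rw [enclosedArea, sweptArea_boundaryCurve, hend, sweptArea, ← mul_sub]
    congr 1
    change (∫ p in a..b, ((c₀ p).re * (v p).im - (c₀ p).im * (v p).re)) - ∫ x in x₀..q b, W x = _
    rw [hsub, ← intervalIntegral.integral_sub (hcvc.intervalIntegrable_of_Icc hab.le)
      (hWqc.intervalIntegrable_of_Icc hab.le)]
    rw [intervalIntegral.integral_congr (fun p hp => hkey p (by rwa [uIcc_of_le hab.le] at hp)),
      intervalIntegral.integral_add (hG'c.intervalIntegrable_of_Icc hab.le)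
        (hposc.intervalIntegrable_of_Icc hab.le),
      integral_eq_sub_of_hasDerivWithinAt hab.le hGd hG'c]
    simp [G, hra, hrb]
  rw [hfinal]
  exact mul_pos (by norm_num) (intervalIntegral.intervalIntegral_pos_of_pos_on
    (hposc.intervalIntegrable_of_Icc hab.le) hpos hab)

end SupportCurve

/-! ### Smooth functions on a closed strip -/

section Strip

variable {E : Type*} [NormedAddCommGroup E] [NormedSpace ℝ E]

/-- The derivative in the first variable, on `[a, b]`. -/
noncomputable def pDeriv (a b : ℝ) (F : ℝ → ℝ → E) (p t : ℝ) : E :=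
  derivWithin (fun q => F q t) (Icc a b) p

/-- The derivative in the second variable. -/
noncomputable def tDeriv (F : ℝ → ℝ → E) (p t : ℝ) : E := deriv (fun s => F p s) t

/-- Smoothness on the strip `[a, b] × U`. -/
def SmoothOnStrip (a b : ℝ) (U : Set ℝ) (F : ℝ → ℝ → E) : Prop :=
  ContDiffOn ℝ (⊤ : ℕ∞) (fun x : ℝ × ℝ => F x.1 x.2) (Icc a b ×ˢ U)

variable {a b : ℝ} {U : Set ℝ} {F : ℝ → ℝ → E}

theorem SmoothOnStrip.hasFDerivWithinAt (hF : SmoothOnStrip a b U F) {p t : ℝ} (hp : p ∈ Icc a b)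
    (ht : t ∈ U) : HasFDerivWithinAt (fun x : ℝ × ℝ => F x.1 x.2)
      (fderivWithin ℝ (fun x : ℝ × ℝ => F x.1 x.2) (Icc a b ×ˢ U) (p, t)) (Icc a b ×ˢ U) (p, t) :=
  (hF.differentiableOn (by simp) (p, t) ⟨hp, ht⟩).hasFDerivWithinAt

theorem HasFDerivWithinAt.strip_left {L : ℝ × ℝ →L[ℝ] E} {p t : ℝ} (ht : t ∈ U)
    (h : HasFDerivWithinAt (fun x : ℝ × ℝ => F x.1 x.2) L (Icc a b ×ˢ U) (p, t)) :
    HasDerivWithinAt (fun q => F q t) (L (1, 0)) (Icc a b) p :=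
  HasFDerivWithinAt.comp_hasDerivWithinAt (f := fun q : ℝ => (q, t)) (s := Icc a b) p h
    ((hasDerivWithinAt_id p _).prodMk (hasDerivWithinAt_const p _ t)) fun _ hq => ⟨hq, ht⟩

theorem HasFDerivWithinAt.strip_right (hU : IsOpen U) {L : ℝ × ℝ →L[ℝ] E} {p t : ℝ}
    (hp : p ∈ Icc a b) (ht : t ∈ U)
    (h : HasFDerivWithinAt (fun x : ℝ × ℝ => F x.1 x.2) L (Icc a b ×ˢ U) (p, t)) :
    HasDerivAt (fun s => F p s) (L (0, 1)) t :=
  (HasFDerivWithinAt.comp_hasDerivWithinAt (f := fun s : ℝ => (p, s)) (s := U) t h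
    ((hasDerivWithinAt_const t _ p).prodMk (hasDerivWithinAt_id t _))
    fun _ hs => ⟨hp, hs⟩).hasDerivAt (hU.mem_nhds ht)

theorem SmoothOnStrip.hasDerivWithinAt (hF : SmoothOnStrip a b U F) {p t : ℝ}
    (hp : p ∈ Icc a b) (ht : t ∈ U) :
    HasDerivWithinAt (fun q => F q t) (pDeriv a b F p t) (Icc a b) p :=
  ((hF.hasFDerivWithinAt hp ht).strip_left ht).differentiableWithinAt.hasDerivWithinAt

theorem SmoothOnStrip.hasDerivAt (hF : SmoothOnStrip a b U F) (hU : IsOpen U) {p t : ℝ}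
    (hp : p ∈ Icc a b) (ht : t ∈ U) : HasDerivAt (fun s => F p s) (tDeriv F p t) t :=
  ((hF.hasFDerivWithinAt hp ht).strip_right hU hp ht).differentiableAt.hasDerivAt

theorem SmoothOnStrip.pDeriv_eq (hab : a < b) (hF : SmoothOnStrip a b U F) {p t : ℝ}
    (hp : p ∈ Icc a b) (ht : t ∈ U) : pDeriv a b F p t =
      fderivWithin ℝ (fun x : ℝ × ℝ => F x.1 x.2) (Icc a b ×ˢ U) (p, t) (1, 0) :=
  ((hF.hasFDerivWithinAt hp ht).strip_left ht).derivWithin (uniqueDiffOn_Icc hab p hp)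

theorem SmoothOnStrip.tDeriv_eq (hF : SmoothOnStrip a b U F) (hU : IsOpen U) {p t : ℝ}
    (hp : p ∈ Icc a b) (ht : t ∈ U) : tDeriv F p t =
      fderivWithin ℝ (fun x : ℝ × ℝ => F x.1 x.2) (Icc a b ×ˢ U) (p, t) (0, 1) :=
  ((hF.hasFDerivWithinAt hp ht).strip_right hU hp ht).deriv

theorem uniqueDiffOn_strip (hab : a < b) (hU : IsOpen U) :
    UniqueDiffOn ℝ (Icc a b ×ˢ U) := (uniqueDiffOn_Icc hab).prod hU.uniqueDiffOn

theorem SmoothOnStrip.fderivWithin (hab : a < b) (hU : IsOpen U) (hF : SmoothOnStrip a b U F) :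
    ContDiffOn ℝ (⊤ : ℕ∞) (_root_.fderivWithin ℝ (fun x : ℝ × ℝ => F x.1 x.2) (Icc a b ×ˢ U))
      (Icc a b ×ˢ U) :=
  ContDiffOn.fderivWithin hF (uniqueDiffOn_strip hab hU) (by simp)

theorem SmoothOnStrip.pDeriv (hab : a < b) (hU : IsOpen U) (hF : SmoothOnStrip a b U F) :
    SmoothOnStrip a b U (pDeriv a b F) :=
  ((hF.fderivWithin hab hU).clm_apply contDiffOn_const).congr fun _ hx =>
    hF.pDeriv_eq hab hx.1 hx.2

theorem SmoothOnStrip.tDeriv (hab : a < b) (hU : IsOpen U) (hF : SmoothOnStrip a b U F) :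
    SmoothOnStrip a b U (tDeriv F) :=
  ((hF.fderivWithin hab hU).clm_apply contDiffOn_const).congr fun _ hx =>
    hF.tDeriv_eq hU hx.1 hx.2

/-- The partial derivatives commute, up to the boundary of the strip. -/
theorem SmoothOnStrip.hasDerivAt_pDeriv (hab : a < b) (hU : IsOpen U) (hF : SmoothOnStrip a b U F)
    {p t : ℝ} (hp : p ∈ Icc a b) (ht : t ∈ U) :
    HasDerivAt (fun s => _root_.pDeriv a b F p s) (_root_.pDeriv a b (_root_.tDeriv F) p t) t := by
  have hx : ((p, t) : ℝ × ℝ) ∈ Icc a b ×ˢ U := ⟨hp, ht⟩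
  set G := _root_.fderivWithin ℝ (fun x : ℝ × ℝ => F x.1 x.2) (Icc a b ×ˢ U) with hG
  have hGd : HasFDerivWithinAt G (_root_.fderivWithin ℝ G (Icc a b ×ˢ U) (p, t))
      (Icc a b ×ˢ U) (p, t) :=
    ((hF.fderivWithin hab hU).differentiableOn (by simp) _ hx).hasFDerivWithinAt
  have h1 : HasDerivAt (fun s => _root_.pDeriv a b F p s)
      (_root_.fderivWithin ℝ G (Icc a b ×ˢ U) (p, t) (0, 1) (1, 0)) t := by
    have h2 := HasFDerivWithinAt.strip_right (F := fun p t => G (p, t)) hU hp ht hGd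
    have h3 := h2.clm_apply (hasDerivAt_const t ((1, 0) : ℝ × ℝ))
    simp only [map_zero, add_zero] at h3
    refine h3.congr_of_eventuallyEq ?_
    filter_upwards [hU.mem_nhds ht] with s hs using hF.pDeriv_eq hab hp hs
  have h4 : HasDerivWithinAt (fun q => _root_.tDeriv F q t)
      (_root_.fderivWithin ℝ G (Icc a b ×ˢ U) (p, t) (1, 0) (0, 1)) (Icc a b) p := by
    have h2 := HasFDerivWithinAt.strip_left (F := fun p t => G (p, t)) ht hGd
    have h3 := h2.clm_apply (hasDerivWithinAt_const p (Icc a b) ((0, 1) : ℝ × ℝ))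
    simp only [map_zero, add_zero] at h3
    exact h3.congr (fun q hq => hF.tDeriv_eq hU hq ht) (hF.tDeriv_eq hU hp ht)
  -- Symmetry of the second derivative extends to boundary points, which lie in the closure of the
  -- interior of the strip.
  have hsymm : IsSymmSndFDerivWithinAt ℝ (fun x : ℝ × ℝ => F x.1 x.2) (Icc a b ×ˢ U) (p, t) := by
    refine ContDiffWithinAt.isSymmSndFDerivWithinAt (hF _ hx)
      (by rw [minSmoothness_of_isRCLikeNormedField]; exact ENat.LEInfty.out)
      (uniqueDiffOn_strip hab hU) ?_ hx
    rw [interior_prod_eq, interior_Icc, hU.interior_eq, closure_prod_eq, closure_Ioo hab.ne]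
    exact ⟨hp, subset_closure ht⟩
  have h5 : _root_.pDeriv a b (_root_.tDeriv F) p t =
      _root_.fderivWithin ℝ G (Icc a b ×ˢ U) (p, t) (1, 0) (0, 1) :=
    h4.derivWithin (uniqueDiffOn_Icc hab p hp)
  rw [h5, hsymm.eq]
  exact h1

end Strip

/-- Removing the initial time makes the time set open, so derivatives in time at positive times are
two-sided. -/
theorem isOpen_timeInterval_diff (T : EReal) : IsOpen (timeInterval T \ {0}) := by
  have : timeInterval T \ {0} = Ioi 0 ∩ {t : ℝ | (t : EReal) < T} := by
    ext t
    simp only [timeInterval, Set.mem_sdiff, mem_ofPred_eq, mem_singleton_iff, mem_inter_iff, mem_Ioi]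
    constructor
    · rintro ⟨⟨h1, h2⟩, h3⟩
      exact ⟨lt_of_le_of_ne h1 (Ne.symm h3), h2⟩
    · rintro ⟨h1, h2⟩
      exact ⟨⟨h1.le, h2⟩, h1.ne'⟩
  rw [this]
  exact isOpen_Ioi.inter (isOpen_Iio.preimage continuous_coe_real_ereal)

theorem Icc_subset_timeInterval {T : EReal} {t₁ : ℝ} (ht₁ : t₁ ∈ timeInterval T) :
    Icc 0 t₁ ⊆ timeInterval T := fun _ ht =>
  ⟨ht.1, lt_of_le_of_lt (EReal.coe_le_coe_iff.2 ht.2) ht₁.2⟩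

theorem Ioc_subset_timeInterval {T : EReal} {t₁ : ℝ} (ht₁ : t₁ ∈ timeInterval T) :
    Ioc 0 t₁ ⊆ timeInterval T \ {0} := fun _ ht =>
  ⟨Icc_subset_timeInterval ht₁ ⟨ht.1.le, ht.2⟩, ht.1.ne'⟩

/-! ### Curves meeting the support curve orthogonally -/

namespace SupportCurve

open PlaneCurve

/-- A locally convex curve meeting the support curve orthogonally, with total curvature in
`(0, 2π)`, has total curvature at least `π`, and its end points are different. -/
theorem MeetsOrthogonally.pi_le_turning {S : SupportCurve} {a b : ℝ} {f : ℝ → ℂ} (hab : a < b)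
    (hf : ContDiffOn ℝ (⊤ : ℕ∞) f (Icc a b)) (h0 : ∀ p ∈ Icc a b, velocity a b f p ≠ 0)
    (hS : S.MeetsOrthogonally a b f) (hκ : ∀ p ∈ Icc a b, 0 ≤ curvature a b f p)
    (hK0 : 0 < turning a b f) : Real.pi ≤ turning a b f ∧ (turning a b f < 2 * Real.pi → f a ≠ f b) := by
  have hpi := Real.pi_pos
  have ham : a ∈ Icc a b := left_mem_Icc.2 hab.le
  have hbm : b ∈ Icc a b := right_mem_Icc.2 hab.le
  have hvd := hasDerivWithinAt_velocity hf
  have hvc := (contDiffOn_velocity hab hf).continuousOn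
  have hκg := continuousOn_curvature_mul_norm hab hf h0
  set K := turning a b f with hKdef
  set τa := tangent a b f a with hτa
  set τb := tangent a b f b with hτb
  set ψ : ℝ → ℝ := fun p => ∫ x in a..p, curvature a b f x * ‖velocity a b f x‖ with hψ
  have hψd := hasDerivWithinAt_integral_Icc hκg
  have hψc : ContinuousOn ψ (Icc a b) := fun p hp => (hψd p hp).continuousWithinAt
  have hψa : ψ a = 0 := by simp [hψ]
  have hψb : ψ b = K := rfl
  have hψm : MonotoneOn ψ (Icc a b) := by
    refine monotoneOn_of_hasDerivWithinAt_nonneg (convex_Icc a b) hψc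
      (fun p hp => (hψd p (interior_subset hp)).mono interior_subset) fun p hp => ?_
    exact mul_nonneg (hκ p (interior_subset hp)) (norm_nonneg _)
  have hψ0 : ∀ p ∈ Icc a b, 0 ≤ ψ p ∧ ψ p ≤ K := fun p hp =>
    ⟨hψa ▸ hψm ham hp hp.1, hψb ▸ hψm hp hbm hp.2⟩
  have hτ : ∀ p ∈ Icc a b, tangent a b f p = τa * Complex.exp (ψ p * Complex.I) :=
    tangent_eq_mul_exp hab hf h0
  have hτK : τb = τa * Complex.exp (K * Complex.I) := hτ b hbm
  have hna : τa * conj τa = 1 := by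
    rw [Complex.mul_conj, Complex.normSq_eq_norm_sq, norm_tangent (h0 a ham)]; simp
  -- The chord is the integral of the velocity. With `u = conj τa · e^{iθ}` the integrand is `|f'|
  -- sin (ψ + θ)`, so the sign of a chord component is read off from the range of the tangent angle.
  have hD : ∀ u : ℂ, ((f b - f a) * u).im = ∫ p in a..b, (velocity a b f p * u).im := by
    intro u
    have hd : ∀ p ∈ Icc a b, HasDerivWithinAt (fun p => (f p * u).im)
        (velocity a b f p * u).im (Icc a b) p := fun p hp =>
      Complex.imCLM.hasFDerivAt.comp_hasDerivWithinAt _ ((hvd p hp).mul_const u)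
    rw [integral_eq_sub_of_hasDerivWithinAt hab.le hd
      (Complex.continuous_im.comp_continuousOn (hvc.mul continuousOn_const)), sub_mul, Complex.sub_im]
  have hvu : ∀ (θ : ℝ), ∀ p ∈ Icc a b,
      (velocity a b f p * (conj τa * Complex.exp (θ * Complex.I))).im =
      ‖velocity a b f p‖ * Real.sin (ψ p + θ) := by
    intro θ p hp
    have h1 : velocity a b f p * (conj τa * Complex.exp (θ * Complex.I)) =
        ‖velocity a b f p‖ * Complex.exp ((ψ p + θ : ℝ) * Complex.I) := by
      have h2 := velocity_eq (h0 p hp)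
      rw [hτ p hp] at h2
      rw [Complex.ofReal_add, add_mul, Complex.exp_add]
      linear_combination (conj τa * Complex.exp (θ * Complex.I)) * h2 + (‖velocity a b f p‖ * Complex.exp (ψ p * Complex.I) *
        Complex.exp (θ * Complex.I)) * hna
    rw [h1, Complex.im_ofReal_mul, Complex.exp_ofReal_mul_I_im]
  -- A parameter with half of the total turning, where the sine is strictly positive; it makes the
  -- integral inequalities strict.
  obtain ⟨m, hm, hmK⟩ : K / 2 ∈ ψ '' Icc a b :=
    intermediate_value_Icc hab.le hψc ⟨by rw [hψa]; linarith, by rw [hψb]; linarith⟩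
  have hcu : ∀ u : ℂ, ContinuousOn (fun p => (velocity a b f p * u).im) (Icc a b) := fun u =>
    Complex.continuous_im.comp_continuousOn (hvc.mul continuousOn_const)
  have hy : K ≤ Real.pi → 0 < ((f b - f a) * conj τa).im := by
    intro hle
    have e := hvu 0
    simp only [Complex.ofReal_zero, zero_mul, Complex.exp_zero, mul_one, add_zero] at e
    rw [hD]
    refine intervalIntegral.integral_pos hab (hcu _) (fun p hp => ?_) ⟨m, hm, ?_⟩
    · have hp' := Ioc_subset_Icc_self hp
      rw [e p hp']
      exact mul_nonneg (norm_nonneg _)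
        (Real.sin_nonneg_of_nonneg_of_le_pi (hψ0 p hp').1 ((hψ0 p hp').2.trans hle))
    · rw [e m hm, hmK]
      exact mul_pos (norm_pos_iff.2 (h0 m hm))
        (Real.sin_pos_of_pos_of_lt_pi (by linarith) (by linarith))
  have hTa : S.tangentAt (f a) = Complex.I * τa := hS.tangentAt_left (h0 a ham)
  have hTb : S.tangentAt (f b) = -Complex.I * τb := hS.tangentAt_right (h0 b hbm)
  refine ⟨?_, fun hK2 hE => ?_⟩
  · by_contra! hlt
    have hy := hy hlt.le
    have hw : ((f b - f a) * (conj τa * Complex.exp ((-K : ℝ) * Complex.I))).im < 0 := by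
      rw [hD, ← neg_pos, ← intervalIntegral.integral_neg]
      refine intervalIntegral.integral_pos hab (hcu _).neg (fun p hp => ?_) ⟨m, hm, ?_⟩
      · have hp' := Ioc_subset_Icc_self hp
        rw [hvu _ p hp', ← mul_neg, ← Real.sin_neg]
        exact mul_nonneg (norm_nonneg _) (Real.sin_nonneg_of_nonneg_of_le_pi
          (by linarith [(hψ0 p hp').2]) (by linarith [(hψ0 p hp').1]))
      · rw [hvu _ m hm, hmK, ← mul_neg, ← Real.sin_neg]
        exact mul_pos (norm_pos_iff.2 (h0 m hm))
          (Real.sin_pos_of_pos_of_lt_pi (by linarith) (by linarith))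
    obtain ⟨x, -, hx⟩ := S.exists_eq_of_mem_trace hS.left_mem
    obtain ⟨y, -, hy'⟩ := S.exists_eq_of_mem_trace hS.right_mem
    -- Each end point lies on the inner side of the tangent line of `Σ` at the other. By
    -- orthogonality this says that the chord has nonpositive components along both `τa` and `τb`.
    have c1 := S.convex x y
    have c2 := S.convex y x
    rw [← S.tangentAt_f, hx, hy', hTa, Complex.inner_eq_re_mul_add_im_mul] at c1
    rw [← S.tangentAt_f, hx, hy', hTb, hτK, Complex.inner_eq_re_mul_add_im_mul] at c2
    have hsin := Real.sin_pos_of_pos_of_lt_pi hK0 hlt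
    rw [Complex.exp_mul_I] at c2 hw
    rw [← Complex.ofReal_cos, ← Complex.ofReal_sin] at c2 hw
    rw [Real.cos_neg, Real.sin_neg] at hw
    generalize Real.sin K = s at *
    generalize Real.cos K = k at *
    generalize hd : f b - f a = D at *
    have hd' : f a - f b = -D := by rw [← hd]; ring
    rw [hd'] at c2
    simp at c1 c2 hw hy
    -- In the frame `τa, i τa` the chord is `(x, y)` with `x ≤ 0 < y`, and `τb = (k, s)` with `s >
    -- 0`. The sign of the component along `i τb` forces `k < 0`, and then the component `x k + y s`
    -- along `τb` is positive, a contradiction.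
    set x := D.re * τa.re + D.im * τa.im with hxdef
    set y := D.im * τa.re - D.re * τa.im with hydef
    have hx0 : x ≤ 0 := by linarith
    have hy0 : 0 < y := by linarith
    have hR : x * k + y * s ≤ 0 := by
      rw [hxdef, hydef]; linarith
    have hI : y * k - x * s < 0 := by
      rw [hxdef, hydef]; linarith
    have hk : k < 0 := by
      by_contra! hk
      nlinarith [mul_nonneg hy0.le hk, mul_nonneg (neg_nonneg.2 hx0) hsin.le]
    nlinarith [mul_pos hy0 hsin, mul_nonneg (neg_nonneg.2 hx0) (neg_pos.2 hk).le]
  -- Coinciding end points share one tangent of `Σ`, so `τb = -τa` and `K = π`; but then the chord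
  -- has a positive component along `i τa`.
  · rw [hE, hTb] at hTa
    have h1 : τb = -τa := by
      have : Complex.I * (-Complex.I * τb) = Complex.I * (Complex.I * τa) := by rw [hTa]
      rw [← mul_assoc, ← mul_assoc, mul_neg, Complex.I_mul_I] at this
      linear_combination this
    have h2 : Complex.exp (K * Complex.I) = -1 := by
      have h3 : τa * Complex.exp (K * Complex.I) = -τa := hτK.symm.trans h1
      linear_combination (conj τa) * h3 - (Complex.exp (K * Complex.I) + 1) * hna
    have h3 : Real.cos K = -1 := by
      have := congrArg Complex.re h2
      rwa [Complex.exp_ofReal_mul_I_re] at this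
    have h4 : Real.sin K = 0 := by
      have := congrArg Complex.im h2
      rw [Complex.exp_ofReal_mul_I_im] at this
      simpa using this
    have h5 : K = Real.pi := by
      have h6 : Real.sin (K - Real.pi) = 0 := by rw [Real.sin_sub_pi, h4, neg_zero]
      have := (Real.sin_eq_zero_iff_of_lt_of_lt (by linarith) (by linarith)).1 h6
      linarith
    have h6 := hy h5.le
    rw [hE, sub_self, zero_mul] at h6
    exact lt_irrefl _ h6

/-- Orthogonality forbids equal tangents at the two end points when the curve is short. -/
theorem MeetsOrthogonally.exp_turning_ne_one {S : SupportCurve} {a b : ℝ} {f : ℝ → ℂ} (hab : a < b)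
    (hf : ContDiffOn ℝ (⊤ : ℕ∞) f (Icc a b)) (h0 : ∀ p ∈ Icc a b, velocity a b f p ≠ 0)
    (hS : S.MeetsOrthogonally a b f) (hL : arcLength a b f < S.oppositeDist) :
    Complex.exp (turning a b f * Complex.I) ≠ 1 := by
  intro h
  have ham : a ∈ Icc a b := left_mem_Icc.2 hab.le
  have hbm : b ∈ Icc a b := right_mem_Icc.2 hab.le
  have h1 : tangent a b f b = tangent a b f a * Complex.exp (turning a b f * Complex.I) :=
    tangent_eq_mul_exp hab hf h0 b hbm
  rw [h, mul_one] at h1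
  have h2 := S.oppositeDist_le hS.right_mem hS.left_mem (by
    rw [hS.tangentAt_left (h0 a ham), hS.tangentAt_right (h0 b hbm), h1, neg_mul])
  linarith [norm_sub_le_arcLength hab hf]

/-- The area between a curve with end points on `Σ` and an arc of `Σ` is controlled by the length
of the curve. -/
theorem sweptArea_sub_le {S : SupportCurve} {a b x y : ℝ} {f : ℝ → ℂ} (hab : a < b)
    (hf : ContDiffOn ℝ (⊤ : ℕ∞) f (Icc a b)) (hx : S.f x = f a) (hy : S.f y = f b) (hxy : x ≤ y) :
    sweptArea a b f - (1 / 2) * ∫ s in x..y,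
      ((S.f s).re * (deriv S.f s).im - (S.f s).im * (deriv S.f s).re) ≤
      arcLength a b f * (arcLength a b f + 2 * Metric.diam S.trace) / 4 := by
  have hfd := hasDerivWithinAt_velocity hf
  have hfc := hf.continuousOn
  have hvc := (contDiffOn_velocity hab hf).continuousOn
  set v := velocity a b f with hv
  set O := f a with hO
  set L := arcLength a b f with hL
  set d := Metric.diam S.trace
  have hd : ‖f b - O‖ ≤ d := by
    rw [← hx, ← hy]; exact S.norm_sub_le_diam (S.f_mem_trace _) (S.f_mem_trace _)
  have hd0 : 0 ≤ d := (norm_nonneg _).trans hd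
  -- The mean of two estimates: along the curve from `f a`, or back from `f b` followed by a chord
  -- of `Σ`. The two pieces of the curve have total length `L`.
  have hdist : ∀ p ∈ Icc a b, ‖f p - O‖ ≤ L / 2 + d := by
    intro p hp
    have h1 : ‖f p - O‖ ≤ ∫ s in a..p, ‖v s‖ := norm_sub_le_integral hab hf le_rfl hp.1 hp.2
    have h2 : ‖f b - f p‖ ≤ ∫ s in p..b, ‖v s‖ := norm_sub_le_integral hab hf hp.1 hp.2 le_rfl
    have hi : ∀ s t, s ∈ Icc a b → t ∈ Icc a b →
        IntervalIntegrable (fun s => ‖v s‖) MeasureTheory.volume s t := fun s t hs ht =>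
      (hvc.norm.mono (ordConnected_Icc.uIcc_subset hs ht)).intervalIntegrable
    have h3 := intervalIntegral.integral_add_adjacent_intervals
      (hi a p (left_mem_Icc.2 hab.le) hp) (hi p b hp (right_mem_Icc.2 hab.le))
    have h4 : ‖f p - O‖ ≤ ‖f b - f p‖ + ‖f b - O‖ := by
      have : f p - O = -(f b - f p) + (f b - O) := by ring
      rw [this]
      exact (norm_add_le _ _).trans (by rw [norm_neg])
    have h5 : L = ∫ s in a..b, ‖v s‖ := rfl
    linarith
  -- Moving the origin to the end point `O = f a` changes the line integral only by a term depending
  -- on the chord.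
  have hswept : sweptArea a b f = (1 / 2) * (∫ p in a..b,
      ((f p - O).re * (v p).im - (f p - O).im * (v p).re)) +
      (1 / 2) * (O.re * (f b - O).im - O.im * (f b - O).re) := by
    have hlin : ∀ p ∈ Icc a b, HasDerivWithinAt (fun p => O.re * (f p).im - O.im * (f p).re)
        (O.re * (v p).im - O.im * (v p).re) (Icc a b) p := fun p hp =>
      ((Complex.imCLM.hasFDerivAt.comp_hasDerivWithinAt _ (hfd p hp)).const_mul _).sub
        ((Complex.reCLM.hasFDerivAt.comp_hasDerivWithinAt _ (hfd p hp)).const_mul _)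
    have hre := Complex.continuous_re.comp_continuousOn hvc
    have him := Complex.continuous_im.comp_continuousOn hvc
    have hlc : ContinuousOn (fun p => O.re * (v p).im - O.im * (v p).re) (Icc a b) :=
      (continuousOn_const.mul him).sub (continuousOn_const.mul hre)
    have h1 := integral_eq_sub_of_hasDerivWithinAt hab.le hlin hlc
    have hfO := hfc.sub (continuousOn_const (c := O))
    have hmc : ContinuousOn (fun p => (f p - O).re * (v p).im - (f p - O).im * (v p).re) (Icc a b) :=
      ((Complex.continuous_re.comp_continuousOn hfO).mul him).sub
        ((Complex.continuous_im.comp_continuousOn hfO).mul hre)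
    rw [sweptArea, ← mul_add]
    congr 1
    have h2 : O.re * (f b - O).im - O.im * (f b - O).re =
        ∫ p in a..b, (O.re * (v p).im - O.im * (v p).re) := by
      rw [h1]; simp only [Complex.sub_re, Complex.sub_im, ← hO]; ring
    rw [h2, ← intervalIntegral.integral_add (hmc.intervalIntegrable_of_Icc hab.le)
      (hlc.intervalIntegrable_of_Icc hab.le)]
    congr 1
    ext p
    simp only [Complex.sub_re, Complex.sub_im, ← hv]
    ring
  have hle : ∫ p in a..b, ((f p - O).re * (v p).im - (f p - O).im * (v p).re) ≤
      (L / 2 + d) * L := by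
    have hre := Complex.continuous_re.comp_continuousOn hvc
    have him := Complex.continuous_im.comp_continuousOn hvc
    have hfO := hfc.sub (continuousOn_const (c := O))
    have hmc : ContinuousOn (fun p => (f p - O).re * (v p).im - (f p - O).im * (v p).re) (Icc a b) :=
      ((Complex.continuous_re.comp_continuousOn hfO).mul him).sub
        ((Complex.continuous_im.comp_continuousOn hfO).mul hre)
    have h5 : (L / 2 + d) * L = ∫ s in a..b, (L / 2 + d) * ‖v s‖ := by
      rw [intervalIntegral.integral_const_mul]; rfl
    rw [h5]
    refine intervalIntegral.integral_mono_on hab.le (hmc.intervalIntegrable_of_Icc hab.le)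
      ((continuousOn_const.mul hvc.norm).intervalIntegrable_of_Icc hab.le) fun p hp => ?_
    rw [← im_conj_mul]
    refine (le_abs_self _).trans ((Complex.abs_im_le_norm _).trans ?_)
    rw [norm_mul, RCLike.norm_conj]
    exact mul_le_mul_of_nonneg_right (hdist p hp) (norm_nonneg _)
  -- Seen from the point `O` of `Σ`, a positively traversed arc sweeps nonnegative area, since `O`
  -- is to the left of every tangent line.
  have harc : (O.re * (f b - O).im - O.im * (f b - O).re) ≤ ∫ s in x..y,
      ((S.f s).re * (deriv S.f s).im - (S.f s).im * (deriv S.f s).re) := by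
    have hlin : ∀ s ∈ Icc x y, HasDerivWithinAt (fun s => O.re * (S.f s).im - O.im * (S.f s).re)
        (O.re * (deriv S.f s).im - O.im * (deriv S.f s).re) (Icc x y) s := fun s _ =>
      (((Complex.imCLM.hasFDerivAt.comp_hasDerivAt _ (S.hasDerivAt s)).const_mul _).sub
        ((Complex.reCLM.hasFDerivAt.comp_hasDerivAt _ (S.hasDerivAt s)).const_mul _)).hasDerivWithinAt
    have hf'c := S.contDiff_deriv.continuous
    have hlc : Continuous fun s => O.re * (deriv S.f s).im - O.im * (deriv S.f s).re := by
      fun_prop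
    have h1 := integral_eq_sub_of_hasDerivWithinAt hxy hlin hlc.continuousOn
    have h2 : O.re * (f b - O).im - O.im * (f b - O).re =
        ∫ s in x..y, (O.re * (deriv S.f s).im - O.im * (deriv S.f s).re) := by
      rw [h1, hx, hy]; simp only [Complex.sub_re, Complex.sub_im]; ring
    rw [h2]
    refine intervalIntegral.integral_mono_on hxy (hlc.intervalIntegrable _ _)
      (S.continuous_wedge.intervalIntegrable _ _) fun s _ => ?_
    have h3 := S.convex s x
    rw [hx, Complex.inner_eq_re_mul_add_im_mul] at h3
    simp at h3
    linarith
  rw [hswept]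
  linarith

/-- A curve on `Σ` that moves with velocity `V` times the unit tangent is `f ∘ σ` with `σ' = V`. -/
theorem eq_comp_of_hasDerivWithinAt (S : SupportCurve) {t₁ x₀ : ℝ} {γ : ℝ → ℂ} {V : ℝ → ℝ}
    (hV : ContinuousOn V (Icc 0 t₁)) (hγ : ∀ t ∈ Icc 0 t₁, γ t ∈ S.trace)
    (hγd : ∀ t ∈ Icc 0 t₁, HasDerivWithinAt γ (V t • S.tangentAt (γ t)) (Icc 0 t₁) t)
    (h0 : γ 0 = S.f x₀) : ∀ t ∈ Icc 0 t₁, γ t = S.f (x₀ + ∫ s in (0 : ℝ)..t, V s) := by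
  intro t ht
  obtain ⟨C, hC⟩ := S.exists_norm_deriv_sub_le
  obtain ⟨B, hB⟩ := isCompact_Icc.exists_bound_of_continuousOn hV
  have hB0 : 0 ≤ B := (norm_nonneg _).trans (hB t ht)
  let σ : ℝ → ℝ := fun t => x₀ + ∫ s in (0 : ℝ)..t, V s
  have hσ : ∀ t ∈ Icc 0 t₁, HasDerivWithinAt σ (V t) (Icc 0 t₁) t := fun t ht =>
    (hasDerivWithinAt_integral_Icc hV t ht).const_add x₀
  have hd : ∀ t ∈ Icc 0 t₁, HasDerivWithinAt (fun t => γ t - S.f (σ t))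
      (V t • S.tangentAt (γ t) - V t • deriv S.f (σ t)) (Icc 0 t₁) t := fun t ht =>
    (hγd t ht).sub ((S.hasDerivAt (σ t)).scomp_hasDerivWithinAt t (hσ t ht))
  -- Gronwall's inequality for `γ - f ∘ σ`: on `Σ` the tangent is a Lipschitz function of the point,
  -- and `V` is bounded.
  have := eq_zero_of_abs_deriv_le_mul_abs_self_of_eq_zero_right (K := B * C)
    (fun t ht => (hd t ht).continuousWithinAt)
    (fun t ht => (hd t (Ico_subset_Icc_self ht)).mono_of_mem_nhdsWithin (Icc_mem_nhdsGE_of_mem ht))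
    (by simp [σ, h0]) (fun t ht => by
      have ht' := Ico_subset_Icc_self ht
      obtain ⟨y, -, hy⟩ := S.exists_eq_of_mem_trace (hγ t ht')
      rw [← smul_sub, norm_smul, ← hy, S.tangentAt_f, mul_assoc]
      exact mul_le_mul (hB t ht') (hC _ _) (norm_nonneg _) hB0) t ht
  exact sub_eq_zero.1 this

end SupportCurve

/-! ### Evolution of speed, tangent and curvature -/

namespace IsAreaPreservingFlow

open PlaneCurve

variable {S : SupportCurve} {a b : ℝ} {T : EReal} {c₀ : ℝ → ℂ} {c : ℝ → ℝ → ℂ}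

/-- The flow is smooth only for positive times; at time `0` the smoothness in `p` comes from the
initial curve. -/
theorem contDiffOn_slice (hc : IsAreaPreservingFlow S a b T c₀ c)
    (hc₀ : ContDiffOn ℝ (⊤ : ℕ∞) c₀ (Icc a b)) {t : ℝ} (ht : t ∈ timeInterval T) :
    ContDiffOn ℝ (⊤ : ℕ∞) (fun p => c p t) (Icc a b) := by
  rcases eq_or_ne t 0 with rfl | h
  · exact hc₀.congr hc.initial
  · exact hc.smooth.comp (f := fun p : ℝ => (p, t)) (by fun_prop) fun p hp => ⟨hp, ht, h⟩

theorem smoothOnStrip (hc : IsAreaPreservingFlow S a b T c₀ c) :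
    SmoothOnStrip a b (timeInterval T \ {0}) c := hc.smooth

/-- The curvature as a function of the parameter and the time. -/
noncomputable def curv (a b : ℝ) (c : ℝ → ℝ → ℂ) (p t : ℝ) : ℝ := curvature a b (fun q => c q t) p

/-- The average of the curvature as a function of the time. -/
noncomputable def avg (a b : ℝ) (c : ℝ → ℝ → ℂ) (t : ℝ) : ℝ := meanCurvature a b (fun q => c q t)

theorem velocity_ne_zero (hc : IsAreaPreservingFlow S a b T c₀ c) {p t : ℝ} (hp : p ∈ Icc a b)
    (ht : t ∈ timeInterval T) : pDeriv a b c p t ≠ 0 := hc.regular t ht p hp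

theorem curv_eq (a b : ℝ) (c : ℝ → ℝ → ℂ) (p t : ℝ) : curv a b c p t =
    (pDeriv a b (pDeriv a b c) p t * conj (pDeriv a b c p t)).im / ‖pDeriv a b c p t‖ ^ 3 :=
  curvature_eq p

theorem continuousOn_curv (hc : IsAreaPreservingFlow S a b T c₀ c) :
    ContinuousOn (fun x : ℝ × ℝ => curv a b c x.1 x.2) (Icc a b ×ˢ timeInterval T) := by
  simp only [curv_eq]
  refine ContinuousOn.div (Complex.continuous_im.comp_continuousOn
    (ContinuousOn.mul hc.continuous_acceleration
      (Complex.continuous_conj.comp_continuousOn hc.continuous_velocity)))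
    (hc.continuous_velocity.norm.pow 3) fun x hx => ?_
  exact pow_ne_zero _ (norm_ne_zero_iff.2 (hc.velocity_ne_zero hx.1 hx.2))

theorem smoothOnStrip_curv (hc : IsAreaPreservingFlow S a b T c₀ c) (hab : a < b) :
    SmoothOnStrip a b (timeInterval T \ {0}) (curv a b c) := by
  have hU := isOpen_timeInterval_diff T
  have h1 := hc.smoothOnStrip.pDeriv hab hU
  have h2 := h1.pDeriv hab hU
  unfold SmoothOnStrip at *
  simp only [curv_eq]
  refine ContDiffOn.div (Complex.imCLM.contDiff.comp_contDiffOn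
    (h2.mul (Complex.conjCLE.contDiff.comp_contDiffOn h1))) ((h1.norm ℝ ?_).pow 3) ?_
  · exact fun x hx => hc.velocity_ne_zero hx.1 hx.2.1
  · exact fun x hx => pow_ne_zero _ (norm_ne_zero_iff.2 (hc.velocity_ne_zero hx.1 hx.2.1))

theorem hasDerivAt_time (hc : IsAreaPreservingFlow S a b T c₀ c) {p t : ℝ} (hp : p ∈ Icc a b)
    (ht : t ∈ timeInterval T \ {0}) : HasDerivAt (fun s => c p s)
      (((curv a b c p t - avg a b c t : ℝ) : ℂ) * (Complex.I * tangent a b (fun q => c q t) p)) t := by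
  have h := (hc.flow p hp t ht.1).hasDerivAt
    (mem_of_superset ((isOpen_timeInterval_diff T).mem_nhds ht) sdiff_subset)
  rwa [Complex.real_smul] at h

theorem hasDerivWithinAt_tangent (hc : IsAreaPreservingFlow S a b T c₀ c) (hab : a < b)
    (hc₀ : ContDiffOn ℝ (⊤ : ℕ∞) c₀ (Icc a b)) {p t : ℝ} (hp : p ∈ Icc a b)
    (ht : t ∈ timeInterval T) : HasDerivWithinAt (tangent a b (fun q => c q t))
      (((curv a b c p t * ‖pDeriv a b c p t‖ : ℝ) : ℂ) * Complex.I *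
        tangent a b (fun q => c q t) p) (Icc a b) p :=
  PlaneCurve.hasDerivWithinAt_tangent hab (hc.contDiffOn_slice hc₀ ht)
    (fun _ hp => hc.velocity_ne_zero hp ht) p hp

/-- The derivative of the normal velocity `V ν` along the curve, with `V = κ - κ̄`. -/
theorem hasDerivWithinAt_normalVelocity (hc : IsAreaPreservingFlow S a b T c₀ c) (hab : a < b)
    (hc₀ : ContDiffOn ℝ (⊤ : ℕ∞) c₀ (Icc a b)) {p t : ℝ} (hp : p ∈ Icc a b)
    (ht : t ∈ timeInterval T \ {0}) : HasDerivWithinAt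
      (fun q => ((curv a b c q t - avg a b c t : ℝ) : ℂ) *
        (Complex.I * tangent a b (fun q => c q t) q))
      ((pDeriv a b (curv a b c) p t * Complex.I -
        ((curv a b c p t - avg a b c t) * curv a b c p t * ‖pDeriv a b c p t‖ : ℝ)) *
          tangent a b (fun q => c q t) p) (Icc a b) p := by
  have h2 := (((hc.smoothOnStrip_curv hab).hasDerivWithinAt hp ht).sub_const
    (avg a b c t)).ofReal_comp
  refine (h2.fun_mul
    ((hc.hasDerivWithinAt_tangent hab hc₀ hp ht.1).const_mul Complex.I)).congr_deriv ?_
  push_cast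
  linear_combination (((curv a b c p t - avg a b c t : ℂ) * (curv a b c p t *
    ‖pDeriv a b c p t‖) * tangent a b (fun q => c q t) p)) * Complex.I_sq

/-- The evolution of the velocity: `∂_t c_p = (i κ_p - V κ |c_p|) τ` with `V = κ - κ̄`. -/
theorem hasDerivAt_velocity (hc : IsAreaPreservingFlow S a b T c₀ c) (hab : a < b)
    (hc₀ : ContDiffOn ℝ (⊤ : ℕ∞) c₀ (Icc a b)) {p t : ℝ} (hp : p ∈ Icc a b)
    (ht : t ∈ timeInterval T \ {0}) : HasDerivAt (fun s => pDeriv a b c p s)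
      ((pDeriv a b (curv a b c) p t * Complex.I -
        ((curv a b c p t - avg a b c t) * curv a b c p t * ‖pDeriv a b c p t‖ : ℝ)) *
          tangent a b (fun q => c q t) p) t := by
  have hU := isOpen_timeInterval_diff T
  refine (hc.smoothOnStrip.hasDerivAt_pDeriv hab hU hp ht).congr_deriv ?_
  exact ((hc.hasDerivWithinAt_normalVelocity hab hc₀ hp ht).congr
      (fun q hq => (hc.hasDerivAt_time hq ht).deriv) (hc.hasDerivAt_time hp ht).deriv).derivWithin
      (uniqueDiffOn_Icc hab p hp)

theorem tangent_mul_conj (hc : IsAreaPreservingFlow S a b T c₀ c) {p t : ℝ} (hp : p ∈ Icc a b)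
    (ht : t ∈ timeInterval T) :
    tangent a b (fun q => c q t) p * conj (tangent a b (fun q => c q t) p) = 1 := by
  rw [Complex.mul_conj, Complex.normSq_eq_norm_sq, norm_tangent (hc.regular t ht p hp)]
  simp

theorem pDeriv_eq (hc : IsAreaPreservingFlow S a b T c₀ c) {p t : ℝ} (hp : p ∈ Icc a b)
    (ht : t ∈ timeInterval T) :
    pDeriv a b c p t = ‖pDeriv a b c p t‖ * tangent a b (fun q => c q t) p :=
  velocity_eq (hc.regular t ht p hp)

/-- `(∂_t c_p) * conj c_p`. -/
theorem deriv_velocity_mul_conj (hc : IsAreaPreservingFlow S a b T c₀ c) {p t : ℝ}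
    (hp : p ∈ Icc a b) (ht : t ∈ timeInterval T) (Q : ℂ) :
    Q * tangent a b (fun q => c q t) p * conj (pDeriv a b c p t) = ‖pDeriv a b c p t‖ * Q := by
  have h := hc.tangent_mul_conj hp ht
  have h2 := congrArg conj (hc.pDeriv_eq hp ht)
  rw [map_mul, Complex.conj_ofReal] at h2
  rw [h2]
  linear_combination (Q * ‖pDeriv a b c p t‖) * h

/-- The evolution of the speed. -/
theorem hasDerivAt_speed (hc : IsAreaPreservingFlow S a b T c₀ c) (hab : a < b)
    (hc₀ : ContDiffOn ℝ (⊤ : ℕ∞) c₀ (Icc a b)) {p t : ℝ} (hp : p ∈ Icc a b)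
    (ht : t ∈ timeInterval T \ {0}) : HasDerivAt (fun s => ‖pDeriv a b c p s‖)
      (-((curv a b c p t - avg a b c t) * curv a b c p t * ‖pDeriv a b c p t‖)) t := by
  have h0 := hc.velocity_ne_zero hp ht.1
  have h := hasDerivWithinAt_univ.1
    ((hasDerivWithinAt_univ.2 (hc.hasDerivAt_velocity hab hc₀ hp ht)).norm_complex h0)
  refine h.congr_deriv ?_
  rw [hc.deriv_velocity_mul_conj hp ht.1, Complex.re_ofReal_mul,
    mul_div_cancel_left₀ _ (norm_ne_zero_iff.2 h0)]
  simp [-Complex.ofReal_mul, -Complex.ofReal_sub]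

/-- The evolution of the tangent. -/
theorem hasDerivAt_tangent (hc : IsAreaPreservingFlow S a b T c₀ c) (hab : a < b)
    (hc₀ : ContDiffOn ℝ (⊤ : ℕ∞) c₀ (Icc a b)) {p t : ℝ} (hp : p ∈ Icc a b)
    (ht : t ∈ timeInterval T \ {0}) : HasDerivAt (fun s => tangent a b (fun q => c q s) p)
      (((pDeriv a b (curv a b c) p t / ‖pDeriv a b c p t‖ : ℝ) : ℂ) * Complex.I *
        tangent a b (fun q => c q t) p) t := by
  have h0 := hc.velocity_ne_zero hp ht.1
  have hn := norm_ne_zero_iff.2 h0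
  have h := hasDerivWithinAt_univ.1
    ((hasDerivWithinAt_univ.2 (hc.hasDerivAt_velocity hab hc₀ hp ht)).unit_complex h0)
  refine h.congr_deriv ?_
  change _ * Complex.I * tangent a b (fun q => c q t) p = _
  congr 3
  rw [hc.deriv_velocity_mul_conj hp ht.1, Complex.im_ofReal_mul]
  simp [-Complex.ofReal_mul, -Complex.ofReal_sub]
  field_simp

/-- The evolution of the curvature. -/
theorem hasDerivAt_curv (hc : IsAreaPreservingFlow S a b T c₀ c) (hab : a < b)
    (hc₀ : ContDiffOn ℝ (⊤ : ℕ∞) c₀ (Icc a b)) {p t : ℝ} (hp : p ∈ Icc a b)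
    (ht : t ∈ timeInterval T \ {0}) : HasDerivAt (fun s => curv a b c p s)
      (1 / ‖pDeriv a b c p t‖ ^ 2 * pDeriv a b (pDeriv a b (curv a b c)) p t +
        -((pDeriv a b (pDeriv a b c) p t * conj (pDeriv a b c p t)).re / ‖pDeriv a b c p t‖ ^ 4) *
          pDeriv a b (curv a b c) p t +
        (curv a b c p t - avg a b c t) * curv a b c p t * curv a b c p t) t := by
  -- In arclength the formula is `κ_t = κ_ss + V κ²` with `V = κ - κ̄`. In terms of `p`, `κ_ss =
  -- κ_pp / g² - g_p κ_p / g³` with `g = |c_p|` and `g_p = Re (c_pp · conj c_p) / g`.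
  have hU := isOpen_timeInterval_diff T
  have h0 := hc.velocity_ne_zero hp ht.1
  have hn := norm_ne_zero_iff.2 h0
  have hvs := hc.smoothOnStrip.pDeriv hab hU
  have hκs := hc.smoothOnStrip_curv hab
  set κ := curv a b c with hκ
  set g := ‖pDeriv a b c p t‖ with hg
  set τ := tangent a b (fun q => c q t) p with hτ
  set gp := (pDeriv a b (pDeriv a b c) p t * conj (pDeriv a b c p t)).re / g with hgp
  set κp := pDeriv a b κ p t with hκp
  set κpp := pDeriv a b (pDeriv a b κ) p t with hκpp
  set V := κ p t - avg a b c t with hV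
  have hτ1 : τ * conj τ = 1 := hc.tangent_mul_conj hp ht.1
  have hv : pDeriv a b c p t = g * τ := hc.pDeriv_eq hp ht.1
  have hspeed : HasDerivWithinAt (fun q => ‖pDeriv a b c q t‖) gp (Icc a b) p :=
    (hvs.hasDerivWithinAt hp ht).norm_complex h0
  have hτd := hc.hasDerivWithinAt_tangent hab hc₀ hp ht.1
  rw [← hτ, ← hκ, ← hg] at hτd
  have hw : pDeriv a b (pDeriv a b c) p t = (gp + κ p t * g ^ 2 * Complex.I) * τ := by
    have h1 : HasDerivWithinAt (fun q => pDeriv a b c q t)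
        (gp * τ + g * (((κ p t * g : ℝ) : ℂ) * Complex.I * τ)) (Icc a b) p :=
      (hspeed.ofReal_comp.mul hτd).congr (fun q hq => hc.pDeriv_eq hq ht.1) hv
    have h2 := h1.derivWithin (uniqueDiffOn_Icc hab p hp)
    rw [pDeriv, h2]
    push_cast
    ring
  -- Partial derivatives commute, so `∂_t c_pp` is the `p`-derivative of the evolution equation of
  -- the velocity.
  have hwt : HasDerivAt (fun s => pDeriv a b (pDeriv a b c) p s)
      (((κpp * Complex.I - ((κp * κ p t + V * κp) * g + V * κ p t * gp : ℝ)) +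
        (κp * Complex.I - (V * κ p t * g : ℝ)) * ((κ p t * g : ℝ) * Complex.I)) * τ) t := by
    refine (hvs.hasDerivAt_pDeriv hab hU hp ht).congr_deriv ?_
    have hκd := hκs.hasDerivWithinAt hp ht
    have h1 : HasDerivWithinAt (fun q => tDeriv (pDeriv a b c) q t)
        ((κpp * Complex.I - ((κp * κ p t + V * κp) * g + V * κ p t * gp : ℝ)) * τ +
        (κp * Complex.I - (V * κ p t * g : ℝ)) * (((κ p t * g : ℝ) : ℂ) * Complex.I * τ))
        (Icc a b) p := by
      have h2 := ((hκs.pDeriv hab hU).hasDerivWithinAt hp ht).ofReal_comp.mul_const Complex.I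
      have h3 := (((hκd.sub_const (avg a b c t)).mul hκd).mul hspeed).ofReal_comp
      exact ((h2.sub h3).mul hτd).congr
        (fun q hq => (hc.hasDerivAt_velocity hab hc₀ hq ht).deriv)
        (hc.hasDerivAt_velocity hab hc₀ hp ht).deriv
    rw [pDeriv, h1.derivWithin (uniqueDiffOn_Icc hab p hp)]
    ring
  have hvt := hc.hasDerivAt_velocity hab hc₀ hp ht
  rw [← hτ, ← hκ, ← hg, ← hκp, ← hV] at hvt
  have hgt := hc.hasDerivAt_speed hab hc₀ hp ht
  rw [← hκ, ← hg, ← hV] at hgt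
  have hconj : HasDerivAt (fun s => conj (pDeriv a b c p s))
      (conj ((κp * Complex.I - (V * κ p t * g : ℝ)) * τ)) t :=
    Complex.conjCLE.toContinuousLinearMap.hasFDerivAt.comp_hasDerivAt t hvt
  have him := Complex.imCLM.hasFDerivAt.comp_hasDerivAt t (hwt.fun_mul hconj)
  have hfin := him.div (hgt.pow 3) (pow_ne_zero 3 hn)
  have hκt : HasDerivAt (fun s => κ p s) _ t :=
    hfin.congr_of_eventuallyEq (.of_forall fun s => by simp only [hκ, curv_eq]; rfl)
  refine hκt.congr_deriv ?_
  have hκval : (pDeriv a b (pDeriv a b c) p t * conj (pDeriv a b c p t)).im = κ p t * g ^ 3 := by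
    simp only [hκ, curv_eq]
    rw [div_mul_cancel₀ _ (pow_ne_zero 3 hn)]
  have hre : (pDeriv a b (pDeriv a b c) p t * conj (pDeriv a b c p t)).re = gp * g := by
    rw [hgp, div_mul_cancel₀ _ hn]
  have hnum : (((κpp * Complex.I - ((κp * κ p t + V * κp) * g + V * κ p t * gp : ℝ)) +
        (κp * Complex.I - (V * κ p t * g : ℝ)) * ((κ p t * g : ℝ) * Complex.I)) * τ *
        conj (pDeriv a b c p t) + pDeriv a b (pDeriv a b c) p t *
        conj ((κp * Complex.I - (V * κ p t * g : ℝ)) * τ)).im =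
        g * κpp - gp * κp - 2 * V * κ p t ^ 2 * g ^ 3 := by
    rw [hc.deriv_velocity_mul_conj hp ht.1, ← hg, hw]
    have e : (gp + κ p t * g ^ 2 * Complex.I) * τ *
        conj ((κp * Complex.I - (V * κ p t * g : ℝ)) * τ) =
        (gp + κ p t * g ^ 2 * Complex.I) * (-(κp * Complex.I) - (V * κ p t * g : ℝ)) := by
      simp only [map_mul, map_sub, Complex.conj_I, Complex.conj_ofReal]
      linear_combination ((gp + κ p t * g ^ 2 * Complex.I) *
        (-(κp * Complex.I) - (V * κ p t * g : ℝ))) * hτ1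
    rw [e]
    have e2 : ((κ p t * g ^ 2 : ℂ)) = ((κ p t * g ^ 2 : ℝ) : ℂ) := by push_cast; ring
    rw [e2]
    simp [-Complex.ofReal_mul, -Complex.ofReal_pow, -Complex.ofReal_add]
    ring
  simp only [Function.comp_apply, Complex.imCLM_apply, Pi.pow_apply] at *
  rw [hnum, hκval, hre, ← hg]
  field_simp
  ring

end IsAreaPreservingFlow

/-! ### Length and total curvature along the flow -/

namespace IsAreaPreservingFlow

open PlaneCurve

variable {S : SupportCurve} {a b : ℝ} {T : EReal} {c₀ : ℝ → ℂ} {c : ℝ → ℝ → ℂ}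

theorem continuousOn_speed (hc : IsAreaPreservingFlow S a b T c₀ c) {t₁ : ℝ}
    (ht₁ : t₁ ∈ timeInterval T) :
    ContinuousOn (fun x : ℝ × ℝ => ‖pDeriv a b c x.1 x.2‖) (Icc a b ×ˢ Icc 0 t₁) :=
  (hc.continuous_velocity.mono (prod_mono_right (Icc_subset_timeInterval ht₁))).norm

theorem continuousOn_curv_Icc (hc : IsAreaPreservingFlow S a b T c₀ c) {t₁ : ℝ}
    (ht₁ : t₁ ∈ timeInterval T) :
    ContinuousOn (fun x : ℝ × ℝ => curv a b c x.1 x.2) (Icc a b ×ˢ Icc 0 t₁) :=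
  hc.continuousOn_curv.mono (prod_mono_right (Icc_subset_timeInterval ht₁))

theorem continuousOn_arcLength (hc : IsAreaPreservingFlow S a b T c₀ c) (hab : a < b) {t₁ : ℝ}
    (ht₁ : t₁ ∈ timeInterval T) :
    ContinuousOn (fun t => arcLength a b (fun q => c q t)) (Icc 0 t₁) :=
  continuousOn_intervalIntegral hab.le (F := fun p t => ‖pDeriv a b c p t‖)
    (hc.continuousOn_speed ht₁)

theorem continuousOn_turning (hc : IsAreaPreservingFlow S a b T c₀ c) (hab : a < b) {t₁ : ℝ}
    (ht₁ : t₁ ∈ timeInterval T) :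
    ContinuousOn (fun t => turning a b (fun q => c q t)) (Icc 0 t₁) :=
  continuousOn_intervalIntegral hab.le
    (F := fun p t => curv a b c p t * ‖pDeriv a b c p t‖)
    ((hc.continuousOn_curv_Icc ht₁).mul (hc.continuousOn_speed ht₁))

theorem arcLength_pos (hc : IsAreaPreservingFlow S a b T c₀ c) (hab : a < b)
    (hc₀ : ContDiffOn ℝ (⊤ : ℕ∞) c₀ (Icc a b)) {t : ℝ} (ht : t ∈ timeInterval T) :
    0 < arcLength a b (fun q => c q t) :=
  PlaneCurve.arcLength_pos hab (hc.contDiffOn_slice hc₀ ht) (hc.regular t ht)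

theorem continuousOn_avg (hc : IsAreaPreservingFlow S a b T c₀ c) (hab : a < b)
    (hc₀ : ContDiffOn ℝ (⊤ : ℕ∞) c₀ (Icc a b)) {t₁ : ℝ} (ht₁ : t₁ ∈ timeInterval T) :
    ContinuousOn (avg a b c) (Icc 0 t₁) :=
  (hc.continuousOn_turning hab ht₁).div (hc.continuousOn_arcLength hab ht₁) fun _ ht =>
    (hc.arcLength_pos hab hc₀ (Icc_subset_timeInterval ht₁ ht)).ne'

theorem continuousOn_normalSpeed (hc : IsAreaPreservingFlow S a b T c₀ c) (hab : a < b)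
    (hc₀ : ContDiffOn ℝ (⊤ : ℕ∞) c₀ (Icc a b)) {t₁ : ℝ} (ht₁ : t₁ ∈ timeInterval T) :
    ContinuousOn (fun x : ℝ × ℝ => curv a b c x.1 x.2 - avg a b c x.2) (Icc a b ×ˢ Icc 0 t₁) :=
  (hc.continuousOn_curv_Icc ht₁).sub
    ((hc.continuousOn_avg hab hc₀ ht₁).comp continuousOn_snd fun _ hx => hx.2)

theorem continuousOn_slice {F : ℝ → ℝ → ℝ} {t₁ t : ℝ} (ht : t ∈ Icc 0 t₁)
    (hF : ContinuousOn (fun x : ℝ × ℝ => F x.1 x.2) (Icc a b ×ˢ Icc 0 t₁)) :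
    ContinuousOn (fun p => F p t) (Icc a b) :=
  hF.comp (f := fun p : ℝ => (p, t)) (by fun_prop) fun _ hp => ⟨hp, ht⟩

/-- The normal speed `V = κ - κ̄` has mean zero. -/
theorem integral_normalSpeed (hc : IsAreaPreservingFlow S a b T c₀ c) (hab : a < b)
    (hc₀ : ContDiffOn ℝ (⊤ : ℕ∞) c₀ (Icc a b)) {t : ℝ} (ht : t ∈ timeInterval T) :
    ∫ p in a..b, (curv a b c p t - avg a b c t) * ‖pDeriv a b c p t‖ = 0 := by
  have htm : t ∈ Icc 0 t := ⟨ht.1, le_rfl⟩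
  have h1 := continuousOn_slice (F := fun p t => curv a b c p t) htm (hc.continuousOn_curv_Icc ht)
  have h2 := continuousOn_slice (F := fun p t => ‖pDeriv a b c p t‖) htm (hc.continuousOn_speed ht)
  have hA : ContinuousOn (fun p => curv a b c p t * ‖pDeriv a b c p t‖) (Icc a b) := h1.mul h2
  have hB : ContinuousOn (fun p => avg a b c t * ‖pDeriv a b c p t‖) (Icc a b) :=
    continuousOn_const.mul h2
  simp only [sub_mul]
  rw [intervalIntegral.integral_sub (hA.intervalIntegrable_of_Icc hab.le)
    (hB.intervalIntegrable_of_Icc hab.le),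
    intervalIntegral.integral_const_mul]
  change turning a b (fun q => c q t) - turning a b (fun q => c q t) /
    arcLength a b (fun q => c q t) * arcLength a b (fun q => c q t) = 0
  rw [div_mul_cancel₀ _ (hc.arcLength_pos hab hc₀ ht).ne', sub_self]

/-- The flow agrees with `c₀` at time `0` only on `[a, b]`; this suffices because all derivatives
are taken within that interval. -/
theorem arcLength_zero (hc : IsAreaPreservingFlow S a b T c₀ c) (hab : a < b) :
    arcLength a b (fun q => c q 0) = arcLength a b c₀ := by
  apply intervalIntegral.integral_congr
  intro p hp
  rw [uIcc_of_le hab.le] at hp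
  simp only [velocity]
  rw [derivWithin_congr hc.initial (hc.initial p hp)]

theorem velocity_zero (hc : IsAreaPreservingFlow S a b T c₀ c) : ∀ p ∈ Icc a b,
    velocity a b (fun q => c q 0) p = velocity a b c₀ p := fun p hp =>
  derivWithin_congr hc.initial (hc.initial p hp)

theorem curvature_zero (hc : IsAreaPreservingFlow S a b T c₀ c) : ∀ p ∈ Icc a b,
    curvature a b (fun q => c q 0) p = curvature a b c₀ p := fun p hp => by
  have h : acceleration a b (fun q => c q 0) p = acceleration a b c₀ p :=
    derivWithin_congr hc.velocity_zero (hc.velocity_zero p hp)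
  rw [curvature_eq, curvature_eq, h, hc.velocity_zero p hp]

theorem turning_zero (hc : IsAreaPreservingFlow S a b T c₀ c) (hab : a < b) :
    turning a b (fun q => c q 0) = turning a b c₀ := by
  apply intervalIntegral.integral_congr
  intro p hp
  rw [uIcc_of_le hab.le] at hp
  simp only [hc.velocity_zero p hp, hc.curvature_zero p hp]

theorem sweptArea_zero (hc : IsAreaPreservingFlow S a b T c₀ c) (hab : a < b) :
    sweptArea a b (fun q => c q 0) = sweptArea a b c₀ := by
  rw [sweptArea, sweptArea]
  congr 1
  apply intervalIntegral.integral_congr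
  intro p hp
  rw [uIcc_of_le hab.le] at hp
  simp only [hc.velocity_zero p hp, hc.initial p hp]

/-- The length does not increase. -/
theorem arcLength_le (hc : IsAreaPreservingFlow S a b T c₀ c) (hab : a < b)
    (hc₀ : ContDiffOn ℝ (⊤ : ℕ∞) c₀ (Icc a b)) {t₁ : ℝ} (ht₁ : t₁ ∈ timeInterval T) :
    arcLength a b (fun q => c q t₁) ≤ arcLength a b c₀ := by
  rw [← hc.arcLength_zero hab]
  rcases eq_or_lt_of_le ht₁.1 with rfl | hpos
  · rfl
  have hsub : Ioo 0 t₁ ⊆ Icc 0 t₁ := Ioo_subset_Icc_self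
  have hF := hc.continuousOn_speed ht₁
  have hV := hc.continuousOn_normalSpeed hab hc₀ ht₁
  have hF' := ((hV.mul (hc.continuousOn_curv_Icc ht₁)).mul hF).neg
  have hd : ∀ t ∈ Ioo 0 t₁, HasDerivAt (fun t => arcLength a b (fun q => c q t))
      (∫ p in a..b, -((curv a b c p t - avg a b c t) * curv a b c p t * ‖pDeriv a b c p t‖)) t :=
    fun t ht => hasDerivAt_intervalIntegral_of_continuousOn hab.le isOpen_Ioo ht
      (F := fun p t => ‖pDeriv a b c p t‖) (hF.mono (prod_mono_right hsub))
      (F' := fun p t => -((curv a b c p t - avg a b c t) * curv a b c p t * ‖pDeriv a b c p t‖))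
      (hF'.mono (prod_mono_right hsub))
      fun p hp s hs => hc.hasDerivAt_speed hab hc₀ hp
        (Ioc_subset_timeInterval ht₁ (Ioo_subset_Ioc_self hs))
  obtain ⟨s, hs, hs'⟩ := exists_hasDerivAt_eq_slope _ _ hpos (hc.continuousOn_arcLength hab ht₁) hd
  have hsm := hsub hs
  have hVs := continuousOn_slice (F := fun p t => curv a b c p t - avg a b c t) hsm hV
  have hgs := continuousOn_slice (F := fun p t => ‖pDeriv a b c p t‖) hsm hF
  have hle : ∫ p in a..b, -((curv a b c p s - avg a b c s) * curv a b c p s *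
      ‖pDeriv a b c p s‖) ≤ 0 := by
    -- As `∫ V ds = 0`, replacing `κ = V + κ̄` turns `-∫ V κ ds` into `-∫ V² ds`.
    have h0 := hc.integral_normalSpeed hab hc₀ (Icc_subset_timeInterval ht₁ hsm)
    have h1 : ∫ p in a..b, -((curv a b c p s - avg a b c s) * curv a b c p s *
        ‖pDeriv a b c p s‖) = -∫ p in a..b, ((curv a b c p s - avg a b c s) ^ 2 *
        ‖pDeriv a b c p s‖) := by
      have h2 : ∀ p, (curv a b c p s - avg a b c s) * curv a b c p s * ‖pDeriv a b c p s‖ =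
          (curv a b c p s - avg a b c s) ^ 2 * ‖pDeriv a b c p s‖ +
          avg a b c s * ((curv a b c p s - avg a b c s) * ‖pDeriv a b c p s‖) := fun p => by ring
      have hA : ContinuousOn (fun p => (curv a b c p s - avg a b c s) ^ 2 *
          ‖pDeriv a b c p s‖) (Icc a b) := (hVs.pow 2).mul hgs
      have hB : ContinuousOn (fun p => avg a b c s * ((curv a b c p s - avg a b c s) *
          ‖pDeriv a b c p s‖)) (Icc a b) := continuousOn_const.mul (hVs.mul hgs)
      simp only [h2]
      rw [intervalIntegral.integral_neg, intervalIntegral.integral_add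
        (hA.intervalIntegrable_of_Icc hab.le) (hB.intervalIntegrable_of_Icc hab.le),
        intervalIntegral.integral_const_mul, h0, mul_zero, add_zero]
    rw [h1, neg_nonpos]
    exact intervalIntegral.integral_nonneg hab.le fun p _ => by positivity
  rw [hs'] at hle
  have := (div_nonpos_iff.1 hle).resolve_left (fun h => by linarith [h.2])
  linarith [this.1]

/-- The total curvature stays in `(0, 2π)`. -/
theorem turning_mem (hc : IsAreaPreservingFlow S a b T c₀ c) (hab : a < b)
    (hc₀ : ContDiffOn ℝ (⊤ : ℕ∞) c₀ (Icc a b)) (hL : arcLength a b c₀ < S.oppositeDist)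
    (h0 : 0 < turning a b c₀) (h2 : turning a b c₀ < 2 * Real.pi) {t : ℝ}
    (ht : t ∈ timeInterval T) :
    0 < turning a b (fun q => c q t) ∧ turning a b (fun q => c q t) < 2 * Real.pi := by
  have hcont := hc.continuousOn_turning hab ht
  -- By continuity, leaving `(0, 2π)` would require the value `0` or `2π`, at both of which `e^{iK}
  -- = 1`.
  have hne : ∀ s ∈ Icc 0 t, Complex.exp (turning a b (fun q => c q s) * Complex.I) ≠ 1 :=
    fun s hs => by
      have hs' := Icc_subset_timeInterval ht hs
      exact (hc.boundary s hs').exp_turning_ne_one hab (hc.contDiffOn_slice hc₀ hs')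
        (hc.regular s hs') ((hc.arcLength_le hab hc₀ hs').trans_lt hL)
  rw [← hc.turning_zero hab] at h0 h2
  constructor
  · by_contra! hcon
    obtain ⟨s, hs, hs'⟩ := intermediate_value_Icc' ht.1 hcont ⟨hcon, h0.le⟩
    refine hne s hs ?_
    simp only at hs'
    rw [hs']; simp
  · by_contra! hcon
    obtain ⟨s, hs, hs'⟩ := intermediate_value_Icc ht.1 hcont ⟨h2.le, hcon⟩
    refine hne s hs ?_
    simp only at hs'
    rw [hs']
    push_cast
    exact Complex.exp_two_pi_mul_I

/-! ### Motion of the end points along the support curve -/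

/-- The parameter on `Σ` of the initial point, as a function of the time. -/
noncomputable def leftParam (a b x₀ : ℝ) (c : ℝ → ℝ → ℂ) (t : ℝ) : ℝ :=
  x₀ + ∫ s in (0 : ℝ)..t, (curv a b c a s - avg a b c s)

/-- The parameter on `Σ` of the end point, as a function of the time. -/
noncomputable def rightParam (a b y₀ : ℝ) (c : ℝ → ℝ → ℂ) (t : ℝ) : ℝ :=
  y₀ + ∫ s in (0 : ℝ)..t, -(curv a b c b s - avg a b c s)

theorem continuousOn_time {F : ℝ → ℝ → ℝ} {t₁ p : ℝ} (hp : p ∈ Icc a b)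
    (hF : ContinuousOn (fun x : ℝ × ℝ => F x.1 x.2) (Icc a b ×ˢ Icc 0 t₁)) :
    ContinuousOn (fun t => F p t) (Icc 0 t₁) :=
  hF.comp (f := fun t : ℝ => (p, t)) (by fun_prop) fun _ ht => ⟨hp, ht⟩

section Boundary

variable {x₀ y₀ t₁ : ℝ}

theorem hasDerivWithinAt_leftParam (hc : IsAreaPreservingFlow S a b T c₀ c) (hab : a < b)
    (hc₀ : ContDiffOn ℝ (⊤ : ℕ∞) c₀ (Icc a b)) (ht₁ : t₁ ∈ timeInterval T) :
    ∀ t ∈ Icc 0 t₁, HasDerivWithinAt (leftParam a b x₀ c) (curv a b c a t - avg a b c t)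
      (Icc 0 t₁) t := fun t ht =>
  (hasDerivWithinAt_integral_Icc (continuousOn_time
    (F := fun p t => curv a b c p t - avg a b c t) (left_mem_Icc.2 hab.le)
    (hc.continuousOn_normalSpeed hab hc₀ ht₁)) t ht).const_add x₀

theorem hasDerivWithinAt_rightParam (hc : IsAreaPreservingFlow S a b T c₀ c) (hab : a < b)
    (hc₀ : ContDiffOn ℝ (⊤ : ℕ∞) c₀ (Icc a b)) (ht₁ : t₁ ∈ timeInterval T) :
    ∀ t ∈ Icc 0 t₁, HasDerivWithinAt (rightParam a b y₀ c) (-(curv a b c b t - avg a b c t))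
      (Icc 0 t₁) t := fun t ht =>
  (hasDerivWithinAt_integral_Icc (continuousOn_time
    (F := fun p t => curv a b c p t - avg a b c t) (right_mem_Icc.2 hab.le)
    (hc.continuousOn_normalSpeed hab hc₀ ht₁)).neg t ht).const_add y₀

/-- At the initial point the normal `i τ` is the tangent of `Σ`, so this point moves along `Σ` with
signed speed `V`. At the end point the normal is minus the tangent, whence the sign in `rightParam`.
-/
theorem flow_left (hc : IsAreaPreservingFlow S a b T c₀ c) (hab : a < b)
    (hc₀ : ContDiffOn ℝ (⊤ : ℕ∞) c₀ (Icc a b)) (ht₁ : t₁ ∈ timeInterval T)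
    (hx : S.f x₀ = c₀ a) : ∀ t ∈ Icc 0 t₁, c a t = S.f (leftParam a b x₀ c t) := by
  have ham := left_mem_Icc.2 hab.le
  refine S.eq_comp_of_hasDerivWithinAt (continuousOn_time
    (F := fun p t => curv a b c p t - avg a b c t) ham (hc.continuousOn_normalSpeed hab hc₀ ht₁))
    (fun t ht => (hc.boundary t (Icc_subset_timeInterval ht₁ ht)).left_mem) (fun t ht => ?_)
    (by rw [hc.initial a ham, hx])
  have ht' := Icc_subset_timeInterval ht₁ ht
  rw [(hc.boundary t ht').tangentAt_left (hc.regular t ht' a ham)]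
  exact (hc.flow a ham t ht').mono (Icc_subset_timeInterval ht₁)

theorem flow_right (hc : IsAreaPreservingFlow S a b T c₀ c) (hab : a < b)
    (hc₀ : ContDiffOn ℝ (⊤ : ℕ∞) c₀ (Icc a b)) (ht₁ : t₁ ∈ timeInterval T)
    (hy : S.f y₀ = c₀ b) : ∀ t ∈ Icc 0 t₁, c b t = S.f (rightParam a b y₀ c t) := by
  have hbm := right_mem_Icc.2 hab.le
  refine S.eq_comp_of_hasDerivWithinAt (continuousOn_time
    (F := fun p t => curv a b c p t - avg a b c t) hbm
      (hc.continuousOn_normalSpeed hab hc₀ ht₁)).neg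
    (fun t ht => (hc.boundary t (Icc_subset_timeInterval ht₁ ht)).right_mem) (fun t ht => ?_)
    (by rw [hc.initial b hbm, hy])
  have ht' := Icc_subset_timeInterval ht₁ ht
  rw [(hc.boundary t ht').tangentAt_right (hc.regular t ht' b hbm)]
  refine ((hc.flow b hbm t ht').mono (Icc_subset_timeInterval ht₁)).congr_deriv ?_
  rw [normal, neg_mul, smul_neg, neg_smul, neg_neg]
  rfl

theorem tangent_left (hc : IsAreaPreservingFlow S a b T c₀ c) (hab : a < b)
    (hc₀ : ContDiffOn ℝ (⊤ : ℕ∞) c₀ (Icc a b)) (ht₁ : t₁ ∈ timeInterval T)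
    (hx : S.f x₀ = c₀ a) : ∀ t ∈ Icc 0 t₁, Complex.I * tangent a b (fun q => c q t) a =
      deriv S.f (leftParam a b x₀ c t) := by
  intro t ht
  have ham := left_mem_Icc.2 hab.le
  have ht' := Icc_subset_timeInterval ht₁ ht
  rw [← S.tangentAt_f, ← hc.flow_left hab hc₀ ht₁ hx t ht,
    (hc.boundary t ht').tangentAt_left (hc.regular t ht' a ham)]

theorem tangent_right (hc : IsAreaPreservingFlow S a b T c₀ c) (hab : a < b)
    (hc₀ : ContDiffOn ℝ (⊤ : ℕ∞) c₀ (Icc a b)) (ht₁ : t₁ ∈ timeInterval T)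
    (hy : S.f y₀ = c₀ b) : ∀ t ∈ Icc 0 t₁, -Complex.I * tangent a b (fun q => c q t) b =
      deriv S.f (rightParam a b y₀ c t) := by
  intro t ht
  have hbm := right_mem_Icc.2 hab.le
  have ht' := Icc_subset_timeInterval ht₁ ht
  rw [← S.tangentAt_f, ← hc.flow_right hab hc₀ ht₁ hy t ht,
    (hc.boundary t ht').tangentAt_right (hc.regular t ht' b hbm)]

/-- The Neumann condition for the curvature at the initial point. -/
theorem pDeriv_curv_left (hc : IsAreaPreservingFlow S a b T c₀ c) (hab : a < b)
    (hc₀ : ContDiffOn ℝ (⊤ : ℕ∞) c₀ (Icc a b)) (ht₁ : t₁ ∈ timeInterval T)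
    (hx : S.f x₀ = c₀ a) {t : ℝ} (ht : t ∈ Ioc 0 t₁) :
    pDeriv a b (curv a b c) a t / ‖pDeriv a b c a t‖ =
      S.curv (leftParam a b x₀ c t) * (curv a b c a t - avg a b c t) := by
  have ham := left_mem_Icc.2 hab.le
  have htm := Ioc_subset_Icc_self ht
  have htU := Ioc_subset_timeInterval ht₁ ht
  -- The identity `i τ = f'(σ)` at the initial point is differentiated in time in two ways: the
  -- tangent turns at the rate `κ_p / |c_p|`, the tangent of `Σ` at the rate `κ_Σ V`.
  have h1 := ((hc.hasDerivAt_tangent hab hc₀ ham htU).const_mul Complex.I).hasDerivWithinAt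
    (s := Icc 0 t₁)
  have h2 := ((S.hasDerivAt_deriv _).scomp_hasDerivWithinAt t
    (hc.hasDerivWithinAt_leftParam hab hc₀ ht₁ (x₀ := x₀) t htm)).congr
    (hc.tangent_left hab hc₀ ht₁ hx) (hc.tangent_left hab hc₀ ht₁ hx t htm)
  have h3 := (uniqueDiffOn_Icc (ht.1.trans_le ht.2) t htm).eq_deriv _ h1 h2
  rw [← hc.tangent_left hab hc₀ ht₁ hx t htm, Complex.real_smul] at h3
  have h4 := hc.tangent_mul_conj ham htU.1
  have h5 : ((pDeriv a b (curv a b c) a t / ‖pDeriv a b c a t‖ : ℝ) : ℂ) =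
      ((S.curv (leftParam a b x₀ c t) * (curv a b c a t - avg a b c t) : ℝ) : ℂ) := by
    generalize pDeriv a b (curv a b c) a t / ‖pDeriv a b c a t‖ = u at *
    rw [Complex.ofReal_mul]
    linear_combination (-conj (tangent a b (fun q => c q t) a)) * h3 +
      ((S.curv (leftParam a b x₀ c t) : ℂ) * ((curv a b c a t - avg a b c t : ℝ) : ℂ) - u) * h4 +
      ((u : ℂ) - (S.curv (leftParam a b x₀ c t) : ℂ) * ((curv a b c a t - avg a b c t : ℝ) : ℂ)) *
        tangent a b (fun q => c q t) a * conj (tangent a b (fun q => c q t) a) * Complex.I_sq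
  exact_mod_cast h5

/-- The Neumann condition for the curvature at the end point. -/
theorem pDeriv_curv_right (hc : IsAreaPreservingFlow S a b T c₀ c) (hab : a < b)
    (hc₀ : ContDiffOn ℝ (⊤ : ℕ∞) c₀ (Icc a b)) (ht₁ : t₁ ∈ timeInterval T)
    (hy : S.f y₀ = c₀ b) {t : ℝ} (ht : t ∈ Ioc 0 t₁) :
    pDeriv a b (curv a b c) b t / ‖pDeriv a b c b t‖ =
      S.curv (rightParam a b y₀ c t) * -(curv a b c b t - avg a b c t) := by
  have hbm := right_mem_Icc.2 hab.le
  have htm := Ioc_subset_Icc_self ht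
  have htU := Ioc_subset_timeInterval ht₁ ht
  have h1 := ((hc.hasDerivAt_tangent hab hc₀ hbm htU).const_mul (-Complex.I)).hasDerivWithinAt
    (s := Icc 0 t₁)
  have h2 := ((S.hasDerivAt_deriv _).scomp_hasDerivWithinAt t
    (hc.hasDerivWithinAt_rightParam hab hc₀ ht₁ (y₀ := y₀) t htm)).congr
    (hc.tangent_right hab hc₀ ht₁ hy) (hc.tangent_right hab hc₀ ht₁ hy t htm)
  have h3 := (uniqueDiffOn_Icc (ht.1.trans_le ht.2) t htm).eq_deriv _ h1 h2
  rw [← hc.tangent_right hab hc₀ ht₁ hy t htm, Complex.real_smul] at h3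
  have h4 := hc.tangent_mul_conj hbm htU.1
  have h5 : ((pDeriv a b (curv a b c) b t / ‖pDeriv a b c b t‖ : ℝ) : ℂ) =
      ((S.curv (rightParam a b y₀ c t) * -(curv a b c b t - avg a b c t) : ℝ) : ℂ) := by
    generalize pDeriv a b (curv a b c) b t / ‖pDeriv a b c b t‖ = u at *
    rw [Complex.ofReal_mul]
    linear_combination (conj (tangent a b (fun q => c q t) b)) * h3 +
      ((S.curv (rightParam a b y₀ c t) : ℂ) * ((-(curv a b c b t - avg a b c t) : ℝ) : ℂ) - u) * h4 +
      ((u : ℂ) - (S.curv (rightParam a b y₀ c t) : ℂ) *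
        ((-(curv a b c b t - avg a b c t) : ℝ) : ℂ)) *
        tangent a b (fun q => c q t) b * conj (tangent a b (fun q => c q t) b) * Complex.I_sq
  exact_mod_cast h5

end Boundary

/-! ### Preservation of convexity and of the enclosed area -/

/-- Convexity is preserved. -/
theorem curv_nonneg (hc : IsAreaPreservingFlow S a b T c₀ c) (hab : a < b)
    (hc₀ : ContDiffOn ℝ (⊤ : ℕ∞) c₀ (Icc a b)) {x₀ y₀ t₁ : ℝ} (ht₁ : t₁ ∈ timeInterval T)
    (hx : S.f x₀ = c₀ a) (hy : S.f y₀ = c₀ b) (hκ : ∀ p ∈ Icc a b, 0 ≤ curvature a b c₀ p)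
    (havg : ∀ t ∈ Icc 0 t₁, 0 < avg a b c t) :
    ∀ t ∈ Icc 0 t₁, ∀ p ∈ Icc a b, 0 ≤ curv a b c p t := by
  have hU := isOpen_timeInterval_diff T
  have hκs := hc.smoothOnStrip_curv hab
  have hI := Ioc_subset_timeInterval ht₁
  have hcomp : IsCompact (Icc a b ×ˢ Icc 0 t₁) := isCompact_Icc.prod isCompact_Icc
  have hg := hc.continuousOn_speed ht₁
  have hg0 : ∀ x ∈ Icc a b ×ˢ Icc 0 t₁, ‖pDeriv a b c x.1 x.2‖ ≠ 0 := fun x hx =>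
    norm_ne_zero_iff.2 (hc.velocity_ne_zero hx.1 (Icc_subset_timeInterval ht₁ hx.2))
  have hv : ContinuousOn (fun x : ℝ × ℝ => pDeriv a b c x.1 x.2) (Icc a b ×ˢ Icc 0 t₁) :=
    hc.continuous_velocity.mono (prod_mono_right (Icc_subset_timeInterval ht₁))
  have hw : ContinuousOn (fun x : ℝ × ℝ => pDeriv a b (pDeriv a b c) x.1 x.2)
      (Icc a b ×ˢ Icc 0 t₁) :=
    hc.continuous_acceleration.mono (prod_mono_right (Icc_subset_timeInterval ht₁))
  have hV := hc.continuousOn_normalSpeed hab hc₀ ht₁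
  -- The coefficients involve `c` only through its first two `p`-derivatives, continuous up to time
  -- `0`, and are therefore bounded on the compact rectangle.
  obtain ⟨M₁, hM₁⟩ := hcomp.exists_bound_of_continuousOn
    (f := fun x : ℝ × ℝ => 1 / ‖pDeriv a b c x.1 x.2‖ ^ 2)
    (continuousOn_const.div (hg.pow 2) fun x hx => pow_ne_zero 2 (hg0 x hx))
  obtain ⟨M₂, hM₂⟩ := hcomp.exists_bound_of_continuousOn
    (f := fun x : ℝ × ℝ => -((pDeriv a b (pDeriv a b c) x.1 x.2 *
      conj (pDeriv a b c x.1 x.2)).re / ‖pDeriv a b c x.1 x.2‖ ^ 4))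
    ((Complex.continuous_re.comp_continuousOn (hw.mul
      (Complex.continuous_conj.comp_continuousOn hv))).div (hg.pow 4)
      fun x hx => pow_ne_zero 4 (hg0 x hx)).neg
  obtain ⟨M₃, hM₃⟩ := hcomp.exists_bound_of_continuousOn
    (f := fun x : ℝ × ℝ => (curv a b c x.1 x.2 - avg a b c x.2) * curv a b c x.1 x.2)
    (hV.mul (hc.continuousOn_curv_Icc ht₁))
  have hM : ∀ t ∈ Ioc 0 t₁, ∀ p ∈ Icc a b, (p, t) ∈ Icc a b ×ˢ Icc 0 t₁ := fun t ht p hp =>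
    ⟨hp, Ioc_subset_Icc_self ht⟩
  refine nonneg_of_parabolic (M := max M₁ (max M₂ M₃)) hab (hc.continuousOn_curv_Icc ht₁)
    (fun p hp => (hκ p hp).trans_eq (hc.curvature_zero p hp).symm)
    (fun t ht p hp => hκs.hasDerivWithinAt hp (hI ht))
    (fun t ht p hp => (hκs.pDeriv hab hU).hasDerivWithinAt hp (hI ht))
    (fun t ht p hp => hc.hasDerivAt_curv hab hc₀ hp (hI ht))
    (A := fun p t => 1 / ‖pDeriv a b c p t‖ ^ 2)
    (B := fun p t => -((pDeriv a b (pDeriv a b c) p t * conj (pDeriv a b c p t)).re /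
      ‖pDeriv a b c p t‖ ^ 4))
    (C := fun p t => (curv a b c p t - avg a b c t) * curv a b c p t)
    (fun t ht p hp => rfl)
    (fun t ht p hp => ⟨by positivity, (le_abs_self _).trans
      ((hM₁ (p, t) (hM t ht p hp)).trans (le_max_left _ _))⟩)
    (fun t ht p hp => (hM₂ (p, t) (hM t ht p hp)).trans
      ((le_max_left _ _).trans (le_max_right _ _)))
    (fun t ht p hp => (hM₃ (p, t) (hM t ht p hp)).trans
      ((le_max_right _ _).trans (le_max_right _ _)))
    (fun t ht hneg => ?_) (fun t ht hneg => ?_)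
  -- If `κ < 0` then `κ - κ̄ < 0` because `κ̄ > 0`, and the Neumann condition with `κ_Σ ≥ 0` gives
  -- the sign of `κ_p`; the other end differs only in sign.
  · have ham := left_mem_Icc.2 hab.le
    have h1 := hc.pDeriv_curv_left hab hc₀ ht₁ hx ht
    have hn : 0 < ‖pDeriv a b c a t‖ :=
      norm_pos_iff.2 (hc.velocity_ne_zero ham (hI ht).1)
    rw [div_eq_iff hn.ne'] at h1
    rw [h1]
    exact mul_nonpos_of_nonpos_of_nonneg (mul_nonpos_of_nonneg_of_nonpos (S.curv_nonneg _)
      (by linarith [havg t (Ioc_subset_Icc_self ht)])) hn.le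
  · have hbm := right_mem_Icc.2 hab.le
    have h1 := hc.pDeriv_curv_right hab hc₀ ht₁ hy ht
    have hn : 0 < ‖pDeriv a b c b t‖ :=
      norm_pos_iff.2 (hc.velocity_ne_zero hbm (hI ht).1)
    rw [div_eq_iff hn.ne'] at h1
    rw [h1]
    exact mul_nonneg (mul_nonneg (S.curv_nonneg _)
      (by linarith [havg t (Ioc_subset_Icc_self ht)])) hn.le

/-- The area enclosed by the curve and the support curve is preserved. -/
theorem area_eq (hc : IsAreaPreservingFlow S a b T c₀ c) (hab : a < b)
    (hc₀ : ContDiffOn ℝ (⊤ : ℕ∞) c₀ (Icc a b)) {x₀ y₀ t₁ : ℝ} (ht₁ : t₁ ∈ timeInterval T)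
    (hx : S.f x₀ = c₀ a) (hy : S.f y₀ = c₀ b) :
    sweptArea a b (fun q => c q t₁) - (1 / 2) *
      (∫ x in leftParam a b x₀ c t₁..rightParam a b y₀ c t₁,
        ((S.f x).re * (deriv S.f x).im - (S.f x).im * (deriv S.f x).re)) =
    sweptArea a b c₀ - (1 / 2) *
      ∫ x in x₀..y₀, ((S.f x).re * (deriv S.f x).im - (S.f x).im * (deriv S.f x).re) := by
  have ham := left_mem_Icc.2 hab.le
  have hbm := right_mem_Icc.2 hab.le
  have hl0 : leftParam a b x₀ c 0 = x₀ := by simp [leftParam]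
  have hr0 : rightParam a b y₀ c 0 = y₀ := by simp [rightParam]
  rcases eq_or_lt_of_le ht₁.1 with rfl | hpos
  · rw [hl0, hr0, hc.sweptArea_zero hab]
  have hU := isOpen_timeInterval_diff T
  set W : ℝ → ℝ := fun x => (S.f x).re * (deriv S.f x).im - (S.f x).im * (deriv S.f x).re with hW
  have hWc : Continuous W := S.continuous_wedge
  let Φ : ℝ → ℝ := fun x => ∫ s in (0 : ℝ)..x, W s
  have hΦ : ∀ x, HasDerivAt Φ (W x) x := fun x =>
    intervalIntegral.integral_hasDerivAt_right (hWc.intervalIntegrable _ _)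
      (hWc.stronglyMeasurableAtFilter _ _) hWc.continuousAt
  have hΦi : ∀ x y, ∫ s in x..y, W s = Φ y - Φ x := fun x y =>
    (intervalIntegral.integral_interval_sub_left (hWc.intervalIntegrable _ _)
      (hWc.intervalIntegrable _ _)).symm
  have hWim : ∀ x, W x = (conj (S.f x) * deriv S.f x).im := fun x =>
    (SupportCurve.im_conj_mul _ _).symm
  let V : ℝ → ℝ → ℝ := fun p t => curv a b c p t - avg a b c t
  have hswept : ∀ t, sweptArea a b (fun q => c q t) =
      (1 / 2) * ∫ p in a..b, (conj (c p t) * pDeriv a b c p t).im := fun t => by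
    simp only [SupportCurve.im_conj_mul]; rfl
  let G : ℝ → ℝ := fun t => sweptArea a b (fun q => c q t) -
    (1 / 2) * (Φ (rightParam a b y₀ c t) - Φ (leftParam a b x₀ c t))
  have hlc : ContinuousOn (leftParam a b x₀ c) (Icc 0 t₁) := fun t ht =>
    (hc.hasDerivWithinAt_leftParam hab hc₀ ht₁ t ht).continuousWithinAt
  have hrc : ContinuousOn (rightParam a b y₀ c) (Icc 0 t₁) := fun t ht =>
    (hc.hasDerivWithinAt_rightParam hab hc₀ ht₁ t ht).continuousWithinAt
  have hΦc : Continuous Φ := continuous_iff_continuousAt.2 fun x => (hΦ x).continuousAt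
  have hGc : ContinuousOn G (Icc 0 t₁) := by
    refine ContinuousOn.sub ?_ (continuousOn_const.mul
      ((hΦc.comp_continuousOn hrc).sub (hΦc.comp_continuousOn hlc)))
    simp only [hswept]
    refine continuousOn_const.mul (continuousOn_intervalIntegral hab.le
      (F := fun p t => (conj (c p t) * pDeriv a b c p t).im) ?_)
    have hsub : Icc a b ×ˢ Icc 0 t₁ ⊆ Icc a b ×ˢ timeInterval T :=
      prod_mono_right (Icc_subset_timeInterval ht₁)
    exact Complex.continuous_im.comp_continuousOn
      ((Complex.continuous_conj.comp_continuousOn (hc.continuous.mono hsub)).mul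
        (hc.continuous_velocity.mono hsub))
  have hGd : ∀ t ∈ Ioo 0 t₁, HasDerivAt G 0 t := by
    intro t ht
    have htm := Ioo_subset_Icc_self ht
    have htU := Ioc_subset_timeInterval ht₁ (Ioo_subset_Ioc_self ht)
    have hs := hc.smoothOnStrip
    have hvs := hs.pDeriv hab hU
    have hconjd : ∀ p ∈ Icc a b, ∀ s ∈ timeInterval T \ {0},
        HasDerivAt (fun s => (conj (c p s) * pDeriv a b c p s).im)
          ((conj (tDeriv c p s) * pDeriv a b c p s +
            conj (c p s) * tDeriv (pDeriv a b c) p s).im) s := fun p hp s hs' => by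
      have h1 : HasDerivAt (fun s => conj (c p s)) (conj (tDeriv c p s)) s :=
        Complex.conjCLE.toContinuousLinearMap.hasFDerivAt.comp_hasDerivAt s
          (hs.hasDerivAt hU hp hs')
      exact Complex.imCLM.hasFDerivAt.comp_hasDerivAt s
        (h1.fun_mul (hvs.hasDerivAt hU hp hs'))
    have hcc := ContDiffOn.continuousOn hs
    have hvc := ContDiffOn.continuousOn hvs
    have h1 := hasDerivAt_intervalIntegral_of_continuousOn hab.le hU htU
      (F := fun p t => (conj (c p t) * pDeriv a b c p t).im)
      (F' := fun p s => (conj (tDeriv c p s) * pDeriv a b c p s +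
            conj (c p s) * tDeriv (pDeriv a b c) p s).im)
      (Complex.continuous_im.comp_continuousOn
        ((Complex.continuous_conj.comp_continuousOn hcc).mul hvc))
      (Complex.continuous_im.comp_continuousOn
        (((Complex.continuous_conj.comp_continuousOn
          (ContDiffOn.continuousOn (hs.tDeriv hab hU))).mul hvc).add
        ((Complex.continuous_conj.comp_continuousOn hcc).mul
          (ContDiffOn.continuousOn (hvs.tDeriv hab hU)))))
      hconjd
    let N : ℝ → ℂ := fun q => ((V q t : ℝ) : ℂ) * (Complex.I * tangent a b (fun q => c q t) q)
    have hNt : ∀ q ∈ Icc a b, tDeriv c q t = N q := fun q hq => (hc.hasDerivAt_time hq htU).deriv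
    have hNp : ∀ q ∈ Icc a b, HasDerivWithinAt N (tDeriv (pDeriv a b c) q t) (Icc a b) q :=
      fun q hq => by
        rw [tDeriv, (hc.hasDerivAt_velocity hab hc₀ hq htU).deriv]
        exact hc.hasDerivWithinAt_normalVelocity hab hc₀ hq htU
    have hPd : ∀ q ∈ Icc a b, HasDerivWithinAt (fun q => (conj (c q t) * N q).im)
        ((conj (pDeriv a b c q t) * N q + conj (c q t) * tDeriv (pDeriv a b c) q t).im)
        (Icc a b) q := fun q hq => by
      have h1 : HasDerivWithinAt (fun q => conj (c q t)) (conj (pDeriv a b c q t)) (Icc a b) q :=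
        Complex.conjCLE.toContinuousLinearMap.hasFDerivAt.comp_hasDerivWithinAt q
          (hs.hasDerivWithinAt hq htU)
      exact Complex.imCLM.hasFDerivAt.comp_hasDerivWithinAt q (h1.fun_mul (hNp q hq))
    have hslice : ∀ {H : ℝ → ℝ → ℂ}, SmoothOnStrip a b (timeInterval T \ {0}) H →
        ContinuousOn (fun q => H q t) (Icc a b) := fun {H} hH =>
      (ContDiffOn.continuousOn hH).comp (f := fun q : ℝ => (q, t)) (by fun_prop)
        fun q hq => ⟨hq, htU⟩
    have hNc : ContinuousOn N (Icc a b) := fun q hq => (hNp q hq).continuousWithinAt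
    have hPc : ContinuousOn (fun q => (conj (pDeriv a b c q t) * N q +
        conj (c q t) * tDeriv (pDeriv a b c) q t).im) (Icc a b) :=
      Complex.continuous_im.comp_continuousOn
        (((Complex.continuous_conj.comp_continuousOn (hslice hvs)).mul hNc).add
        ((Complex.continuous_conj.comp_continuousOn (hslice hs)).mul
          (hslice (hvs.tDeriv hab hU))))
    have hPi := integral_eq_sub_of_hasDerivWithinAt hab.le hPd hPc
    have hVc : ContinuousOn (fun q => V q t * ‖pDeriv a b c q t‖) (Icc a b) :=
      (continuousOn_slice (F := V) htm (hc.continuousOn_normalSpeed hab hc₀ ht₁)).mul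
        (hslice hvs).norm
    have hNv : ∀ q ∈ Icc a b, (conj (pDeriv a b c q t) * N q).im =
        V q t * ‖pDeriv a b c q t‖ := fun q hq => by
      have h1 := hc.deriv_velocity_mul_conj hq htU.1 (((V q t : ℝ) : ℂ) * Complex.I)
      have h2 : conj (pDeriv a b c q t) * N q = ((‖pDeriv a b c q t‖ * V q t : ℝ) : ℂ) * Complex.I := by
        push_cast
        linear_combination h1
      rw [h2, Complex.im_ofReal_mul, Complex.I_im]
      ring
    -- Integration by parts in `p` moves the derivative off the normal velocity; the remaining
    -- interior term is `-2 ∫ V ds = 0`.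
    have hI : ∫ q in a..b, ((conj (tDeriv c q t) * pDeriv a b c q t +
        conj (c q t) * tDeriv (pDeriv a b c) q t).im) =
        (conj (c b t) * N b).im - (conj (c a t) * N a).im := by
      rw [← hPi]
      have h2 : ∫ q in a..b, ((conj (tDeriv c q t) * pDeriv a b c q t +
          conj (c q t) * tDeriv (pDeriv a b c) q t).im) =
          ∫ q in a..b, ((conj (pDeriv a b c q t) * N q +
            conj (c q t) * tDeriv (pDeriv a b c) q t).im -
            2 * (V q t * ‖pDeriv a b c q t‖)) := by
        apply intervalIntegral.integral_congr
        intro q hq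
        rw [uIcc_of_le hab.le] at hq
        have h3 := hNv q hq
        have h4 : (conj (tDeriv c q t) * pDeriv a b c q t).im =
            -(conj (pDeriv a b c q t) * N q).im := by
          rw [hNt q hq, ← Complex.conj_im]
          simp only [map_mul, Complex.conj_conj]
          rw [mul_comm]
        simp only [Complex.add_im]
        rw [h4, h3]
        ring
      have hB : ContinuousOn (fun q => 2 * (V q t * ‖pDeriv a b c q t‖)) (Icc a b) :=
        continuousOn_const.mul hVc
      rw [h2, intervalIntegral.integral_sub (hPc.intervalIntegrable_of_Icc hab.le)
        (hB.intervalIntegrable_of_Icc hab.le),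
        intervalIntegral.integral_const_mul, hc.integral_normalSpeed hab hc₀ htU.1, mul_zero,
        sub_zero]
    -- The remaining boundary terms are exactly the rates at which the line integral over the arc of
    -- `Σ` changes as its end parameters move, so they cancel in `G'`.
    have hNa : (conj (c a t) * N a).im = V a t * W (leftParam a b x₀ c t) := by
      simp only [N]
      rw [hc.tangent_left hab hc₀ ht₁ hx t htm, hc.flow_left hab hc₀ ht₁ hx t htm, hWim,
        ← Complex.im_ofReal_mul]
      congr 1
      ring
    have hNb : (conj (c b t) * N b).im = -(V b t * W (rightParam a b y₀ c t)) := by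
      have h2 := hc.tangent_right hab hc₀ ht₁ hy t htm
      rw [hc.flow_right hab hc₀ ht₁ hy t htm, hWim, ← h2, ← Complex.im_ofReal_mul,
        ← Complex.neg_im]
      congr 1
      simp only [N]
      ring
    have hld := (hc.hasDerivWithinAt_leftParam hab hc₀ ht₁ (x₀ := x₀) t htm).hasDerivAt
      (Icc_mem_nhds ht.1 ht.2)
    have hrd := (hc.hasDerivWithinAt_rightParam hab hc₀ ht₁ (y₀ := y₀) t htm).hasDerivAt
      (Icc_mem_nhds ht.1 ht.2)
    have hfin := (h1.const_mul (1 / 2)).sub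
      ((((hΦ _).comp t hrd).sub ((hΦ _).comp t hld)).const_mul (1 / 2))
    refine (hfin.congr_of_eventuallyEq (.of_forall fun s => ?_)).congr_deriv ?_
    · simp only [G, hswept]; rfl
    · rw [hI, hNa, hNb]
      simp only [V]
      ring
  obtain ⟨s, hs, hs'⟩ := exists_hasDerivAt_eq_slope G (fun _ => 0) hpos hGc hGd
  have h1 : G t₁ = G 0 := by
    have h2 := (div_eq_zero_iff.1 hs'.symm).resolve_right (by linarith)
    linarith
  simp only [G, hl0, hr0] at h1
  rw [hΦi, hΦi, h1, hc.sweptArea_zero hab]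

end IsAreaPreservingFlow

/-! ### The curvature bounds -/

namespace IsAreaPreservingFlow

open PlaneCurve

variable {S : SupportCurve} {a b : ℝ} {T : EReal} {c₀ : ℝ → ℂ} {c : ℝ → ℝ → ℂ}

/-- As long as the flow exists, the total curvature is at least `π` and the two end points do not
collide. -/
theorem pi_le_turning (hc : IsAreaPreservingFlow S a b T c₀ c) (hc₀ : S.IsInitialCurve a b c₀)
    {x₀ y₀ : ℝ} (hx : S.f x₀ = c₀ a) (hy : S.f y₀ = c₀ b)
    (hκ : ∀ p ∈ Icc a b, 0 ≤ curvature a b c₀ p) (hL : arcLength a b c₀ < S.oppositeDist)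
    (h0 : 0 < turning a b c₀) (h2 : turning a b c₀ < 2 * Real.pi) {t : ℝ}
    (ht : t ∈ timeInterval T) :
    Real.pi ≤ turning a b (fun q => c q t) ∧ c a t ≠ c b t := by
  have hmem := fun s (hs : s ∈ Icc 0 t) => hc.turning_mem hc₀.lt hc₀.smooth hL h0 h2
    (Icc_subset_timeInterval ht hs)
  have htm : t ∈ Icc 0 t := ⟨ht.1, le_rfl⟩
  -- The crude bound `K > 0` already gives `κ̄ > 0`, which preserves convexity; convexity in turn
  -- sharpens the bound to `K ≥ π`.
  have hnonneg := hc.curv_nonneg hc₀.lt hc₀.smooth ht hx hy hκ fun s hs =>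
    div_pos (hmem s hs).1 (hc.arcLength_pos hc₀.lt hc₀.smooth (Icc_subset_timeInterval ht hs))
  have h := (hc.boundary t ht).pi_le_turning hc₀.lt (hc.contDiffOn_slice hc₀.smooth ht)
    (hc.regular t ht) (hnonneg t htm) (hmem t htm).1
  exact ⟨h.1, h.2 (hmem t htm).2⟩

end IsAreaPreservingFlow

theorem mainTheorem6 (S : SupportCurve) (a b : ℝ) (T : EReal) (c₀ : ℝ → ℂ) (c : ℝ → ℝ → ℂ)
    (hc₀ : S.IsInitialCurve a b c₀)
    (hc : IsAreaPreservingFlow S a b T c₀ c)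
    (hκ : ∀ p ∈ Set.Icc a b, 0 < PlaneCurve.curvature a b c₀ p)
    (hinj : Set.InjOn c₀ (Set.Icc a b))
    (hout : ∀ p ∈ Set.Ioo a b, c₀ p ∈ S.outerDomain)
    (hL : PlaneCurve.arcLength a b c₀ < S.oppositeDist) :
    ∀ t ∈ timeInterval T,
      Real.pi / PlaneCurve.arcLength a b c₀ ≤ PlaneCurve.meanCurvature a b (fun p => c p t) ∧
      PlaneCurve.meanCurvature a b (fun p => c p t) ≤
        (PlaneCurve.arcLength a b c₀ + 2 * Metric.diam S.trace) * Real.pi /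
          (2 * S.enclosedArea a b c₀) := by
  intro t ht
  have hpi := Real.pi_pos
  have hab := hc₀.lt
  have hsm := hc₀.smooth
  obtain ⟨hK, hK2, hxy, hx, hy, hA⟩ := S.initial_curve hc₀ hκ hinj hout hL
  have hK0 := hpi.trans_le hK
  set x₀ := S.startParam a c₀ with hx₀
  set y₀ := S.endParam a b c₀ with hy₀
  have hmain := fun s (hs : s ∈ Icc 0 t) => hc.pi_le_turning hc₀ hx hy (fun p hp => (hκ p hp).le)
    hL hK0 hK2 (Icc_subset_timeInterval ht hs)
  have htm : t ∈ Icc 0 t := ⟨ht.1, le_rfl⟩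
  have hfl := hc.flow_left hab hsm ht hx
  have hfr := hc.flow_right hab hsm ht hy
  -- The arc of `Σ` must keep its positive direction for the area estimate. If the two parameters
  -- ever met, the end points of the curve would coincide.
  have hparam : IsAreaPreservingFlow.leftParam a b x₀ c t ≤
      IsAreaPreservingFlow.rightParam a b y₀ c t := by
    have hcont : ContinuousOn (fun s => IsAreaPreservingFlow.rightParam a b y₀ c s -
        IsAreaPreservingFlow.leftParam a b x₀ c s) (Icc 0 t) := fun s hs =>
      ((hc.hasDerivWithinAt_rightParam hab hsm ht s hs).continuousWithinAt).sub
        (hc.hasDerivWithinAt_leftParam hab hsm ht s hs).continuousWithinAt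
    by_contra! hcon
    obtain ⟨s, hs, hs'⟩ := intermediate_value_Icc' ht.1 hcont (show (0 : ℝ) ∈ _ from
      ⟨by linarith, by simp [IsAreaPreservingFlow.leftParam, IsAreaPreservingFlow.rightParam,
        hxy.le]⟩)
    refine (hmain s hs).2 ?_
    rw [hfl s hs, hfr s hs, sub_eq_zero.1 hs']
  have harea := SupportCurve.sweptArea_sub_le hab (hc.contDiffOn_slice hsm ht)
    (hfl t htm).symm (hfr t htm).symm hparam
  rw [hc.area_eq hab hsm ht hx hy, hx₀, hy₀, ← S.sweptArea_boundaryCurve] at harea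
  change S.enclosedArea a b c₀ ≤ _ at harea
  have hLpos := hc.arcLength_pos hab hsm ht
  have hLle := hc.arcLength_le hab hsm ht
  have hturn := (hc.turning_mem hab hsm hL hK0 hK2 ht).2
  have hturn' := (hmain t htm).1
  have hd : 0 ≤ Metric.diam S.trace := Metric.diam_nonneg
  change _ ≤ PlaneCurve.turning a b (fun q => c q t) / PlaneCurve.arcLength a b (fun q => c q t) ∧
    PlaneCurve.turning a b (fun q => c q t) / PlaneCurve.arcLength a b (fun q => c q t) ≤ _
  generalize PlaneCurve.arcLength a b (fun q => c q t) = L at *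
  generalize PlaneCurve.turning a b (fun q => c q t) = K at *
  refine ⟨div_le_div₀ (hpi.le.trans hturn') hturn' hLpos hLle, ?_⟩
  rw [div_le_div_iff₀ hLpos (by positivity)]
  -- The area estimate is quadratic in the current length; only one factor is replaced by `L₀`,
  -- since the other cancels the `L` in `κ̄ = K / L`.
  have h1 : 4 * S.enclosedArea a b c₀ ≤
      L * (PlaneCurve.arcLength a b c₀ + 2 * Metric.diam S.trace) := by
    nlinarith [mul_le_mul_of_nonneg_left hLle hLpos.le]
  calc K * (2 * S.enclosedArea a b c₀) ≤ 2 * Real.pi * (2 * S.enclosedArea a b c₀) := by gcongr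
    _ = Real.pi * (4 * S.enclosedArea a b c₀) := by ring
    _ ≤ Real.pi * (L * (PlaneCurve.arcLength a b c₀ + 2 * Metric.diam S.trace)) := by gcongr
    _ = _ := by ring
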